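/- Let $(\Omega,\mathscr G,P)$ be a probability space, and let $L^0$ and $\bar L^0$ be the spaces of $\mathscr G$-measurable random variables with values in $\mathbb R$ and in $[-\infty,\infty]$, modulo $P$-a.s. equality and ordered a.s.; $L^0_{++}$ is the set of $\lambda\in L^0$ with $\lambda>0$ a.s. The ring $L^0$ carries the topology generated by the balls $\{n:|m-n|\le\varepsilon\}$, $m\in L^0$, $\varepsilon\in L^0_{++}$. In $\bar L^0$ we set $0\cdot(\pm\infty)=0$ and $\infty-\infty=-\infty$. Let $\mathcal X$ be a conditional locally convex topological $L^0$-module, that is, a topological $L^0$-module such that: every concatenation $\sum_i 1_{A_i}X_i$ of a sequence in $\mathcal X$ along a countable measurable partition $(A_i)$ of $\Omega$ exists in $\mathcal X$; zero has a base of neighbourhoods that are $L^0$-convex, $L^0$-absorbent, $L^0$-balanced and $\sigma$-stable (closed under such concatenations); and $\sum_i 1_{A_i}U_i$ is a neighbourhood of zero for all neighbourhoods $U_i$ of zero and all countable measurable partitions $(A_i)$. Let $\mathcal X^*$ be the $L^0$-module of continuous $L^0$-linear maps $\mathcal X\to L^0$, $\langle X^*,X\rangle:=X^*(X)$, equipped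 with the weak topology generated by the evaluations at the elements of $\mathcal X$. Let $\mathcal K\subseteq\mathcal X$ be a closed $L^0$-convex cone containing $0$ (so $\lambda\mathcal K\subseteq\mathcal K$ for $\lambda\in L^0_{++}$), and $\mathcal K^\circ=\{X^*\in\mathcal X^*:\langle X^*,X\rangle\ge0\ \forall X\in\mathcal K\}$. A conditional assessment index is a map $\alpha:\mathcal X\to\bar L^0$ that is local, $\alpha(1_AX+1_{A^c}Y)=1_A\alpha(X)+1_{A^c}\alpha(Y)$ for $A\in\mathscr G$; quasiconcave, $\alpha(\lambda X+(1-\lambda)Y)\ge\alpha(X)\wedge\alpha(Y)$ for $\lambda\in L^0$, $0\le\lambda\le1$; and monotone, $\alpha(X)\ge\alpha(Y)$ if $X-Y\in\mathcal K$. It is upper semicontinuous if $\{\alpha\ge m\}$ is closed for every $m\in\bar L^0$. For $F:\bar L^0\to\bar L^0$ put $F^-(m)=\operatorname{ess\,sup}\{F(n):n<m\text{ on }\{m>-\infty\}\}$ on $\{m>-\infty\}$ and $F^-(m)=-\infty$ on $\{m=-\infty\}$; $F^+(m)=\operatorname{ess\,inf}\{F(n):n>m\text{ on }\{m<\infty\}\}$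 on $\{m<\infty\}$ and $F^+(m)=\infty$ on $\{m=\infty\}$. A conditional risk function is a map $R:\mathcal K^\circ\times\bar L^0\to\bar L^0$ that is jointly local and such that each $F=R(X^*,\cdot)$ is increasing and right-continuous, i.e. $F=F^+$. It is minimal if moreover 1. $R$ is jointly quasiconvex, $R(\lambda X^*+(1-\lambda)Y^*,\lambda s+(1-\lambda)t)\le R(X^*,s)\vee R(Y^*,t)$ for $\lambda\in L^0$, $0\le\lambda\le1$, and $R(\lambda X^*,s)=R(X^*,s/\lambda)$ for $\lambda\in L^0_{++}$; 2. $\operatorname{ess\,sup}_{s\in L^0}R(X^*,s)=\operatorname{ess\,sup}_{s\in L^0}R(Y^*,s)$ for all $X^*,Y^*\in\mathcal K^\circ$; 3. $R^-$ (left-continuous version in the second argument) is jointly lower semicontinuous: $\{(X^*,s)\in\mathcal K^\circ\times L^0:R^-(X^*,s)\le m\}$ is closed for every $m\in\bar L^0$. **Theorem.** (i) Let $\alpha:\mathcal X\to\bar L^0$ be an upper semicontinuous conditional assessment index. Then there is exactly one minimal conditional risk function $R$ with the normalization $R(0,s)=-\infty$ on $\{s<0\}$ for all $s\in\bar L^0$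 such that $$\alpha(X)=\operatorname*{ess\,inf}_{X^*\in\mathcal K^\circ}R(X^*,\langle X^*,X\rangle),\qquad X\in\mathcal X.\tag{1}$$ Moreover, without the normalization, any two minimal conditional risk functions $R,R'$ satisfying (1) differ at most where $X^*$ vanishes and $s<0$: for all $X^*\in\mathcal K^\circ$, $s\in\bar L^0$ and $X\in\mathcal X$, $R(X^*,s)=R'(X^*,s)$ a.s. on $\{\langle X^*,X\rangle\ne0\}\cup\{s\ge0\}$. (ii) Conversely, for every conditional risk function $R$, the right-hand side of (1) defines an upper semicontinuous conditional assessment index. -/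

import Mathlib

open MeasureTheory Filter Topology

noncomputable section

namespace CondIndex

variable {Ω : Type*} [MeasurableSpace Ω]

/-! ### The spaces `L⁰` and `L̄⁰` -/

/-- `L⁰`: real random variables modulo almost sure equality, ordered almost surely. -/
abbrev L0 (P : Measure Ω) := Ω →ₘ[P] ℝ

/-- `L̄⁰`: random variables with values in `[-∞, ∞]` modulo almost sure equality. -/
abbrev Lbar (P : Measure Ω) := Ω →ₘ[P] EReal

instance instCommRingL0 (P : Measure Ω) : CommRing (L0 P) :=
  { (inferInstance : AddCommGroup (L0 P)), (inferInstance : CommMonoid (L0 P)) with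
    left_distrib := fun a b c => by
      apply AEEqFun.ext
      filter_upwards [AEEqFun.coeFn_mul a (b + c), AEEqFun.coeFn_add b c,
        AEEqFun.coeFn_add (a * b) (a * c), AEEqFun.coeFn_mul a b, AEEqFun.coeFn_mul a c]
        with ω h1 h2 h3 h4 h5
      simp only [h1, h2, h3, h4, h5, Pi.mul_apply, Pi.add_apply, mul_add]
    right_distrib := fun a b c => by
      apply AEEqFun.ext
      filter_upwards [AEEqFun.coeFn_mul (a + b) c, AEEqFun.coeFn_add a b,
        AEEqFun.coeFn_add (a * c) (b * c), AEEqFun.coeFn_mul a c, AEEqFun.coeFn_mul b c]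
        with ω h1 h2 h3 h4 h5
      simp only [h1, h2, h3, h4, h5, Pi.mul_apply, Pi.add_apply, add_mul]
    zero_mul := fun a => by
      apply AEEqFun.ext
      filter_upwards [AEEqFun.coeFn_mul 0 a, AEEqFun.coeFn_zero (μ := P) (β := ℝ)] with ω h1 h2
      simp only [h1, h2, Pi.mul_apply, Pi.zero_apply, zero_mul]
    mul_zero := fun a => by
      apply AEEqFun.ext
      filter_upwards [AEEqFun.coeFn_mul a 0, AEEqFun.coeFn_zero (μ := P) (β := ℝ)] with ω h1 h2
      simp only [h1, h2, Pi.mul_apply, Pi.zero_apply, mul_zero] }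

/-- Membership in `L⁰₊₊`: almost surely strictly positive. -/
def IsPos {P : Measure Ω} (m : L0 P) : Prop := ∀ᵐ ω ∂P, 0 < m ω

/-- The ball `{n : |m - n| ≤ ε a.s.}` with random radius `ε`. -/
def ball {P : Measure Ω} (m ε : L0 P) : Set (L0 P) := {n | ∀ᵐ ω ∂P, |m ω - n ω| ≤ ε ω}

theorem mem_ball_zero {P : Measure Ω} {n ε : L0 P} :
    n ∈ ball 0 ε ↔ ∀ᵐ ω ∂P, |n ω| ≤ ε ω := by
  have h0 := AEEqFun.coeFn_zero (α := Ω) (μ := P) (β := ℝ)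
  constructor <;> intro h
  · filter_upwards [h, h0] with ω h h0
    simpa [h0] using h
  · filter_upwards [h, h0] with ω h h0
    simpa [h0] using h

/-- The balls around zero form a neighbourhood basis of zero of a ring topology. -/
@[reducible]
def ballBasis (P : Measure Ω) : RingFilterBasis (L0 P) where
  sets := {U | ∃ ε : L0 P, IsPos ε ∧ U = ball 0 ε}
  nonempty := ⟨_, 1, by
    filter_upwards [AEEqFun.coeFn_one (α := Ω) (μ := P) (β := ℝ)] with ω h
    simp [h], rfl⟩
  inter_sets := by
    rintro _ _ ⟨ε, hε, rfl⟩ ⟨δ, hδ, rfl⟩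
    refine ⟨_, ⟨ε ⊓ δ, ?_, rfl⟩, ?_⟩
    · filter_upwards [hε, hδ, AEEqFun.coeFn_inf ε δ] with ω h1 h2 h3
      simp [h3, h1, h2]
    · intro n hn
      rw [mem_ball_zero] at hn
      refine ⟨mem_ball_zero.2 ?_, mem_ball_zero.2 ?_⟩ <;>
      · filter_upwards [hn, AEEqFun.coeFn_inf ε δ] with ω h1 h2
        rw [h2] at h1
        simp at h1
        tauto
  zero' := by
    rintro _ ⟨ε, hε, rfl⟩
    rw [mem_ball_zero]
    filter_upwards [hε, AEEqFun.coeFn_zero (α := Ω) (μ := P) (β := ℝ)] with ω h h0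
    simpa [h0] using h.le
  add' := by
    rintro _ ⟨ε, hε, rfl⟩
    have hh := AEEqFun.coeFn_smul (1 / 2 : ℝ) ε
    refine ⟨_, ⟨(1 / 2 : ℝ) • ε, ?_, rfl⟩, ?_⟩
    · filter_upwards [hε, hh] with ω h1 h2
      rw [h2, Pi.smul_apply, smul_eq_mul]
      positivity
    · rintro _ ⟨a, ha, b, hb, rfl⟩
      rw [mem_ball_zero] at *
      filter_upwards [ha, hb, hh, AEEqFun.coeFn_add a b] with ω h1 h2 h3 h4
      simp only [h3, h4, Pi.smul_apply, smul_eq_mul, Pi.add_apply] at *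
      linarith [abs_add_le (a ω) (b ω)]
  neg' := by
    rintro _ ⟨ε, hε, rfl⟩
    refine ⟨_, ⟨ε, hε, rfl⟩, fun a ha => ?_⟩
    simp only [Set.mem_preimage]
    rw [mem_ball_zero] at *
    filter_upwards [ha, AEEqFun.coeFn_neg a] with ω h1 h2
    simpa [h2] using h1
  conj' := by
    rintro x _ ⟨ε, hε, rfl⟩
    exact ⟨_, ⟨ε, hε, rfl⟩, fun a ha => by simpa using ha⟩
  mul' := by
    rintro _ ⟨ε, hε, rfl⟩
    have hm := AEEqFun.coeFn_inf ε 1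
    have h1 := AEEqFun.coeFn_one (α := Ω) (μ := P) (β := ℝ)
    refine ⟨_, ⟨ε ⊓ 1, ?_, rfl⟩, ?_⟩
    · filter_upwards [hε, hm, h1] with ω h1 h2 h3
      simp [h1, h2, h3]
    · rintro _ ⟨a, ha, b, hb, rfl⟩
      rw [mem_ball_zero] at *
      filter_upwards [ha, hb, hm, h1, AEEqFun.coeFn_mul a b] with ω ha hb hm h1 hab
      simp only [hm, hab, h1, Pi.mul_apply, Pi.one_apply, le_inf_iff, abs_mul] at *
      nlinarith [abs_nonneg (a ω), abs_nonneg (b ω)]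
  mul_left' := by
    rintro x _ ⟨ε, hε, rfl⟩
    obtain ⟨δ, hδ⟩ : ∃ δ : L0 P, ∀ᵐ ω ∂P, δ ω = ε ω / (|x ω| + 1) :=
      ⟨AEEqFun.mk (fun ω => ε ω / (|x ω| + 1))
        ((ε.stronglyMeasurable.measurable.div
          (x.stronglyMeasurable.measurable.abs.add_const 1)).aestronglyMeasurable),
        AEEqFun.coeFn_mk _ _⟩
    refine ⟨_, ⟨δ, ?_, rfl⟩, fun a ha => ?_⟩
    · filter_upwards [hε, hδ] with ω h1 h2
      rw [h2]
      positivity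
    · simp only [Set.mem_preimage]
      rw [mem_ball_zero] at *
      filter_upwards [hε, ha, hδ, AEEqFun.coeFn_mul x a] with ω h1 h2 h3 h4
      rw [h4, Pi.mul_apply, abs_mul]
      rw [h3, le_div_iff₀ (by positivity)] at h2
      nlinarith [abs_nonneg (x ω), abs_nonneg (a ω)]
  mul_right' := by
    rintro x _ ⟨ε, hε, rfl⟩
    obtain ⟨δ, hδ⟩ : ∃ δ : L0 P, ∀ᵐ ω ∂P, δ ω = ε ω / (|x ω| + 1) :=
      ⟨AEEqFun.mk (fun ω => ε ω / (|x ω| + 1))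
        ((ε.stronglyMeasurable.measurable.div
          (x.stronglyMeasurable.measurable.abs.add_const 1)).aestronglyMeasurable),
        AEEqFun.coeFn_mk _ _⟩
    refine ⟨_, ⟨δ, ?_, rfl⟩, fun a ha => ?_⟩
    · filter_upwards [hε, hδ] with ω h1 h2
      rw [h2]
      positivity
    · simp only [Set.mem_preimage]
      rw [mem_ball_zero] at *
      filter_upwards [hε, ha, hδ, AEEqFun.coeFn_mul a x] with ω h1 h2 h3 h4
      rw [h4, Pi.mul_apply, abs_mul]
      rw [h3, le_div_iff₀ (by positivity)] at h2
      nlinarith [abs_nonneg (x ω), abs_nonneg (a ω)]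

/-- The topology of `L⁰` induced by the balls with random radius `ε ∈ L⁰₊₊`. -/
instance instTopologyL0 (P : Measure Ω) : TopologicalSpace (L0 P) := (ballBasis P).topology

instance instTopologicalRingL0 (P : Measure Ω) : IsTopologicalRing (L0 P) :=
  (ballBasis P).isTopologicalRing

/-- The balls around `m` are a neighbourhood basis of `m`. -/
theorem mem_nhds_iff_ball {P : Measure Ω} (m : L0 P) (V : Set (L0 P)) :
    V ∈ 𝓝 m ↔ ∃ ε : L0 P, IsPos ε ∧ ball m ε ⊆ V := by
  have hb : ∀ ε : L0 P, ball m ε = (fun y => m + y) '' ball 0 ε := by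
    intro ε
    ext n
    simp only [Set.mem_image, mem_ball_zero]
    constructor
    · intro h
      refine ⟨n - m, ?_, by abel⟩
      filter_upwards [h, AEEqFun.coeFn_sub n m] with ω h1 h2
      rw [h2, Pi.sub_apply, abs_sub_comm]
      exact h1
    · rintro ⟨y, hy, rfl⟩
      filter_upwards [hy, AEEqFun.coeFn_add m y] with ω h1 h2
      rw [h2, Pi.add_apply]
      simpa using h1
  have h := ((ballBasis P).toAddGroupFilterBasis.nhds_hasBasis m).mem_iff (t := V)
  refine h.trans ⟨?_, ?_⟩
  · rintro ⟨_, ⟨ε, hε, rfl⟩, hV⟩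
    exact ⟨ε, hε, (hb ε).trans_subset hV⟩
  · rintro ⟨ε, hε, hV⟩
    exact ⟨ball 0 ε, ⟨ε, hε, rfl⟩, (hb ε).symm.trans_subset hV⟩

/-- The indicator `1_A` of a measurable set, as an element of `L⁰`. -/
def ind (P : Measure Ω) {A : Set Ω} (hA : MeasurableSet A) : L0 P :=
  AEEqFun.mk (A.indicator fun _ => (1 : ℝ))
    ((measurable_const.indicator hA).aestronglyMeasurable)

/-- The embedding `L⁰ → L̄⁰`. -/
def toBar {P : Measure Ω} (m : L0 P) : Lbar P :=
  AEEqFun.comp Real.toEReal continuous_coe_real_ereal m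

open Classical in
/-- `1_A m + 1_{Aᶜ} n` in `L̄⁰`, with `0 · (±∞) = 0`. -/
def glue {P : Measure Ω} {A : Set Ω} (hA : MeasurableSet A) (m n : Lbar P) : Lbar P :=
  AEEqFun.mk (A.piecewise m n)
    ((m.stronglyMeasurable.measurable.piecewise hA
      n.stronglyMeasurable.measurable).aestronglyMeasurable)

/-- `l m + k n` in `L̄⁰` for `l, k ∈ L⁰`, with `0 · (±∞) = 0` and `∞ - ∞ = -∞`
(the conventions of `EReal`). -/
def combBar {P : Measure Ω} (l : L0 P) (m : Lbar P) (k : L0 P) (n : Lbar P) : Lbar P :=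
  AEEqFun.mk (fun ω => (l ω : EReal) * m ω + (k ω : EReal) * n ω)
    (((l.stronglyMeasurable.measurable.coe_real_ereal.mul m.stronglyMeasurable.measurable).add
      (k.stronglyMeasurable.measurable.coe_real_ereal.mul
        n.stronglyMeasurable.measurable)).aestronglyMeasurable)

/-- `s / l` in `L̄⁰`. -/
def divBar {P : Measure Ω} (s : Lbar P) (l : L0 P) : Lbar P :=
  AEEqFun.mk (fun ω => s ω * (((l ω)⁻¹ : ℝ) : EReal))
    ((s.stronglyMeasurable.measurable.mul
      l.stronglyMeasurable.measurable.inv.coe_real_ereal).aestronglyMeasurable)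

/-! ### Essential infima and suprema -/

/-- For a finite measure every subset of `L̄⁰` has a greatest lower bound. -/
theorem exists_isGLB {P : Measure Ω} [IsFiniteMeasure P] (S : Set (Lbar P)) :
    ∃ a, IsGLB S a := by
  classical
  let D : ℚ → Set (Lbar P) → Set Ω := fun q c => ⋃ f ∈ c, {ω | f ω < ((q : ℝ) : EReal)}
  have hDm : ∀ q c, c.Countable → MeasurableSet (D q c) := fun q c hc =>
    MeasurableSet.biUnion hc fun f _ =>
      measurableSet_lt f.stronglyMeasurable.measurable measurable_const
  have hmono : ∀ q c d, c ⊆ d → D q c ⊆ D q d := fun q c d h =>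
    Set.biUnion_subset_biUnion_left h
  have key : ∀ q, ∃ c ⊆ S, c.Countable ∧ ∀ d ⊆ S, d.Countable → P (D q d) ≤ P (D q c) := by
    intro q
    let T : Set ENNReal := {x | ∃ c ⊆ S, c.Countable ∧ x = P (D q c)}
    have hT : T.Nonempty := ⟨_, ∅, Set.empty_subset _, Set.countable_empty, rfl⟩
    obtain ⟨u, -, hu, huT⟩ := exists_seq_tendsto_sSup hT (OrderTop.bddAbove T)
    choose c hcS hcc hcu using huT
    refine ⟨⋃ n, c n, Set.iUnion_subset hcS, Set.countable_iUnion hcc, fun d hd hdc => ?_⟩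
    refine (le_sSup ⟨d, hd, hdc, rfl⟩ : P (D q d) ≤ sSup T).trans ?_
    refine le_of_tendsto' hu fun n => ?_
    rw [hcu n]
    exact measure_mono (hmono q _ _ (Set.subset_iUnion c n))
  choose c hcS hcc hmax using key
  let C := ⋃ q, c q
  have hCc : C.Countable := Set.countable_iUnion hcc
  have hCS : C ⊆ S := Set.iUnion_subset hcS
  have hgm : Measurable fun ω => ⨅ f ∈ C, (f : Lbar P) ω :=
    Measurable.biInf C hCc fun f _ => f.stronglyMeasurable.measurable
  refine ⟨AEEqFun.mk _ hgm.aestronglyMeasurable, ?_, ?_⟩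
  · intro f hf
    rw [← AEEqFun.coeFn_le]
    have hae : ∀ q : ℚ, ∀ᵐ ω ∂P, f ω < ((q : ℝ) : EReal) → ω ∈ D q C := by
      intro q
      have hins : (insert f C).Countable := hCc.insert f
      have h1 : P (D q (insert f C)) ≤ P (D q C) :=
        (hmax q _ (Set.insert_subset hf hCS) hins).trans
          (measure_mono (hmono q _ _ (Set.subset_iUnion c q)))
      have h2 : P (D q (insert f C) \ D q C) = 0 := by
        rw [measure_sdiff (hmono q _ _ (Set.subset_insert f C)) (hDm q C hCc).nullMeasurableSet
          (measure_ne_top P _)]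
        exact tsub_eq_zero_of_le h1
      refine measure_mono_null (fun ω hω => ?_) h2
      simp only [Set.mem_compl_iff, Set.mem_ofPred_eq, Classical.not_imp] at hω
      exact ⟨Set.mem_biUnion (Set.mem_insert f C) hω.1, hω.2⟩
    filter_upwards [AEEqFun.coeFn_mk _ hgm.aestronglyMeasurable, ae_all_iff.2 hae] with ω h1 h2
    rw [h1]
    by_contra hlt
    rw [not_le] at hlt
    obtain ⟨q, hq1, hq2⟩ := EReal.lt_iff_exists_rat_btwn.1 hlt
    obtain ⟨g, hg, hgq⟩ := Set.mem_iUnion₂.1 (h2 q hq1)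
    exact absurd (lt_of_le_of_lt (iInf₂_le g hg) hgq) (not_lt.2 hq2.le)
  · intro b hb
    rw [← AEEqFun.coeFn_le]
    have hall : ∀ᵐ ω ∂P, ∀ f ∈ C, b ω ≤ (f : Lbar P) ω :=
      (ae_ball_iff hCc).2 fun f hf => AEEqFun.coeFn_le.2 (hb (hCS hf))
    filter_upwards [AEEqFun.coeFn_mk _ hgm.aestronglyMeasurable, hall] with ω h1 h2
    rw [h1]
    exact le_iInf₂ h2

open Classical in
/-- The essential infimum of a set in `L̄⁰`: its greatest lower bound. -/
def essInfSet {P : Measure Ω} (S : Set (Lbar P)) : Lbar P :=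
  if h : ∃ a, IsGLB S a then h.choose else AEEqFun.const Ω ⊤

theorem isGLB_essInfSet {P : Measure Ω} [IsFiniteMeasure P] (S : Set (Lbar P)) :
    IsGLB S (essInfSet S) := by
  unfold essInfSet
  rw [dif_pos (exists_isGLB S)]
  exact (exists_isGLB S).choose_spec

/-- The essential supremum of a set in `L̄⁰`: its least upper bound, that is, the essential
infimum of its set of upper bounds. -/
def essSupSet {P : Measure Ω} (S : Set (Lbar P)) : Lbar P := essInfSet (upperBounds S)

theorem isLUB_essSupSet {P : Measure Ω} [IsFiniteMeasure P] (S : Set (Lbar P)) :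
    IsLUB S (essSupSet S) :=
  isGLB_upperBounds.1 (isGLB_essInfSet _)

/-! ### Left- and right-continuous versions of increasing functions on `L̄⁰` -/

theorem measurableSet_bot_lt {P : Measure Ω} (m : Lbar P) : MeasurableSet {ω | ⊥ < m ω} :=
  measurableSet_lt measurable_const m.stronglyMeasurable.measurable

theorem measurableSet_lt_top {P : Measure Ω} (m : Lbar P) : MeasurableSet {ω | m ω < ⊤} :=
  measurableSet_lt m.stronglyMeasurable.measurable measurable_const

/-- `F⁻(m) = esssup {F(n) : n < m on {m > -∞}}` on `{m > -∞}`, and `-∞` on `{m = -∞}`. -/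
def leftVersion {P : Measure Ω} (F : Lbar P → Lbar P) (m : Lbar P) : Lbar P :=
  glue (measurableSet_bot_lt m)
    (essSupSet {x | ∃ n : Lbar P, (∀ᵐ ω ∂P, ⊥ < m ω → n ω < m ω) ∧ x = F n})
    (AEEqFun.const Ω ⊥)

/-- `F⁺(m) = essinf {F(n) : n > m on {m < ∞}}` on `{m < ∞}`, and `∞` on `{m = ∞}`. -/
def rightVersion {P : Measure Ω} (F : Lbar P → Lbar P) (m : Lbar P) : Lbar P :=
  glue (measurableSet_lt_top m)
    (essInfSet {x | ∃ n : Lbar P, (∀ᵐ ω ∂P, m ω < ⊤ → m ω < n ω) ∧ x = F n})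
    (AEEqFun.const Ω ⊤)

/-! ### Conditional locally convex topological `L⁰`-modules -/

section Modules

variable {P : Measure Ω} {X : Type*} [AddCommGroup X] [Module (L0 P) X]

/-- A countable measurable partition of `Ω` (some of the sets may be empty). -/
structure IsPartition (A : ℕ → Set Ω) : Prop where
  measurable : ∀ i, MeasurableSet (A i)
  disjoint : Pairwise fun i j => Disjoint (A i) (A j)
  cover : ⋃ i, A i = Set.univ

variable (P) in
/-- `y` is a concatenation `∑ 1_{A_i} x_i`. -/
def IsConcat {A : ℕ → Set Ω} (hA : IsPartition A) (x : ℕ → X) (y : X) : Prop :=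
  ∀ i, ind P (hA.measurable i) • y = ind P (hA.measurable i) • x i

variable (P) in
/-- `σ`-stability: `C` contains all concatenations `∑ 1_{A_i} x_i` of its elements. -/
def SigmaStable (C : Set X) : Prop :=
  ∀ (A : ℕ → Set Ω) (hA : IsPartition A) (x : ℕ → X), (∀ i, x i ∈ C) →
    ∀ y, IsConcat P hA x y → y ∈ C

variable (P) in
/-- `L⁰`-convexity. -/
def L0Convex (C : Set X) : Prop :=
  ∀ l : L0 P, 0 ≤ l → l ≤ 1 → ∀ x ∈ C, ∀ y ∈ C, l • x + (1 - l) • y ∈ C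

variable (P) in
/-- `L⁰`-absorbent: every `x` lies in `l U` for some `l ∈ L⁰₊₊`. -/
def L0Absorbent (U : Set X) : Prop :=
  ∀ x : X, ∃ l : L0 P, IsPos l ∧ ∃ u ∈ U, x = l • u

variable (P) in
/-- `L⁰`-balanced: `l U ⊆ U` whenever `|l| ≤ 1`. -/
def L0Balanced (U : Set X) : Prop :=
  ∀ l : L0 P, (∀ᵐ ω ∂P, |l ω| ≤ 1) → ∀ x ∈ U, l • x ∈ U

variable (P X) in
/-- Conditional local convexity of a topological `L⁰`-module: the module is `σ`-stable, zero has
a neighbourhood base of `σ`-stable, `L⁰`-convex, `L⁰`-absorbent and `L⁰`-balanced sets, and the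
system of neighbourhoods of zero is stable under concatenation along countable partitions. -/
structure IsConditionallyLocallyConvex [TopologicalSpace X] : Prop where
  exists_concat : ∀ (A : ℕ → Set Ω) (hA : IsPartition A) (x : ℕ → X), ∃ y, IsConcat P hA x y
  nhds_base : ∀ V ∈ 𝓝 (0 : X), ∃ U ∈ 𝓝 (0 : X), U ⊆ V ∧
    SigmaStable P U ∧ L0Convex P U ∧ L0Absorbent P U ∧ L0Balanced P U
  nhds_concat : ∀ (A : ℕ → Set Ω) (hA : IsPartition A) (U : ℕ → Set X),
    (∀ i, U i ∈ 𝓝 (0 : X)) →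
      {y | ∃ x : ℕ → X, (∀ i, x i ∈ U i) ∧ IsConcat P hA x y} ∈ 𝓝 (0 : X)

variable (P) in
/-- An `L⁰`-convex cone containing zero. -/
structure IsConvexCone (K : Set X) : Prop where
  convex : L0Convex P K
  smul_mem : ∀ l : L0 P, IsPos l → ∀ x ∈ K, l • x ∈ K
  zero_mem : (0 : X) ∈ K

/-! ### Conditional assessment indices -/

/-- A conditional assessment index: local, quasiconcave, and monotone for the preorder
`x ≽ y ↔ x - y ∈ K`. -/
structure IsAssessmentIndex (K : Set X) (α : X → Lbar P) : Prop where
  isLocal : ∀ (A : Set Ω) (hA : MeasurableSet A) (x y : X),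
    α (ind P hA • x + ind P hA.compl • y) = glue hA (α x) (α y)
  quasiconcave : ∀ l : L0 P, 0 ≤ l → l ≤ 1 → ∀ x y : X,
    α x ⊓ α y ≤ α (l • x + (1 - l) • y)
  monotone : ∀ x y : X, x - y ∈ K → α y ≤ α x

/-- Upper semicontinuity: all upper level sets, with levels in `L̄⁰`, are closed. -/
def IsUSC [TopologicalSpace X] (α : X → Lbar P) : Prop :=
  ∀ m : Lbar P, IsClosed {x | m ≤ α x}

/-! ### Conditional risk functions -/

variable [TopologicalSpace X]

/-- The polar cone `K°` in the `L⁰`-dual, which carries the weak topology of evaluations. -/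
def polarCone (K : Set X) : Set (WeakDual (L0 P) X) := {Z | ∀ x ∈ K, 0 ≤ Z x}

/-- A conditional risk function `R : K° × L̄⁰ → L̄⁰`. -/
structure IsRiskFunction {K : Set X} (R : polarCone (P := P) K → Lbar P → Lbar P) : Prop where
  isLocal : ∀ (A : Set Ω) (hA : MeasurableSet A) (Z₁ Z₂ Z : polarCone (P := P) K),
    Z.1 = ind P hA • Z₁.1 + ind P hA.compl • Z₂.1 →
      ∀ s t : Lbar P, R Z (glue hA s t) = glue hA (R Z₁ s) (R Z₂ t)
  increasing : ∀ Z, Monotone (R Z)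
  rightContinuous : ∀ Z, R Z = rightVersion (R Z)

/-- A conditional risk function is minimal if it is jointly quasiconvex with
`R(l Z, s) = R(Z, s / l)`, has a uniform asymptotic maximum, and its left-continuous version is
jointly lower semicontinuous on `K° × L⁰`. -/
structure IsMinimalRiskFunction {K : Set X} (R : polarCone (P := P) K → Lbar P → Lbar P) : Prop
    extends IsRiskFunction R where
  quasiconvex : ∀ l : L0 P, 0 ≤ l → l ≤ 1 → ∀ Z₁ Z₂ Z : polarCone (P := P) K,
    Z.1 = l • Z₁.1 + (1 - l) • Z₂.1 →
      ∀ s t : Lbar P, R Z (combBar l s (1 - l) t) ≤ R Z₁ s ⊔ R Z₂ t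
  scaling : ∀ l : L0 P, IsPos l → ∀ Z Z' : polarCone (P := P) K, Z'.1 = l • Z.1 →
    ∀ s : Lbar P, R Z' s = R Z (divBar s l)
  asymptoticMax : ∀ Z Z' : polarCone (P := P) K,
    essSupSet (Set.range fun s : L0 P => R Z (toBar s)) =
      essSupSet (Set.range fun s : L0 P => R Z' (toBar s))
  lsc : ∀ m : Lbar P,
    IsClosed {p : polarCone (P := P) K × L0 P | leftVersion (R p.1) (toBar p.2) ≤ m}

/-- The normalization at the zero functional: `R(0, s) = -∞` on `{s < 0}`. -/
def IsNormalizedAtZero {K : Set X} (R : polarCone (P := P) K → Lbar P → Lbar P) : Prop :=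
  ∀ Z : polarCone (P := P) K, Z.1 = 0 → ∀ s : Lbar P, ∀ᵐ ω ∂P, s ω < 0 → R Z s ω = ⊥

/-- The function `x ↦ essinf_{Z ∈ K°} R(Z, ⟨Z, x⟩)`. -/
def robust {K : Set X} (R : polarCone (P := P) K → Lbar P → Lbar P) (x : X) : Lbar P :=
  essInfSet (Set.range fun Z : polarCone (P := P) K => R Z (toBar (Z.1 x)))

end Modules

end CondIndex

end

open CondIndex

/-!
The representing function is essentially forced: (1) gives `α x ≤ R(Z, s)` whenever `⟨Z, x⟩ < s`,
and the least right-continuous choice is `minRisk α`, the right-continuous version of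
`levelSup α Z s = esssup {α x : ⟨Z, x⟩ < s}`.

*Existence.* If `α x < m` on a nonnull event, then `x` can be separated from the closed `L⁰`-convex
set `{α ≥ m}` by a continuous functional `Z`, which lies in `K°` because `α` is monotone. Separation
rests on a Hahn–Banach theorem for `L⁰`-sublinear maps, applied to gauges of neighbourhoods of zero;
stability under concatenation replaces the case distinctions which a field would allow.

*Uniqueness.* Let `R` be minimal and represent `α`. If `R⁻(Z₀, s₀) > m`, then lower semicontinuity
and quasiconvexity allow one to separate `(Z₀, s₀)` from the closed convex cone `{R⁻ ≤ m}` in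
`X* × L⁰` by a pair `(y, b) ∈ X × L⁰` with `b ≤ 0`. The uniform asymptotic maximum separates
`(0, 1)` as well, and thus `b < 0` after a perturbation. Then `x = -y / b` satisfies `⟨Z₀, x⟩ < s₀`
and `m ≤ α x`, so that `R⁻ ≤ levelSup α`. If no pair satisfies `R⁻ ≤ m`, then every `x` has
`m ≤ α x` and only `⟨Z₀, x⟩ < s₀` is needed; this is solvable where `Z₀` does not vanish or
`s₀ > 0`, which explains the exceptional set.

One-sided versions of increasing local functions are determined pointwise by the values at rational
constants (`LocalMono`), which turns statements on essential infima and suprema into inequalities in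
`[-∞, ∞]` at almost every point.
-/

noncomputable section

namespace CondIndex

variable {Ω : Type*} [MeasurableSpace Ω] {P : Measure Ω}

/-! ### Calculus in `L⁰` and `L̄⁰` -/

section Pointwise

theorem exists_coeFn_eq {β : Type*} [TopologicalSpace β] [TopologicalSpace.PseudoMetrizableSpace β]
    [SecondCountableTopology β] [MeasurableSpace β] [OpensMeasurableSpace β] (P : Measure Ω)
    {f : Ω → β} (hf : Measurable f) : ∃ g : Ω →ₘ[P] β, ∀ᵐ ω ∂P, g ω = f ω :=
  ⟨AEEqFun.mk f hf.aestronglyMeasurable, AEEqFun.coeFn_mk _ _⟩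

open Classical in
theorem exists_coeFn_eq_ite {β : Type*} [TopologicalSpace β]
    [TopologicalSpace.PseudoMetrizableSpace β] {A : Set Ω} (hA : MeasurableSet A)
    (f g : Ω →ₘ[P] β) : ∃ h : Ω →ₘ[P] β, ∀ᵐ ω ∂P, h ω = if ω ∈ A then f ω else g ω :=
  ⟨AEEqFun.mk (A.piecewise f g)
    (f.stronglyMeasurable.piecewise hA g.stronglyMeasurable).aestronglyMeasurable,
    AEEqFun.coeFn_mk _ _⟩

theorem coeFn_toBar (a : L0 P) : ∀ᵐ ω ∂P, toBar a ω = (a ω : EReal) :=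
  AEEqFun.coeFn_comp _ continuous_coe_real_ereal a

open Classical in
theorem coeFn_ind {A : Set Ω} (hA : MeasurableSet A) :
    ∀ᵐ ω ∂P, ind P hA ω = if ω ∈ A then 1 else 0 := by
  filter_upwards [AEEqFun.coeFn_mk (μ := P) (A.indicator fun _ => (1 : ℝ))
    (measurable_const.indicator hA).aestronglyMeasurable] with ω hω
  exact hω.trans (Set.indicator_apply ..)

open Classical in
theorem coeFn_ind_mul_add {A : Set Ω} (hA : MeasurableSet A) (a b : L0 P) :
    ∀ᵐ ω ∂P, (ind P hA * a + ind P hA.compl * b) ω = if ω ∈ A then a ω else b ω := by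
  filter_upwards [AEEqFun.coeFn_add (ind P hA * a) (ind P hA.compl * b),
    AEEqFun.coeFn_mul (ind P hA) a, AEEqFun.coeFn_mul (ind P hA.compl) b, coeFn_ind (P := P) hA,
    coeFn_ind (P := P) hA.compl] with ω hadd hmul hmul' hind hind'
  by_cases hω : ω ∈ A <;> simp [hadd, hmul, hmul', hind, hind', hω]

open Classical in
theorem coeFn_glue {A : Set Ω} (hA : MeasurableSet A) (m n : Lbar P) :
    ∀ᵐ ω ∂P, glue hA m n ω = if ω ∈ A then m ω else n ω :=
  AEEqFun.coeFn_mk _ _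

theorem coeFn_combBar (l : L0 P) (m : Lbar P) (k : L0 P) (n : Lbar P) :
    ∀ᵐ ω ∂P, combBar l m k n ω = (l ω : EReal) * m ω + (k ω : EReal) * n ω :=
  AEEqFun.coeFn_mk _ _

theorem coeFn_divBar (s : Lbar P) (l : L0 P) :
    ∀ᵐ ω ∂P, divBar s l ω = s ω * (((l ω)⁻¹ : ℝ) : EReal) :=
  AEEqFun.coeFn_mk _ _

theorem nonneg_iff_ae {a : L0 P} : 0 ≤ a ↔ ∀ᵐ ω ∂P, 0 ≤ a ω := by
  rw [← AEEqFun.coeFn_le]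
  refine eventually_congr ?_
  filter_upwards [AEEqFun.coeFn_zero (μ := P) (β := ℝ)] with ω h0
  rw [h0, Pi.zero_apply]

theorem le_one_iff_ae {a : L0 P} : a ≤ 1 ↔ ∀ᵐ ω ∂P, a ω ≤ 1 := by
  rw [← AEEqFun.coeFn_le]
  refine eventually_congr ?_
  filter_upwards [AEEqFun.coeFn_one (μ := P) (β := ℝ)] with ω h1
  rw [h1, Pi.one_apply]

instance instIsOrderedAddMonoidL0 : IsOrderedAddMonoid (L0 P) where
  add_le_add_left a b h c := by
    rw [← AEEqFun.coeFn_le] at h ⊢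
    filter_upwards [h, AEEqFun.coeFn_add a c, AEEqFun.coeFn_add b c] with ω h hac hbc
    rw [hac, hbc]
    exact add_le_add_left h (c ω)

instance instZeroLEOneClassL0 : ZeroLEOneClass (L0 P) where
  zero_le_one := nonneg_iff_ae.2 <| by
    filter_upwards [AEEqFun.coeFn_one (μ := P) (β := ℝ)] with ω h1
    rw [h1]
    exact zero_le_one

instance instIsOrderedRingL0 : IsOrderedRing (L0 P) :=
  .of_mul_nonneg fun a b ha hb => by
    rw [nonneg_iff_ae] at *
    filter_upwards [ha, hb, AEEqFun.coeFn_mul a b] with ω ha hb hab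
    rw [hab]
    exact mul_nonneg ha hb

theorem ind_nonneg {A : Set Ω} (hA : MeasurableSet A) : 0 ≤ ind P hA := by
  rw [nonneg_iff_ae]
  filter_upwards [coeFn_ind (P := P) hA] with ω hω
  rw [hω]
  positivity

theorem ind_add_ind_compl {A : Set Ω} (hA : MeasurableSet A) :
    ind P hA + ind P hA.compl = 1 := by
  apply AEEqFun.ext
  filter_upwards [coeFn_ind_mul_add (P := P) hA 1 1] with ω hω
  simpa using hω

theorem ind_mul_eq_ind_mul_iff {A : Set Ω} (hA : MeasurableSet A) {a b : L0 P} :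
    ind P hA * a = ind P hA * b ↔ ∀ᵐ ω ∂P, ω ∈ A → a ω = b ω := by
  rw [AEEqFun.ext_iff]
  refine eventually_congr ?_
  filter_upwards [AEEqFun.coeFn_mul (ind P hA) a, AEEqFun.coeFn_mul (ind P hA) b,
    coeFn_ind (P := P) hA] with ω ha hb hind
  by_cases hω : ω ∈ A <;> simp [ha, hb, hind, hω]

theorem IsPos.le {a : L0 P} (h : IsPos a) : 0 ≤ a :=
  nonneg_iff_ae.2 (h.mono fun _ h => h.le)

theorem isPos_one : IsPos (1 : L0 P) := by
  filter_upwards [AEEqFun.coeFn_one (μ := P) (β := ℝ)] with ω h1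
  exact h1.symm ▸ one_pos

theorem IsPos.add_of_nonneg {a b : L0 P} (hb : IsPos b) (ha : 0 ≤ a) : IsPos (a + b) := by
  filter_upwards [nonneg_iff_ae.1 ha, hb, AEEqFun.coeFn_add a b] with ω ha hb hadd
  exact hadd.symm ▸ add_pos_of_nonneg_of_pos ha hb

theorem exists_coeFn_eq_inv (a : L0 P) : ∃ b : L0 P, ∀ᵐ ω ∂P, b ω = (a ω)⁻¹ :=
  exists_coeFn_eq P a.measurable.inv

theorem IsPos.exists_inv {a : L0 P} (h : IsPos a) :
    ∃ b : L0 P, IsPos b ∧ a * b = 1 ∧ ∀ᵐ ω ∂P, b ω = (a ω)⁻¹ := by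
  obtain ⟨b, hb⟩ := exists_coeFn_eq_inv a
  refine ⟨b, ?_, AEEqFun.ext ?_, hb⟩
  · filter_upwards [h, hb] with ω ha hb
    rw [hb]
    exact inv_pos.2 ha
  · filter_upwards [h, hb, AEEqFun.coeFn_mul a b, AEEqFun.coeFn_one (μ := P) (β := ℝ)]
      with ω ha hb hab h1
    rw [hab, h1, Pi.mul_apply, Pi.one_apply, hb, mul_inv_cancel₀ ha.ne']

theorem nonneg_of_forall_isPos_le_mul {a b : L0 P} (h : ∀ l, IsPos l → a ≤ l * b) : 0 ≤ b := by
  obtain ⟨l, hl⟩ := exists_coeFn_eq P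
    (((a.measurable.abs.add_const 1).div b.measurable.abs).add_const 1)
  have hpos : IsPos l := hl.mono fun ω hl => hl.symm ▸ by simp only [Pi.div_apply]; positivity
  rw [nonneg_iff_ae]
  filter_upwards [hl, AEEqFun.coeFn_le.2 (h l hpos), AEEqFun.coeFn_mul l b] with ω hl hle hmul
  rw [hmul, Pi.mul_apply, hl, Pi.div_apply] at hle
  by_contra! hneg
  have hcancel : (|a ω| + 1) / |b ω| * b ω = -(|a ω| + 1) := by
    rw [abs_of_neg hneg, div_neg, neg_mul, div_mul_cancel₀ _ hneg.ne]
  linarith [neg_abs_le (a ω)]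

theorem le_of_forall_isPos_le_add {a b : L0 P} (h : ∀ e, IsPos e → a ≤ b + e) : a ≤ b := by
  refine sub_nonneg.1 (nonneg_of_forall_isPos_le_mul (a := -1) fun l hl => ?_)
  obtain ⟨k, hk, hlk, -⟩ := hl.exists_inv
  have hle := mul_le_mul_of_nonneg_left (h k hk) hl.le
  rwa [mul_sub, neg_le_sub_iff_le_add, ← hlk, ← mul_add]

theorem exists_convex_weight {a b : L0 P} (ha : 0 ≤ a) (hb : 0 ≤ b) :
    ∃ l : L0 P, 0 ≤ l ∧ l ≤ 1 ∧ (a + b) * l = a ∧ (a + b) * (1 - l) = b := by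
  obtain ⟨l, hl⟩ := exists_coeFn_eq P (a.measurable.div (a.measurable.add b.measurable))
  simp only [Pi.div_apply, Pi.add_apply] at hl
  have hla : (a + b) * l = a := by
    apply AEEqFun.ext
    filter_upwards [hl, nonneg_iff_ae.1 ha, nonneg_iff_ae.1 hb, AEEqFun.coeFn_mul (a + b) l,
      AEEqFun.coeFn_add a b] with ω hl ha hb hmul hadd
    rw [hmul, Pi.mul_apply, hadd, Pi.add_apply, hl]
    refine mul_div_cancel_of_imp' fun h => ?_
    linarith
  refine ⟨l, nonneg_iff_ae.2 ?_, le_one_iff_ae.2 ?_, hla, by rw [mul_sub, hla]; ring⟩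
  · filter_upwards [hl, nonneg_iff_ae.1 ha, nonneg_iff_ae.1 hb] with ω hl ha hb
    rw [hl]
    positivity
  · filter_upwards [hl, nonneg_iff_ae.1 ha, nonneg_iff_ae.1 hb] with ω hl ha hb
    rw [hl]
    exact div_le_one_of_le₀ (by linarith) (by positivity)

theorem toBar_le_toBar {a b : L0 P} : toBar a ≤ toBar b ↔ a ≤ b := by
  rw [← AEEqFun.coeFn_le, ← AEEqFun.coeFn_le]
  refine eventually_congr ?_
  filter_upwards [coeFn_toBar a, coeFn_toBar b] with ω ha hb
  rw [ha, hb, EReal.coe_le_coe_iff]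

theorem exists_toBar_eq {a b : L0 P} {m : Lbar P} (ha : toBar a ≤ m) (hb : m ≤ toBar b) :
    ∃ c : L0 P, toBar c = m := by
  obtain ⟨c, hc⟩ := exists_coeFn_eq P m.measurable.ereal_toReal
  refine ⟨c, AEEqFun.ext ?_⟩
  rw [← AEEqFun.coeFn_le] at ha hb
  filter_upwards [ha, hb, hc, coeFn_toBar a, coeFn_toBar b, coeFn_toBar c]
    with ω ha hb hc hta htb htc
  rw [htc, hc]
  rw [hta] at ha
  rw [htb] at hb
  exact EReal.coe_toReal (ne_top_of_le_ne_top (EReal.coe_ne_top _) hb)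
    (ne_bot_of_le_ne_bot (EReal.coe_ne_bot _) ha)

end Pointwise

/-! ### Partitions and exhaustion -/

section Exhaustion

theorem exists_isPartition_subset {B : ℕ → Set Ω} (hB : ∀ n, MeasurableSet (B n))
    (hcov : ⋃ n, B n = Set.univ) : ∃ A : ℕ → Set Ω, IsPartition A ∧ ∀ n, A n ⊆ B n :=
  ⟨disjointed B, ⟨MeasurableSet.disjointed hB, disjoint_disjointed B,
    iUnion_disjointed.trans hcov⟩, disjointed_subset B⟩

theorem IsPartition.exists_mem {A : ℕ → Set Ω} (hA : IsPartition A) (ω : Ω) : ∃ n, ω ∈ A n :=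
  Set.mem_iUnion.1 (hA.cover ▸ Set.mem_univ ω)

theorem IsPartition.ae_of_forall {A : ℕ → Set Ω} (hA : IsPartition A) {p : Ω → Prop}
    (h : ∀ n, ∀ᵐ ω ∂P, ω ∈ A n → p ω) : ∀ᵐ ω ∂P, p ω := by
  filter_upwards [ae_all_iff.2 h] with ω hω
  obtain ⟨n, hn⟩ := hA.exists_mem ω
  exact hω n hn

theorem IsPartition.exists_forall_ae_eq {A : ℕ → Set Ω} (hA : IsPartition A) (y : ℕ → L0 P) :
    ∃ z : L0 P, ∀ n, ∀ᵐ ω ∂P, ω ∈ A n → z ω = y n ω := by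
  obtain ⟨f, hf, hfy⟩ := exists_measurable_piecewise A hA.measurable (fun n ω => y n ω)
    (fun n => (y n).measurable) fun i j hij ω hω =>
      absurd hω.2 (Set.disjoint_left.1 (hA.disjoint hij) hω.1)
  obtain ⟨z, hz⟩ := exists_coeFn_eq P hf
  exact ⟨z, fun n => hz.mono fun ω h hω => h.trans (hfy n hω)⟩

/-- The set of largest measure contains all the others up to null sets. -/
theorem exists_forall_ae_subset [IsFiniteMeasure P] {ι : Type*} [Nonempty ι] {D : ι → Set Ω}
    (hD : ∀ i, MeasurableSet (D i)) (hdir : ∀ y : ℕ → ι, ∃ z, ∀ n, D (y n) ≤ᵐ[P] D z) :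
    ∃ z, ∀ i, D i ≤ᵐ[P] D z := by
  obtain ⟨u, -, hu, huD⟩ := exists_seq_tendsto_sSup
    (Set.range_nonempty fun i => P (D i)) (OrderTop.bddAbove _)
  choose y hy using huD
  obtain ⟨z, hz⟩ := hdir y
  have hmax : ∀ i, P (D i) ≤ P (D z) := fun i =>
    (le_sSup (Set.mem_range_self i)).trans <|
      le_of_tendsto' hu fun n => (hy n).symm.trans_le (measure_mono_ae (hz n))
  refine ⟨z, fun i => ?_⟩
  obtain ⟨w, hw⟩ := hdir fun n => if n = 0 then z else i
  have hzw : D z =ᵐ[P] D w := ae_eq_of_ae_subset_of_measure_ge (by simpa using hw 0) (hmax w)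
    (hD z).nullMeasurableSet (measure_ne_top P _)
  exact EventuallyLE.trans (by simpa using hw 1) hzw.symm.le

/-- A subset of `L⁰` is downward stable under gluing if for every sequence in it and every
countable partition some member lies below the `n`-th term on the `n`-th part, for all `n`. -/
def GlueStable (S : Set (L0 P)) : Prop :=
  ∀ A, IsPartition A → ∀ y : ℕ → L0 P, (∀ n, y n ∈ S) →
    ∃ z ∈ S, ∀ n, ∀ᵐ ω ∂P, ω ∈ A n → z ω ≤ y n ω

theorem GlueStable.exists_forall_ae_lt [IsFiniteMeasure P] {S : Set (L0 P)} (hS : GlueStable S)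
    (hne : S.Nonempty) (e : L0 P) :
    ∃ z ∈ S, ∀ y ∈ S, ∀ᵐ ω ∂P, y ω < e ω → z ω < e ω := by
  have hmeas (y : L0 P) : MeasurableSet {ω | y ω < e ω} :=
    measurableSet_lt y.measurable e.measurable
  have := hne.to_subtype
  obtain ⟨⟨z, hz⟩, hmax⟩ := exists_forall_ae_subset (P := P) (D := fun y : S => {ω | y.1 ω < e ω})
    (fun y => hmeas y) fun y => by
      set U := ⋃ n, {ω | (y n).1 ω < e ω} with hU
      obtain ⟨A, hA, hAU⟩ := exists_isPartition_subset
        (B := fun n => {ω | (y n).1 ω < e ω} ∪ Uᶜ)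
        (fun n => (hmeas _).union (MeasurableSet.iUnion fun n => hmeas _).compl)
        (by rw [← Set.iUnion_union, ← hU, Set.union_compl_self])
      obtain ⟨z, hz, hzy⟩ := hS A hA (fun n => y n) fun n => (y n).2
      refine ⟨⟨z, hz⟩, fun k => ?_⟩
      filter_upwards [ae_all_iff.2 hzy] with ω hω hk
      obtain ⟨n, hn⟩ := hA.exists_mem ω
      exact (hω n hn).trans_lt ((hAU n hn).resolve_right fun h => h (Set.mem_iUnion.2 ⟨k, hk⟩))
  exact ⟨z, hz, fun y hy => hmax ⟨y, hy⟩⟩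

end Exhaustion

/-! ### Essential infima and suprema -/

section EssInf

variable {β : Type*} [TopologicalSpace β] [TopologicalSpace.PseudoMetrizableSpace β]
  {S : Set (Ω →ₘ[P] β)} {A : Set Ω}

theorem ae_le_on_of_isGLB [Preorder β] {g b : Ω →ₘ[P] β} (hg : IsGLB S g) (hA : MeasurableSet A)
    (h : ∀ x ∈ S, ∀ᵐ ω ∂P, ω ∈ A → b ω ≤ x ω) : ∀ᵐ ω ∂P, ω ∈ A → b ω ≤ g ω := by
  obtain ⟨c, hc⟩ := exists_coeFn_eq_ite hA b g
  have hcg : c ≤ g := hg.2 fun x hx => by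
    rw [← AEEqFun.coeFn_le]
    filter_upwards [h x hx, hc, AEEqFun.coeFn_le.2 (hg.1 hx)] with ω hb hc hgx
    by_cases hω : ω ∈ A <;> simp [hc, hω, hb, hgx]
  filter_upwards [AEEqFun.coeFn_le.2 hcg, hc] with ω hle hc hω
  simpa [hc, hω] using hle

theorem ae_le_on_of_isLUB [Preorder β] {g b : Ω →ₘ[P] β} (hg : IsLUB S g) (hA : MeasurableSet A)
    (h : ∀ x ∈ S, ∀ᵐ ω ∂P, ω ∈ A → x ω ≤ b ω) : ∀ᵐ ω ∂P, ω ∈ A → g ω ≤ b ω := by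
  obtain ⟨c, hc⟩ := exists_coeFn_eq_ite hA b g
  have hgc : g ≤ c := hg.2 fun x hx => by
    rw [← AEEqFun.coeFn_le]
    filter_upwards [h x hx, hc, AEEqFun.coeFn_le.2 (hg.1 hx)] with ω hb hc hxg
    by_cases hω : ω ∈ A <;> simp [hc, hω, hb, hxg]
  filter_upwards [AEEqFun.coeFn_le.2 hgc, hc] with ω hle hc hω
  simpa [hc, hω] using hle

theorem exists_frequently_lt_of_isLUB [LinearOrder β] {g b : Ω →ₘ[P] β} (hg : IsLUB S g)
    (hA : MeasurableSet A) (h : ∃ᵐ ω ∂P, ω ∈ A ∧ b ω < g ω) :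
    ∃ x ∈ S, ∃ᵐ ω ∂P, ω ∈ A ∧ b ω < x ω := by
  by_contra hc
  simp only [not_exists, not_and, not_frequently, not_lt] at hc
  obtain ⟨ω, ⟨hω, hlt⟩, hle⟩ := (h.and_eventually (ae_le_on_of_isLUB hg hA hc)).exists
  exact (hle hω).not_gt hlt

theorem GlueStable.exists_ae_lt_of_isGLB [IsFiniteMeasure P] {S : Set (L0 P)} (hS : GlueStable S)
    (hne : S.Nonempty) {g : L0 P} (hg : IsGLB S g) (e : L0 P) :
    ∃ z ∈ S, ∀ᵐ ω ∂P, g ω < e ω → z ω < e ω := by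
  obtain ⟨z, hz, hmax⟩ := hS.exists_forall_ae_lt hne e
  have hle : ∀ᵐ ω ∂P, ω ∈ {ω | e ω ≤ z ω} → e ω ≤ g ω :=
    ae_le_on_of_isGLB hg (measurableSet_le e.measurable z.measurable) fun y hy =>
      (hmax y hy).mono fun ω h hω => not_lt.1 fun hlt => (h hlt).not_ge hω
  exact ⟨z, hz, hle.mono fun ω h hlt => not_le.1 fun hω => (h hω).not_gt hlt⟩

theorem exists_isGLB_L0 [IsFiniteMeasure P] {S : Set (L0 P)} (hne : S.Nonempty)
    (hS : BddBelow S) : ∃ g, IsGLB S g := by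
  obtain ⟨y, hy⟩ := hne
  obtain ⟨b, hb⟩ := hS
  have hglb := isGLB_essInfSet (toBar '' S)
  obtain ⟨g, hg⟩ := exists_toBar_eq
    (hglb.2 (by rintro _ ⟨x, hx, rfl⟩; exact toBar_le_toBar.2 (hb hx))) (hglb.1 ⟨y, hy, rfl⟩)
  exact ⟨g, IsGLB.of_image toBar_le_toBar (hg ▸ hglb)⟩

theorem le_add_of_isGLB {S T : Set (L0 P)} {a b c : L0 P} (ha : IsGLB S a) (hb : IsGLB T b)
    (h : ∀ x ∈ S, ∀ y ∈ T, c ≤ x + y) : c ≤ a + b := by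
  have hca : ∀ y ∈ T, c - y ≤ a := fun y hy =>
    ha.2 fun x hx => sub_le_iff_le_add.2 (h x hx y hy)
  exact sub_le_iff_le_add'.1 (hb.2 fun y hy => sub_le_comm.1 (hca y hy))

theorem le_mul_of_isGLB {S : Set (L0 P)} (hne : S.Nonempty) {a c l : L0 P} (ha : IsGLB S a)
    (hl : 0 ≤ l) (h : ∀ x ∈ S, c ≤ l * x) : c ≤ l * a := by
  obtain ⟨d, hd⟩ := exists_coeFn_eq P (c.measurable.div l.measurable)
  have hda : ∀ᵐ ω ∂P, ω ∈ {ω | 0 < l ω} → d ω ≤ a ω :=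
    ae_le_on_of_isGLB ha (measurableSet_lt measurable_const l.measurable) fun x hx => by
      filter_upwards [hd, AEEqFun.coeFn_le.2 (h x hx), AEEqFun.coeFn_mul l x]
        with ω hd hcx hlx hω
      rw [hlx, Pi.mul_apply] at hcx
      rw [hd, Pi.div_apply]
      exact (div_le_iff₀' hω).2 hcx
  obtain ⟨y, hy⟩ := hne
  rw [← AEEqFun.coeFn_le]
  filter_upwards [hda, hd, AEEqFun.coeFn_le.2 (h y hy), AEEqFun.coeFn_mul l y,
    AEEqFun.coeFn_mul l a, nonneg_iff_ae.1 hl] with ω hda hd hcy hly hla hl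
  rw [hla, Pi.mul_apply]
  rcases hl.eq_or_lt with h0 | h0
  · simpa [hly, ← h0] using hcy
  · exact (div_le_iff₀' h0).1 (hd.symm.trans_le (hda h0))

end EssInf

/-! ### The Hahn–Banach theorem for `L⁰`-modules -/

section HahnBanach

variable {E : Type*} [AddCommGroup E] [Module (L0 P) E]

theorem ind_smul_glue {A : Set Ω} (hA : MeasurableSet A) (x y : E) :
    ind P hA • (ind P hA • x + ind P hA.compl • y) = ind P hA • x := by
  have hsq : ind P hA * ind P hA = ind P hA * 1 :=
    (ind_mul_eq_ind_mul_iff hA).2 <| by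
      filter_upwards [coeFn_ind (P := P) hA, AEEqFun.coeFn_one (μ := P) (β := ℝ)]
        with ω hind h1 hω
      simp [hind, h1, hω]
  have hcompl : ind P hA * ind P hA.compl = ind P hA * 0 :=
    (ind_mul_eq_ind_mul_iff hA).2 <| by
      filter_upwards [coeFn_ind (P := P) hA.compl, AEEqFun.coeFn_zero (μ := P) (β := ℝ)]
        with ω hind h0 hω
      simp [hind, h0, hω]
  rw [smul_add, smul_smul, smul_smul, hsq, hcompl, mul_one, mul_zero, zero_smul, add_zero]

open Classical in
theorem coeFn_map_glue (f : E →ₗ[L0 P] L0 P) {A : Set Ω} (hA : MeasurableSet A) (x y : E) :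
    ∀ᵐ ω ∂P, f (ind P hA • x + ind P hA.compl • y) ω = if ω ∈ A then f x ω else f y ω := by
  simpa only [map_add, map_smul, smul_eq_mul] using coeFn_ind_mul_add hA (f x) (f y)

theorem L0Convex.glue_mem {C : Set E} (hC : L0Convex P C) {A : Set Ω} (hA : MeasurableSet A)
    {x y : E} (hx : x ∈ C) (hy : y ∈ C) : ind P hA • x + ind P hA.compl • y ∈ C := by
  have hcompl : ind P hA.compl = 1 - ind P hA := eq_sub_of_add_eq' (ind_add_ind_compl hA)
  rw [hcompl]
  refine hC _ (ind_nonneg hA) (sub_nonneg.1 ?_) x hx y hy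
  exact hcompl ▸ ind_nonneg hA.compl

/-- `L⁰`-sublinear maps, the analogue of sublinear functionals for modules over `L⁰`. -/
structure IsSublinear (q : E → L0 P) : Prop where
  add_le : ∀ x y, q (x + y) ≤ q x + q y
  smul_le : ∀ l : L0 P, 0 ≤ l → ∀ x, q (l • x) ≤ l * q x

namespace IsSublinear

variable {p q : E → L0 P}

theorem map_zero (hq : IsSublinear q) : q 0 = 0 :=
  le_antisymm (by simpa using hq.smul_le 0 le_rfl 0)
    (by simpa using hq.add_le 0 0)

theorem neg_map_neg_le (hq : IsSublinear q) (x : E) : -q (-x) ≤ q x :=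
  neg_le_iff_add_nonneg.2 (by simpa [hq.map_zero] using hq.add_le x (-x))

theorem of_isGLB {S : E → Set (L0 P)} (hne : ∀ x, (S x).Nonempty) (hq : ∀ x, IsGLB (S x) (q x))
    (hadd : ∀ x y, ∀ a ∈ S x, ∀ b ∈ S y, ∃ c ∈ S (x + y), c ≤ a + b)
    (hsmul : ∀ l : L0 P, 0 ≤ l → ∀ x, ∀ a ∈ S x, ∃ c ∈ S (l • x), c ≤ l * a) :
    IsSublinear q where
  add_le x y := le_add_of_isGLB (hq x) (hq y) fun a ha b hb => by
    obtain ⟨c, hc, hle⟩ := hadd x y a ha b hb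
    exact ((hq _).1 hc).trans hle
  smul_le l hl x := le_mul_of_isGLB (hne x) (hq x) hl fun a ha => by
    obtain ⟨c, hc, hle⟩ := hsmul l hl x a ha
    exact ((hq _).1 hc).trans hle

theorem map_smul_of_nonneg (hq : IsSublinear q) {l : L0 P} (hl : 0 ≤ l) (x : E) :
    q (l • x) = l * q x := by
  refine le_antisymm (hq.smul_le l hl x) ?_
  have hpos : IsPos (l + 1) := isPos_one.add_of_nonneg hl
  obtain ⟨k, hk, hlk, -⟩ := hpos.exists_inv
  have hle : q x ≤ k * q ((l + 1) • x) := by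
    simpa [smul_smul, mul_comm k, hlk] using hq.smul_le k hk.le ((l + 1) • x)
  have hmul : l * q x + q x ≤ q (l • x) + q x :=
    calc l * q x + q x = (l + 1) * q x := by ring
      _ ≤ (l + 1) * (k * q ((l + 1) • x)) := mul_le_mul_of_nonneg_left hle hpos.le
      _ = q (l • x + x) := by rw [← mul_assoc, hlk, one_mul, add_smul, one_smul]
      _ ≤ q (l • x) + q x := hq.add_le _ _
  exact le_of_add_le_add_right hmul

theorem eq_on (hq : IsSublinear q) {A : Set Ω} (hA : MeasurableSet A) {x y : E}
    (h : ind P hA • x = ind P hA • y) : ∀ᵐ ω ∂P, ω ∈ A → q x ω = q y ω := by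
  rw [← ind_mul_eq_ind_mul_iff hA, ← hq.map_smul_of_nonneg (ind_nonneg hA),
    ← hq.map_smul_of_nonneg (ind_nonneg hA), h]

theorem exists_linearMap_eq (hq : IsSublinear q) (hneg : ∀ x, q (-x) = -q x) :
    ∃ f : E →ₗ[L0 P] L0 P, ∀ x, f x = q x := by
  have hadd : ∀ x y, q (x + y) = q x + q y := fun x y => by
    refine le_antisymm (hq.add_le x y) (neg_le_neg_iff.1 ?_)
    have := hq.add_le (-x) (-y)
    rwa [← neg_add, hneg, hneg, hneg, ← neg_add] at this
  refine ⟨{ toFun := q, map_add' := hadd, map_smul' := fun l x => ?_ }, fun x => rfl⟩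
  rw [RingHom.id_apply, smul_eq_mul, ← posPart_sub_negPart l, sub_smul, sub_eq_add_neg, hadd, hneg,
    hq.map_smul_of_nonneg (posPart_nonneg l), hq.map_smul_of_nonneg (negPart_nonneg l)]
  ring

variable [IsFiniteMeasure P]

/-- The witness is `q y = essinf {p (y + l c) - l d : c ∈ C, l ≥ 0}`. -/
theorem exists_isSublinear_le (hp : IsSublinear p) {C : Set E} (hC : L0Convex P C)
    (hne : C.Nonempty) {d : L0 P} (hd : ∀ c ∈ C, d ≤ p c) :
    ∃ q : E → L0 P, IsSublinear q ∧ q ≤ p ∧ ∀ c ∈ C, q (-c) ≤ -d := by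
  let S (y : E) : Set (L0 P) := {a | ∃ c ∈ C, ∃ l : L0 P, 0 ≤ l ∧ a = p (y + l • c) - l * d}
  obtain ⟨c₀, hc₀⟩ := hne
  have hSne : ∀ y, (S y).Nonempty := fun y => ⟨_, c₀, hc₀, 0, le_rfl, rfl⟩
  have hb : ∀ y, BddBelow (S y) := fun y => ⟨-p (-y), by
    rintro _ ⟨c, hc, l, hl, rfl⟩
    have hle : l * d ≤ p (y + l • c) + p (-y) :=
      calc l * d ≤ l * p c := mul_le_mul_of_nonneg_left (hd c hc) hl
        _ = p (y + l • c + -y) := by rw [← hp.map_smul_of_nonneg hl, add_neg_cancel_comm]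
        _ ≤ p (y + l • c) + p (-y) := hp.add_le _ _
    rw [neg_le_iff_add_nonneg, sub_add_eq_add_sub]
    exact sub_nonneg.2 hle⟩
  choose q hq using fun y => exists_isGLB_L0 (hSne y) (hb y)
  refine ⟨q, of_isGLB hSne hq ?_ ?_, fun y => (hq y).1 ⟨c₀, hc₀, 0, le_rfl, by simp⟩,
    fun c hc => (hq _).1 ⟨c, hc, 1, zero_le_one, by simp [hp.map_zero]⟩⟩
  · rintro y z _ ⟨c, hc, l, hl, rfl⟩ _ ⟨e, he, k, hk, rfl⟩
    obtain ⟨t, ht0, ht1, htl, htk⟩ := exists_convex_weight hl hk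
    refine ⟨_, ⟨_, hC t ht0 ht1 c hc e he, l + k, add_nonneg hl hk, rfl⟩, ?_⟩
    have hsum : y + z + (l + k) • (t • c + (1 - t) • e) = (y + l • c) + (z + k • e) := by
      rw [smul_add, smul_smul, smul_smul, htl, htk]
      abel
    rw [hsum, add_mul, sub_add_sub_comm]
    exact sub_le_sub_right (hp.add_le _ _) _
  · rintro k hk y _ ⟨c, hc, l, hl, rfl⟩
    refine ⟨_, ⟨c, hc, k * l, mul_nonneg hk hl, rfl⟩, ?_⟩
    rw [mul_sub, mul_assoc, mul_smul, ← smul_add]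
    exact sub_le_sub_right (hp.smul_le k hk _) _

theorem exists_le_of_isChain {c : Set (E → L0 P)} (hcp : ∀ q ∈ c, IsSublinear q ∧ q ≤ p)
    (hc : IsChain (· ≤ ·) c) (hne : c.Nonempty) :
    ∃ q : E → L0 P, IsSublinear q ∧ ∀ r ∈ c, q ≤ r := by
  have hb : ∀ x : E, BddBelow ((fun r : E → L0 P => r x) '' c) := fun x => ⟨-p (-x), by
    rintro _ ⟨r, hr, rfl⟩
    exact (neg_le_neg ((hcp r hr).2 (-x))).trans ((hcp r hr).1.neg_map_neg_le x)⟩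
  choose q hq using fun x => exists_isGLB_L0 (hne.image fun r : E → L0 P => r x) (hb x)
  refine ⟨q, of_isGLB (fun x => hne.image _) hq ?_ ?_, fun r hr x => (hq x).1 ⟨r, hr, rfl⟩⟩
  · rintro x y _ ⟨r, hr, rfl⟩ _ ⟨t, ht, rfl⟩
    rcases hc.total hr ht with h | h
    · exact ⟨r (x + y), ⟨r, hr, rfl⟩, ((hcp r hr).1.add_le x y).trans (add_le_add_right (h y) _)⟩
    · exact ⟨t (x + y), ⟨t, ht, rfl⟩, ((hcp t ht).1.add_le x y).trans (add_le_add_left (h x) _)⟩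
  · rintro l hl x _ ⟨r, hr, rfl⟩
    exact ⟨r (l • x), ⟨r, hr, rfl⟩, (hcp r hr).1.smul_le l hl x⟩

theorem exists_minimal_le (hp : IsSublinear p) :
    ∃ q : E → L0 P, q ≤ p ∧ Minimal IsSublinear q := by
  obtain ⟨q, -, ⟨hq, hqp⟩, hmin⟩ := zorn_le_nonempty₀ (α := (E → L0 P)ᵒᵈ)
    {q | IsSublinear (OrderDual.ofDual q) ∧ OrderDual.ofDual q ≤ p} (fun c hcs hc y hy => by
      obtain ⟨q, hq, hqr⟩ := exists_le_of_isChain (p := p) (c := OrderDual.toDual ⁻¹' c)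
        (fun r hr => hcs hr) hc.symm ⟨y, hy⟩
      exact ⟨OrderDual.toDual q, ⟨hq, (hqr _ hy).trans (hcs hy).2⟩, fun r hr => hqr _ hr⟩)
    (OrderDual.toDual p) ⟨hp, le_rfl⟩
  exact ⟨OrderDual.ofDual q, hqp, hq, fun r hr hrq =>
    hmin (y := OrderDual.toDual r) ⟨hr, hrq.trans hqp⟩ hrq⟩

theorem map_neg_of_minimal (hq : Minimal IsSublinear q) (x : E) : q (-x) = -q x := by
  refine le_antisymm ?_ (neg_le.1 (hq.1.neg_map_neg_le x))
  have hconv : L0Convex P {x} := by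
    rintro l - - _ rfl _ rfl
    rw [← add_smul, add_sub_cancel, one_smul]
    rfl
  obtain ⟨r, hr, hrq, hneg⟩ := hq.1.exists_isSublinear_le hconv (Set.singleton_nonempty x)
    (d := q x) (by rintro _ rfl; rfl)
  exact (hq.2 hr hrq (-x)).trans (hneg x rfl)

/-- The Mazur–Orlicz form of the Hahn–Banach theorem. -/
theorem exists_linearMap_le_forall_le (hp : IsSublinear p) {C : Set E} (hC : L0Convex P C)
    (hne : C.Nonempty) {d : L0 P} (hd : ∀ c ∈ C, d ≤ p c) :
    ∃ f : E →ₗ[L0 P] L0 P, (∀ x, f x ≤ p x) ∧ ∀ c ∈ C, d ≤ f c := by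
  obtain ⟨q, hq, hqp, hqC⟩ := hp.exists_isSublinear_le hC hne hd
  obtain ⟨r, hrq, hr⟩ := hq.exists_minimal_le
  obtain ⟨f, hf⟩ := hr.1.exists_linearMap_eq (map_neg_of_minimal hr)
  refine ⟨f, fun x => (hf x).trans_le ((hrq x).trans (hqp x)), fun c hc => ?_⟩
  rw [← neg_le_neg_iff, ← map_neg, hf]
  exact (hrq _).trans (hqC c hc)

end IsSublinear

end HahnBanach

/-! ### One-sided versions of increasing local functions -/

section OneSided

/-- The constant `r`, as an element of `L̄⁰`. Rational constants detect the one-sided limits of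
increasing local functions. -/
def constBar (P : Measure Ω) (r : ℝ) : Lbar P := AEEqFun.const Ω (r : EReal)

theorem coeFn_constBar (r : ℝ) : ∀ᵐ ω ∂P, constBar P r ω = r :=
  AEEqFun.coeFn_const Ω (r : EReal)

/-- A self-map of `L̄⁰` which is increasing on each part of `Ω` separately. This combines
monotonicity and locality in the form in which they are used pointwise. -/
def LocalMono (F : Lbar P → Lbar P) : Prop :=
  ∀ s t, ∀ᵐ ω ∂P, s ω ≤ t ω → F s ω ≤ F t ω

variable {F : Lbar P → Lbar P}

theorem localMono_of_monotone (hmono : Monotone F)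
    (hloc : ∀ A (hA : MeasurableSet A) s t, F (glue hA s t) = glue hA (F s) (F t)) :
    LocalMono F := by
  intro s t
  have hA : MeasurableSet {ω | s ω ≤ t ω} := measurableSet_le s.measurable t.measurable
  have hle : glue hA s t ≤ t := by
    rw [← AEEqFun.coeFn_le]
    filter_upwards [coeFn_glue hA s t] with ω hglue
    rw [hglue]
    split_ifs with hω
    exacts [hω, le_rfl]
  filter_upwards [AEEqFun.coeFn_le.2 (hmono hle), coeFn_glue hA (F s) (F t)] with ω hle hglue hω
  rw [hloc, hglue] at hle
  exact (if_pos (Set.mem_ofPred_eq.mpr hω) : _ = F s ω).symm.trans_le hle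

theorem LocalMono.monotone (hF : LocalMono F) : Monotone F := fun s t hst => by
  rw [← AEEqFun.coeFn_le] at hst ⊢
  filter_upwards [hF s t, hst] with ω h hst using h hst

namespace LocalMono

variable [IsFiniteMeasure P]

theorem rightVersion_le (hF : LocalMono F) (m n : Lbar P) :
    ∀ᵐ ω ∂P, m ω < n ω → rightVersion F m ω ≤ F n ω := by
  have hA : MeasurableSet {ω | m ω < n ω} := measurableSet_lt m.measurable n.measurable
  obtain ⟨k, hk⟩ := exists_coeFn_eq_ite hA n (AEEqFun.const Ω ⊤)
  have hadm : ∀ᵐ ω ∂P, m ω < ⊤ → m ω < k ω := by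
    filter_upwards [hk, AEEqFun.coeFn_const (μ := P) Ω (⊤ : EReal)] with ω hk htop hm
    rw [hk, htop]
    split_ifs with hω
    exacts [hω, hm]
  filter_upwards [AEEqFun.coeFn_le.2 ((isGLB_essInfSet {x | ∃ n : Lbar P,
      (∀ᵐ ω ∂P, m ω < ⊤ → m ω < n ω) ∧ x = F n}).1 ⟨k, hadm, rfl⟩),
    coeFn_glue (measurableSet_lt_top m) _ _, hk, hF k n] with ω hle hglue hk hFk hω
  have hkn : k ω = n ω := hk.trans (if_pos (Set.mem_ofPred_eq.mpr hω))
  refine Eq.trans_le ?_ (hle.trans (hFk hkn.le))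
  exact hglue.trans (if_pos (Set.mem_ofPred_eq.mpr (hω.trans_le le_top)))

theorem le_leftVersion (hF : LocalMono F) (m n : Lbar P) :
    ∀ᵐ ω ∂P, n ω < m ω → F n ω ≤ leftVersion F m ω := by
  have hA : MeasurableSet {ω | n ω < m ω} := measurableSet_lt n.measurable m.measurable
  obtain ⟨k, hk⟩ := exists_coeFn_eq_ite hA n (AEEqFun.const Ω ⊥)
  have hadm : ∀ᵐ ω ∂P, ⊥ < m ω → k ω < m ω := by
    filter_upwards [hk, AEEqFun.coeFn_const (μ := P) Ω (⊥ : EReal)] with ω hk hbot hm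
    rw [hk, hbot]
    split_ifs with hω
    exacts [hω, hm]
  filter_upwards [AEEqFun.coeFn_le.2 ((isLUB_essSupSet {x | ∃ n : Lbar P,
      (∀ᵐ ω ∂P, ⊥ < m ω → n ω < m ω) ∧ x = F n}).1 ⟨k, hadm, rfl⟩),
    coeFn_glue (measurableSet_bot_lt m) _ _, hk, hF n k] with ω hle hglue hk hFk hω
  have hkn : k ω = n ω := hk.trans (if_pos (Set.mem_ofPred_eq.mpr hω))
  refine ((hFk hkn.ge).trans hle).trans_eq ?_
  exact (hglue.trans (if_pos (Set.mem_ofPred_eq.mpr (bot_le.trans_lt hω)))).symm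

theorem rightVersion_lt_iff (hF : LocalMono F) (m : Lbar P) :
    ∀ᵐ ω ∂P, ∀ c, rightVersion F m ω < c ↔ ∃ q : ℚ, m ω < (q : ℝ) ∧ F (constBar P q) ω < c := by
  classical
  obtain ⟨b, hb⟩ := exists_coeFn_eq P <| Measurable.iInf fun q : ℚ =>
    Measurable.ite (measurableSet_lt m.measurable (measurable_const (a := ((q : ℝ) : EReal))))
      (F (constBar P q)).measurable (measurable_const (a := (⊤ : EReal)))
  have hle := ae_le_on_of_isGLB (b := b) (isGLB_essInfSet {x | ∃ n : Lbar P,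
      (∀ᵐ ω ∂P, m ω < ⊤ → m ω < n ω) ∧ x = F n}) (measurableSet_lt_top m) <| by
    rintro _ ⟨n, hn, rfl⟩
    filter_upwards [hb, hn, ae_all_iff.2 fun q : ℚ => hF (constBar P q) n,
      ae_all_iff.2 fun q : ℚ => coeFn_constBar (P := P) q] with ω hb hn hFn hq hω
    obtain ⟨q, hmq, hqn⟩ := EReal.lt_iff_exists_rat_btwn.1 (hn hω)
    rw [hb]
    refine iInf_le_of_le q ((if_pos hmq).trans_le (hFn q ?_))
    rw [hq]
    exact hqn.le
  filter_upwards [hb, hle, coeFn_glue (measurableSet_lt_top m) _ _,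
    AEEqFun.coeFn_const (μ := P) Ω (⊤ : EReal), ae_all_iff.2 fun q : ℚ => coeFn_constBar (P := P) q,
    ae_all_iff.2 fun q : ℚ => hF.rightVersion_le m (constBar P q)]
    with ω hb hle hglue htop hconst hright c
  refine ⟨fun hc => ?_, fun ⟨q, hmq, hqc⟩ => (hright q (by rwa [hconst])).trans_lt hqc⟩
  have hbc : b ω < c := by
    refine lt_of_le_of_lt ?_ hc
    rw [rightVersion, hglue]
    split_ifs with hω
    exacts [hle hω, le_top.trans_eq htop.symm]
  rw [hb] at hbc
  obtain ⟨q, hq⟩ := iInf_lt_iff.1 hbc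
  split_ifs at hq with hmq
  exacts [⟨q, hmq, hq⟩, absurd hq not_top_lt]

theorem lt_leftVersion_iff (hF : LocalMono F) (m : Lbar P) :
    ∀ᵐ ω ∂P, ∀ c, c < leftVersion F m ω ↔ ∃ q : ℚ, (q : ℝ) < m ω ∧ c < F (constBar P q) ω := by
  classical
  obtain ⟨b, hb⟩ := exists_coeFn_eq P <| Measurable.iSup fun q : ℚ =>
    Measurable.ite (measurableSet_lt (measurable_const (a := ((q : ℝ) : EReal))) m.measurable)
      (F (constBar P q)).measurable (measurable_const (a := (⊥ : EReal)))
  have hle := ae_le_on_of_isLUB (b := b) (isLUB_essSupSet {x | ∃ n : Lbar P,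
      (∀ᵐ ω ∂P, ⊥ < m ω → n ω < m ω) ∧ x = F n}) (measurableSet_bot_lt m) <| by
    rintro _ ⟨n, hn, rfl⟩
    filter_upwards [hb, hn, ae_all_iff.2 fun q : ℚ => hF n (constBar P q),
      ae_all_iff.2 fun q : ℚ => coeFn_constBar (P := P) q] with ω hb hn hFn hq hω
    obtain ⟨q, hnq, hqm⟩ := EReal.lt_iff_exists_rat_btwn.1 (hn hω)
    rw [hb]
    refine (hFn q ?_).trans (le_iSup_of_le q (if_pos hqm).ge)
    rw [hq]
    exact hnq.le
  filter_upwards [hb, hle, coeFn_glue (measurableSet_bot_lt m) _ _,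
    AEEqFun.coeFn_const (μ := P) Ω (⊥ : EReal), ae_all_iff.2 fun q : ℚ => coeFn_constBar (P := P) q,
    ae_all_iff.2 fun q : ℚ => hF.le_leftVersion m (constBar P q)]
    with ω hb hle hglue hbot hconst hleft c
  refine ⟨fun hc => ?_, fun ⟨q, hqm, hcq⟩ => hcq.trans_le (hleft q (by rwa [hconst]))⟩
  have hcb : c < b ω := by
    refine hc.trans_le ?_
    rw [leftVersion, hglue]
    split_ifs with hω
    exacts [hle hω, hbot.trans_le bot_le]
  rw [hb] at hcb
  obtain ⟨q, hq⟩ := lt_iSup_iff.1 hcb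
  split_ifs at hq with hqm
  exacts [⟨q, hqm, hq⟩, absurd hq not_lt_bot]

theorem le_rightVersion_self (hF : LocalMono F) (m : Lbar P) : F m ≤ rightVersion F m := by
  rw [← AEEqFun.coeFn_le]
  filter_upwards [hF.rightVersion_lt_iff m, ae_all_iff.2 fun q : ℚ => hF m (constBar P q),
    ae_all_iff.2 fun q : ℚ => coeFn_constBar (P := P) q] with ω hlt hmono hconst
  refine le_of_forall_gt fun c hc => ?_
  obtain ⟨q, hmq, hqc⟩ := (hlt c).1 hc
  exact (hmono q (by rw [hconst]; exact hmq.le)).trans_lt hqc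

theorem leftVersion_le_self (hF : LocalMono F) (m : Lbar P) : leftVersion F m ≤ F m := by
  rw [← AEEqFun.coeFn_le]
  filter_upwards [hF.lt_leftVersion_iff m, ae_all_iff.2 fun q : ℚ => hF (constBar P q) m,
    ae_all_iff.2 fun q : ℚ => coeFn_constBar (P := P) q] with ω hlt hmono hconst
  refine le_of_forall_lt fun c hc => ?_
  obtain ⟨q, hqm, hcq⟩ := (hlt c).1 hc
  exact hcq.trans_le (hmono q (by rw [hconst]; exact hqm.le))

protected theorem rightVersion (hF : LocalMono F) : LocalMono (rightVersion F) := fun s t => by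
  filter_upwards [hF.rightVersion_lt_iff s, hF.rightVersion_lt_iff t] with ω hs ht hst
  refine le_of_forall_gt fun c hc => (hs c).2 ?_
  obtain ⟨q, htq, hqc⟩ := (ht c).1 hc
  exact ⟨q, hst.trans_lt htq, hqc⟩

theorem rightVersion_rightVersion (hF : LocalMono F) :
    rightVersion (rightVersion F) = rightVersion F := by
  refine funext fun m => le_antisymm ?_ (hF.rightVersion.le_rightVersion_self m)
  rw [← AEEqFun.coeFn_le]
  filter_upwards [hF.rightVersion_lt_iff m, hF.rightVersion.rightVersion_lt_iff m,
    ae_all_iff.2 fun q : ℚ => hF.rightVersion_lt_iff (constBar P q),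
    ae_all_iff.2 fun q : ℚ => coeFn_constBar (P := P) q] with ω hm hm' hq hconst
  refine le_of_forall_gt fun c hc => ?_
  obtain ⟨r, hmr, hrc⟩ := (hm c).1 hc
  obtain ⟨q, hmq, hqr⟩ := EReal.lt_iff_exists_rat_btwn.1 hmr
  exact (hm' c).2 ⟨q, hmq, (hq q c).2 ⟨r, by rwa [hconst], hrc⟩⟩

theorem leftVersion_rightVersion (hF : LocalMono F) (m : Lbar P) :
    leftVersion (rightVersion F) m = leftVersion F m := by
  apply AEEqFun.ext
  filter_upwards [hF.lt_leftVersion_iff m, hF.rightVersion.lt_leftVersion_iff m,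
    ae_all_iff.2 fun q : ℚ => ae_all_iff.2 fun r : ℚ =>
      hF.rightVersion_le (constBar P q) (constBar P r),
    ae_all_iff.2 fun q : ℚ => AEEqFun.coeFn_le.2 (hF.le_rightVersion_self (constBar P q)),
    ae_all_iff.2 fun q : ℚ => coeFn_constBar (P := P) q] with ω hm hm' hqr hself hconst
  refine eq_of_forall_lt_iff fun c => ?_
  rw [hm, hm']
  refine ⟨fun ⟨q, hqm, hcq⟩ => ?_, fun ⟨q, hqm, hcq⟩ => ⟨q, hqm, hcq.trans_le (hself q)⟩⟩
  obtain ⟨r, hq, hrm⟩ := EReal.lt_iff_exists_rat_btwn.1 hqm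
  exact ⟨r, hrm, hcq.trans_le (hqr q r (by rwa [hconst, hconst]))⟩

end LocalMono

end OneSided

/-! ### Risk functions induce assessment indices -/

section Robust

theorem coeFn_convexComb (l a b : L0 P) :
    ∀ᵐ ω ∂P, (l * a + (1 - l) * b) ω = l ω * a ω + (1 - l ω) * b ω := by
  filter_upwards [AEEqFun.coeFn_add (l * a) ((1 - l) * b), AEEqFun.coeFn_mul l a,
    AEEqFun.coeFn_mul (1 - l) b, AEEqFun.coeFn_sub 1 l, AEEqFun.coeFn_one (μ := P) (β := ℝ)]
    with ω hadd hla hlb hsub h1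
  simp [hadd, hla, hlb, hsub, h1]

theorem eventually_nhds_ae_pos (a : L0 P) : ∀ᶠ b in 𝓝 a, ∀ᵐ ω ∂P, 0 < a ω → 0 < b ω := by
  obtain ⟨r, hr⟩ := exists_coeFn_eq_ite (measurableSet_lt measurable_const a.measurable)
    (AEEqFun.mk (fun ω => a ω / 2) (a.measurable.div_const 2).aestronglyMeasurable) (1 : L0 P)
  have hrpos : ∀ᵐ ω ∂P, 0 < r ω ∧ (0 < a ω → r ω < a ω) := by
    filter_upwards [hr, AEEqFun.coeFn_mk (μ := P) (fun ω => a ω / 2)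
      (a.measurable.div_const 2).aestronglyMeasurable, AEEqFun.coeFn_one (μ := P) (β := ℝ)]
      with ω hr hhalf h1
    rw [hr, hhalf, h1]
    split_ifs with hω
    · exact ⟨half_pos hω, fun _ => half_lt_self hω⟩
    · exact ⟨one_pos, fun h => absurd h hω⟩
  refine (mem_nhds_iff_ball a _).2 ⟨r, hrpos.mono fun ω h => h.1, fun b hb => ?_⟩
  rw [Set.mem_ofPred_eq]
  filter_upwards [hrpos, hb] with ω hr hb hω
  linarith [hr.2 hω, le_abs_self (a ω - b ω)]

variable {X : Type*} [AddCommGroup X] [Module (L0 P) X] [TopologicalSpace X] {K : Set X}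
  {R : polarCone (P := P) K → Lbar P → Lbar P}

namespace IsRiskFunction

theorem localMono (hR : IsRiskFunction R) (Z : polarCone (P := P) K) : LocalMono (R Z) :=
  localMono_of_monotone (hR.increasing Z) fun A hA s t => hR.isLocal A hA Z Z Z (by
    rw [← add_smul, ind_add_ind_compl, one_smul]) s t

variable [IsFiniteMeasure P]

theorem robust_le_robust_on (hR : IsRiskFunction R) {A : Set Ω} (hA : MeasurableSet A) {x y : X}
    (h : ∀ Z : polarCone (P := P) K, ∀ᵐ ω ∂P, ω ∈ A → Z.1 x ω ≤ Z.1 y ω) :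
    ∀ᵐ ω ∂P, ω ∈ A → robust R x ω ≤ robust R y ω := by
  refine ae_le_on_of_isGLB (isGLB_essInfSet _) hA ?_
  rintro _ ⟨Z, rfl⟩
  filter_upwards [AEEqFun.coeFn_le.2 ((isGLB_essInfSet _).1 ⟨Z, rfl⟩ : robust R x ≤ _),
    hR.localMono Z (toBar (Z.1 x)) (toBar (Z.1 y)), h Z, coeFn_toBar (Z.1 x), coeFn_toBar (Z.1 y)]
    with ω hle hmono hxy hx hy hω
  rw [hx, hy, EReal.coe_le_coe_iff] at hmono
  exact hle.trans (hmono (hxy hω))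

theorem robust_eq_on (hR : IsRiskFunction R) {A : Set Ω} (hA : MeasurableSet A) {x y : X}
    (h : ∀ Z : polarCone (P := P) K, ∀ᵐ ω ∂P, ω ∈ A → Z.1 x ω = Z.1 y ω) :
    ∀ᵐ ω ∂P, ω ∈ A → robust R x ω = robust R y ω := by
  filter_upwards [hR.robust_le_robust_on hA fun Z => (h Z).mono fun ω h hω => (h hω).le,
    hR.robust_le_robust_on hA fun Z => (h Z).mono fun ω h hω => (h hω).ge] with ω hle hge hω
  exact le_antisymm (hle hω) (hge hω)

theorem robust_glue (hR : IsRiskFunction R) {A : Set Ω} (hA : MeasurableSet A) (x y : X) :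
    robust R (ind P hA • x + ind P hA.compl • y) = glue hA (robust R x) (robust R y) := by
  have hZ (Z : polarCone (P := P) K) :=
    coeFn_map_glue ((Z.1 : X →L[L0 P] L0 P) : X →ₗ[L0 P] L0 P) hA x y
  apply AEEqFun.ext
  filter_upwards [hR.robust_eq_on hA fun Z => (hZ Z).mono fun ω h hω => h.trans (if_pos hω),
    hR.robust_eq_on hA.compl fun Z => (hZ Z).mono fun ω h hω => h.trans (if_neg hω),
    coeFn_glue hA (robust R x) (robust R y)] with ω hx hy hglue
  rw [hglue]
  split_ifs with hω
  exacts [hx hω, hy hω]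

theorem inf_robust_le (hR : IsRiskFunction R) {l : L0 P} (hl0 : 0 ≤ l) (hl1 : l ≤ 1) (x y : X) :
    robust R x ⊓ robust R y ≤ robust R (l • x + (1 - l) • y) := by
  refine (isGLB_essInfSet _).2 ?_
  rintro _ ⟨Z, rfl⟩
  set z := Z.1 (l • x + (1 - l) • y)
  have hz : ∀ᵐ ω ∂P, z ω = l ω * Z.1 x ω + (1 - l ω) * Z.1 y ω := by
    simpa only [z, map_add, map_smul, smul_eq_mul] using coeFn_convexComb l (Z.1 x) (Z.1 y)
  rw [← AEEqFun.coeFn_le]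
  filter_upwards [AEEqFun.coeFn_inf (robust R x) (robust R y),
    AEEqFun.coeFn_le.2 ((isGLB_essInfSet _).1 ⟨Z, rfl⟩ : robust R x ≤ _),
    AEEqFun.coeFn_le.2 ((isGLB_essInfSet _).1 ⟨Z, rfl⟩ : robust R y ≤ _),
    hR.localMono Z (toBar (Z.1 x)) (toBar z), hR.localMono Z (toBar (Z.1 y)) (toBar z),
    coeFn_toBar (Z.1 x), coeFn_toBar (Z.1 y), coeFn_toBar z, hz, nonneg_iff_ae.1 hl0,
    le_one_iff_ae.1 hl1] with ω hinf hx hy hmonox hmonoy hZx hZy hZz hz hl0 hl1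
  rw [hZx, hZz, hz, EReal.coe_le_coe_iff] at hmonox
  rw [hZy, hZz, hz, EReal.coe_le_coe_iff] at hmonoy
  rw [hinf]
  rcases le_total (Z.1 x ω) (Z.1 y ω) with h | h
  · exact (inf_le_left.trans hx).trans (hmonox (by nlinarith))
  · exact (inf_le_right.trans hy).trans (hmonoy (by nlinarith))

theorem robust_isAssessmentIndex (hR : IsRiskFunction R) : IsAssessmentIndex K (robust R) where
  isLocal _ hA x y := hR.robust_glue hA x y
  quasiconcave _ hl0 hl1 x y := hR.inf_robust_le hl0 hl1 x y
  monotone x y hxy := by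
    rw [← AEEqFun.coeFn_le]
    filter_upwards [hR.robust_le_robust_on MeasurableSet.univ (x := y) (y := x) fun Z => by
      have hle : Z.1 y ≤ Z.1 x := sub_nonneg.1 (by simpa only [map_sub] using Z.2 _ hxy)
      exact (AEEqFun.coeFn_le.2 hle).mono fun ω h _ => h] with ω h using h trivial

theorem isClosed_le (hR : IsRiskFunction R) (Z : polarCone (P := P) K) (m : Lbar P) :
    IsClosed {s : L0 P | m ≤ R Z (toBar s)} := by
  refine isOpen_compl_iff.1 (isOpen_iff_eventually.2 fun s hs => ?_)
  obtain ⟨q, hq⟩ : ∃ q : ℚ, ∃ᵐ ω ∂P, s ω < q ∧ R Z (constBar P q) ω < m ω := by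
    by_contra hc
    simp only [not_exists, not_frequently, ← ae_all_iff] at hc
    refine hs (AEEqFun.coeFn_le.1 ?_)
    filter_upwards [hc, (hR.localMono Z).rightVersion_lt_iff (toBar s), coeFn_toBar s]
      with ω hc hlt hs
    rw [← hR.rightContinuous Z, hs] at hlt
    refine not_lt.1 fun h => ?_
    obtain ⟨q, hsq, hqm⟩ := (hlt _).1 h
    exact hc q ⟨EReal.coe_lt_coe_iff.1 hsq, hqm⟩
  have hcont : Continuous fun t : L0 P => AEEqFun.const Ω (q : ℝ) - t :=
    continuous_const.sub continuous_id
  filter_upwards [hcont.continuousAt.eventually (eventually_nhds_ae_pos _)] with t ht hle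
  refine hq ?_
  filter_upwards [ht, AEEqFun.coeFn_le.2 hle, AEEqFun.coeFn_sub (AEEqFun.const Ω (q : ℝ)) s,
    AEEqFun.coeFn_sub (AEEqFun.const Ω (q : ℝ)) t, AEEqFun.coeFn_const (μ := P) Ω (q : ℝ),
    hR.localMono Z (toBar t) (constBar P q), coeFn_toBar t, coeFn_constBar (P := P) q]
    with ω hpos hle hsub hsub' hconst hmono ht hq hω
  rw [hsub, hsub', Pi.sub_apply, Pi.sub_apply, hconst, sub_pos, sub_pos] at hpos
  rw [ht, hq, EReal.coe_le_coe_iff] at hmono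
  exact (hle.trans (hmono (hpos hω.1).le)).not_gt hω.2

theorem robust_isUSC (hR : IsRiskFunction R) : IsUSC (robust R) := by
  intro m
  have hset : {x | m ≤ robust R x} = ⋂ Z : polarCone (P := P) K,
      (fun x => Z.1 x) ⁻¹' {s : L0 P | m ≤ R Z (toBar s)} := by
    ext x
    simp only [Set.mem_iInter, Set.mem_preimage, Set.mem_ofPred_eq, robust,
      le_isGLB_iff (isGLB_essInfSet _), mem_lowerBounds, Set.forall_mem_range]
  rw [hset]
  exact isClosed_iInter fun Z => (hR.isClosed_le Z m).preimage
    (ContinuousLinearMap.continuous (Z.1 : X →L[L0 P] L0 P))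

end IsRiskFunction

end Robust

/-! ### The minimal risk function of an assessment index -/

section MinRisk

theorem coe_mul_add_coe_mul_le {l k a b : ℝ} (hl : 0 ≤ l) (hk : 0 ≤ k) {s t : EReal} (hs : s ≤ a)
    (ht : t ≤ b) : (l : EReal) * s + k * t ≤ (l * a + k * b : ℝ) := by
  rw [EReal.coe_add, EReal.coe_mul, EReal.coe_mul]
  exact add_le_add (mul_le_mul_of_nonneg_left hs (EReal.coe_nonneg.2 hl))
    (mul_le_mul_of_nonneg_left ht (EReal.coe_nonneg.2 hk))

theorem coe_mul_add_coe_mul_lt {l k a b : ℝ} (hl : 0 ≤ l) (hk : 0 ≤ k) (hlk : l + k = 1)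
    {s t : EReal} (hs : s < a) (ht : t < b) :
    (l : EReal) * s + k * t < (l * a + k * b : ℝ) := by
  obtain ⟨s', hss', hs'a⟩ := EReal.lt_iff_exists_real_btwn.1 hs
  obtain ⟨t', htt', ht'b⟩ := EReal.lt_iff_exists_real_btwn.1 ht
  refine (coe_mul_add_coe_mul_le hl hk hss'.le htt'.le).trans_lt (EReal.coe_lt_coe_iff.2 ?_)
  rw [EReal.coe_lt_coe_iff] at hs'a ht'b
  rcases hl.eq_or_lt with rfl | hl
  · rw [zero_add] at hlk
    simpa [hlk] using ht'b
  · nlinarith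

theorem coe_mul_lt_iff {l : ℝ} (hl : 0 < l) (z : ℝ) (s : EReal) :
    ((l * z : ℝ) : EReal) < s ↔ (z : EReal) < s * (l⁻¹ : ℝ) := by
  induction s with
  | bot => simp [EReal.bot_mul_coe_of_pos (inv_pos.2 hl)]
  | top => simp only [EReal.top_mul_coe_of_pos (inv_pos.2 hl), EReal.coe_lt_top]
  | coe r =>
    rw [← EReal.coe_mul, EReal.coe_lt_coe_iff, EReal.coe_lt_coe_iff, ← div_eq_mul_inv,
      lt_div_iff₀' hl]

theorem mul_coe_inv_lt_mul_coe_inv {l : ℝ} (hl : 0 < l) {s t : EReal} (h : s < t) :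
    s * (l⁻¹ : ℝ) < t * (l⁻¹ : ℝ) := by
  obtain ⟨r, hsr, hrt⟩ := EReal.lt_iff_exists_real_btwn.1 h
  rw [show r = l * (r * l⁻¹) by field_simp, coe_mul_lt_iff hl] at hrt
  refine lt_of_le_of_lt ?_ hrt
  rw [EReal.coe_mul]
  exact mul_le_mul_of_nonneg_right hsr.le (EReal.coe_nonneg.2 (inv_pos.2 hl).le)

theorem divBar_divBar {l k : L0 P} (hl : IsPos l) (hk : ∀ᵐ ω ∂P, k ω = (l ω)⁻¹) (s : Lbar P) :
    divBar (divBar s l) k = s := by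
  apply AEEqFun.ext
  filter_upwards [coeFn_divBar (divBar s l) k, coeFn_divBar s l, hl, hk]
    with ω hslk hsl hl hk
  rw [hslk, hsl, hk, inv_inv, mul_assoc, ← EReal.coe_mul, inv_mul_cancel₀ hl.ne', EReal.coe_one,
    mul_one]

theorem measurableSet_coe_lt (a : L0 P) (s : Lbar P) :
    MeasurableSet {ω | (a ω : EReal) < s ω} :=
  measurableSet_lt a.measurable.coe_real_ereal s.measurable

variable {X : Type*} [AddCommGroup X] [Module (L0 P) X] [TopologicalSpace X] {K : Set X}

theorem smul_add_smul_apply (l k : L0 P) (Z₁ Z₂ : WeakDual (L0 P) X) (x : X) :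
    (l • Z₁ + k • Z₂) x = l * Z₁ x + k * Z₂ x :=
  rfl

/-- The essential supremum of `α x` subject to `⟨Z, x⟩ < s`, where the constraint may hold on a part
of `Ω` only: `α x` competes on `{⟨Z, x⟩ < s}` and is replaced by `-∞` elsewhere. -/
def levelSup (α : X → Lbar P) (Z : WeakDual (L0 P) X) (s : Lbar P) : Lbar P :=
  essSupSet (Set.range fun x => glue (measurableSet_coe_lt (Z x) s) (α x) (AEEqFun.const Ω ⊥))

/-- The minimal risk function of `α`, that is, the right-continuous version of `levelSup α`. -/
def minRisk (α : X → Lbar P) (Z : polarCone (P := P) K) : Lbar P → Lbar P :=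
  rightVersion (levelSup α Z.1)

theorem levelSup_smul (α : X → Lbar P) {l : L0 P} (hl : IsPos l) (Z : WeakDual (L0 P) X)
    (s : Lbar P) : levelSup α (l • Z) s = levelSup α Z (divBar s l) := by
  refine congrArg (fun f => essSupSet (Set.range f)) (funext fun x => AEEqFun.ext ?_)
  have hsmul : (l • Z) x = l * Z x := rfl
  filter_upwards [coeFn_glue (measurableSet_coe_lt ((l • Z) x) s) (α x) (AEEqFun.const Ω ⊥),
    coeFn_glue (measurableSet_coe_lt (Z x) (divBar s l)) (α x) (AEEqFun.const Ω ⊥), hl,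
    coeFn_divBar s l, AEEqFun.coeFn_mul l (Z x)] with ω hglue hglue' hl hdiv hmul
  rw [hglue, hglue']
  simp only [hsmul, hmul, Pi.mul_apply, coe_mul_lt_iff hl, hdiv]

variable [IsFiniteMeasure P] (α : X → Lbar P)

theorem le_levelSup (Z : WeakDual (L0 P) X) (s : Lbar P) (x : X) :
    ∀ᵐ ω ∂P, (Z x ω : EReal) < s ω → α x ω ≤ levelSup α Z s ω := by
  filter_upwards [AEEqFun.coeFn_le.2 ((isLUB_essSupSet _).1 ⟨x, rfl⟩ : _ ≤ levelSup α Z s),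
    coeFn_glue (measurableSet_coe_lt (Z x) s) (α x) (AEEqFun.const Ω ⊥)] with ω hle hglue hω
  exact (hglue.trans (if_pos hω)).symm.trans_le hle

variable {α}

theorem levelSup_le_on {Z : WeakDual (L0 P) X} {s : Lbar P} {A : Set Ω} (hA : MeasurableSet A)
    {b : Lbar P} (h : ∀ x, ∀ᵐ ω ∂P, ω ∈ A → (Z x ω : EReal) < s ω → α x ω ≤ b ω) :
    ∀ᵐ ω ∂P, ω ∈ A → levelSup α Z s ω ≤ b ω := by
  refine ae_le_on_of_isLUB (isLUB_essSupSet _) hA ?_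
  rintro _ ⟨x, rfl⟩
  filter_upwards [h x, coeFn_glue (measurableSet_coe_lt (Z x) s) (α x) (AEEqFun.const Ω ⊥),
    AEEqFun.coeFn_const (μ := P) Ω (⊥ : EReal)] with ω h hglue hbot hω
  rw [hglue, hbot]
  split_ifs with hlt
  exacts [h hω hlt, bot_le]

theorem levelSup_le {Z : WeakDual (L0 P) X} {s b : Lbar P}
    (h : ∀ x, ∀ᵐ ω ∂P, (Z x ω : EReal) < s ω → α x ω ≤ b ω) : levelSup α Z s ≤ b := by
  rw [← AEEqFun.coeFn_le]
  filter_upwards [levelSup_le_on MeasurableSet.univ fun x => (h x).mono fun ω h _ => h]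
    with ω h using h trivial

theorem levelSup_le_levelSup_on {Z Z' : WeakDual (L0 P) X} {s t : Lbar P} {A : Set Ω}
    (hA : MeasurableSet A) (hZ : ∀ x, ∀ᵐ ω ∂P, ω ∈ A → Z x ω = Z' x ω)
    (hst : ∀ᵐ ω ∂P, ω ∈ A → s ω ≤ t ω) :
    ∀ᵐ ω ∂P, ω ∈ A → levelSup α Z s ω ≤ levelSup α Z' t ω := by
  refine levelSup_le_on hA fun x => ?_
  filter_upwards [hZ x, hst, le_levelSup α Z' t x] with ω hZ hst hle hω hlt
  exact hle (hZ hω ▸ hlt.trans_le (hst hω))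

variable (α) in
theorem localMono_levelSup (Z : WeakDual (L0 P) X) : LocalMono (levelSup α Z) := fun s t =>
  levelSup_le_levelSup_on (measurableSet_le s.measurable t.measurable)
    (fun _ => Eventually.of_forall fun _ _ => rfl) (Eventually.of_forall fun _ h => h)

variable (α) in
theorem leftVersion_levelSup (Z : WeakDual (L0 P) X) (s : Lbar P) :
    leftVersion (levelSup α Z) s = levelSup α Z s := by
  have hmono := localMono_levelSup α Z
  refine le_antisymm (hmono.leftVersion_le_self s) (levelSup_le fun x => ?_)
  filter_upwards [ae_all_iff.2 fun q : ℚ => le_levelSup α Z (constBar P q) x,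
    ae_all_iff.2 fun q : ℚ => hmono.le_leftVersion s (constBar P q),
    ae_all_iff.2 fun q : ℚ => coeFn_constBar (P := P) q] with ω hle hleft hconst hω
  obtain ⟨q, hZq, hqs⟩ := EReal.lt_iff_exists_rat_btwn.1 hω
  exact (hle q (by rwa [hconst])).trans (hleft q (by rwa [hconst]))

variable (α) in
theorem leftVersion_minRisk (Z : polarCone (P := P) K) (s : Lbar P) :
    leftVersion (minRisk α Z) s = levelSup α Z.1 s :=
  ((localMono_levelSup α Z.1).leftVersion_rightVersion s).trans (leftVersion_levelSup α Z.1 s)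

theorem minRisk_le_minRisk_on {Z Z' : polarCone (P := P) K} {s t : Lbar P} {A : Set Ω}
    (hA : MeasurableSet A) (hZ : ∀ x, ∀ᵐ ω ∂P, ω ∈ A → Z.1 x ω = Z'.1 x ω)
    (hst : ∀ᵐ ω ∂P, ω ∈ A → s ω ≤ t ω) :
    ∀ᵐ ω ∂P, ω ∈ A → minRisk α Z s ω ≤ minRisk α Z' t ω := by
  filter_upwards [(localMono_levelSup α Z.1).rightVersion_lt_iff s,
    (localMono_levelSup α Z'.1).rightVersion_lt_iff t, hst,
    ae_all_iff.2 fun q : ℚ => levelSup_le_levelSup_on (α := α) hA hZ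
      (Eventually.of_forall fun ω _ => le_refl (constBar P q ω))] with ω hs ht hst hle hω
  refine le_of_forall_gt fun c hc => (hs c).2 ?_
  obtain ⟨q, htq, hqc⟩ := (ht c).1 hc
  exact ⟨q, (hst hω).trans_lt htq, (hle q hω).trans_lt hqc⟩

theorem minRisk_eq_minRisk_on {Z Z' : polarCone (P := P) K} {s t : Lbar P} {A : Set Ω}
    (hA : MeasurableSet A) (hZ : ∀ x, ∀ᵐ ω ∂P, ω ∈ A → Z.1 x ω = Z'.1 x ω)
    (hst : ∀ᵐ ω ∂P, ω ∈ A → s ω = t ω) :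
    ∀ᵐ ω ∂P, ω ∈ A → minRisk α Z s ω = minRisk α Z' t ω := by
  filter_upwards [minRisk_le_minRisk_on (α := α) hA hZ (hst.mono fun ω h hω => (h hω).le),
    minRisk_le_minRisk_on (α := α) hA (fun x => (hZ x).mono fun ω h hω => (h hω).symm)
      (hst.mono fun ω h hω => (h hω).ge)] with ω hle hge hω
  exact le_antisymm (hle hω) (hge hω)

variable (α) in
theorem le_minRisk (Z : polarCone (P := P) K) (s : Lbar P) (x : X) :
    ∀ᵐ ω ∂P, (Z.1 x ω : EReal) ≤ s ω → α x ω ≤ minRisk α Z s ω := by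
  filter_upwards [(localMono_levelSup α Z.1).rightVersion_lt_iff s,
    ae_all_iff.2 fun q : ℚ => le_levelSup α Z.1 (constBar P q) x,
    ae_all_iff.2 fun q : ℚ => coeFn_constBar (P := P) q] with ω hs hle hconst hω
  refine le_of_forall_gt fun c hc => ?_
  obtain ⟨q, hsq, hqc⟩ := (hs c).1 hc
  exact (hle q (by rw [hconst]; exact hω.trans_lt hsq)).trans_lt hqc

variable (α)

theorem minRisk_isRiskFunction : IsRiskFunction (minRisk (K := K) α) where
  isLocal A hA Z₁ Z₂ Z hZ s t := by
    have hite (x : X) := coeFn_ind_mul_add hA (Z₁.1 x) (Z₂.1 x)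
    simp only [← smul_add_smul_apply, ← hZ] at hite
    apply AEEqFun.ext
    filter_upwards [coeFn_glue hA (minRisk α Z₁ s) (minRisk α Z₂ t),
      minRisk_eq_minRisk_on (α := α) (Z := Z) (s := glue hA s t) hA
        (fun x => (hite x).mono fun ω h hω => h.trans (if_pos hω))
        ((coeFn_glue hA s t).mono fun ω h hω => h.trans (if_pos hω)),
      minRisk_eq_minRisk_on (α := α) (Z := Z) (s := glue hA s t) hA.compl
        (fun x => (hite x).mono fun ω h hω => h.trans (if_neg hω))
        ((coeFn_glue hA s t).mono fun ω h hω => h.trans (if_neg hω))] with ω hglue hmem hnotMem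
    rw [hglue]
    split_ifs with hω
    exacts [hmem hω, hnotMem hω]
  increasing Z := (localMono_levelSup α Z.1).rightVersion.monotone
  rightContinuous Z := (localMono_levelSup α Z.1).rightVersion_rightVersion.symm

variable {α}

theorem levelSup_comb_le {l : L0 P} (hl0 : 0 ≤ l) (hl1 : l ≤ 1) (Z₁ Z₂ : WeakDual (L0 P) X)
    (s t : Lbar P) : levelSup α (l • Z₁ + (1 - l) • Z₂) (combBar l s (1 - l) t) ≤
      levelSup α Z₁ s ⊔ levelSup α Z₂ t := by
  refine levelSup_le fun x => ?_
  rw [smul_add_smul_apply]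
  filter_upwards [le_levelSup α Z₁ s x, le_levelSup α Z₂ t x,
    AEEqFun.coeFn_sup (levelSup α Z₁ s) (levelSup α Z₂ t), coeFn_combBar l s (1 - l) t,
    coeFn_convexComb l (Z₁ x) (Z₂ x),
    AEEqFun.coeFn_sub 1 l, AEEqFun.coeFn_one (μ := P) (β := ℝ), nonneg_iff_ae.1 hl0,
    le_one_iff_ae.1 hl1] with ω hs ht hsup hcomb hZ hsub h1 hl0 hl1 hω
  rw [Pi.sub_apply, h1, Pi.one_apply] at hsub
  rw [hsup]
  by_contra! hlt
  obtain ⟨hlt₁, hlt₂⟩ := max_lt_iff.1 hlt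
  refine hω.not_ge ?_
  rw [hcomb, hZ, hsub]
  exact coe_mul_add_coe_mul_le hl0 (sub_nonneg.2 hl1) (not_lt.1 fun h => (hs h).not_gt hlt₁)
    (not_lt.1 fun h => (ht h).not_gt hlt₂)

theorem minRisk_comb_le {l : L0 P} (hl0 : 0 ≤ l) (hl1 : l ≤ 1) {Z₁ Z₂ Z : polarCone (P := P) K}
    (hZ : Z.1 = l • Z₁.1 + (1 - l) • Z₂.1) (s t : Lbar P) :
    minRisk α Z (combBar l s (1 - l) t) ≤ minRisk α Z₁ s ⊔ minRisk α Z₂ t := by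
  rw [← AEEqFun.coeFn_le]
  filter_upwards [(localMono_levelSup α Z₁.1).rightVersion_lt_iff s,
    (localMono_levelSup α Z₂.1).rightVersion_lt_iff t,
    AEEqFun.coeFn_sup (minRisk α Z₁ s) (minRisk α Z₂ t), coeFn_combBar l s (1 - l) t,
    AEEqFun.coeFn_sub 1 l, AEEqFun.coeFn_one (μ := P) (β := ℝ), nonneg_iff_ae.1 hl0,
    le_one_iff_ae.1 hl1, ae_all_iff.2 fun q : ℚ => coeFn_constBar (P := P) q,
    ae_all_iff.2 fun q : ℚ => ae_all_iff.2 fun r : ℚ =>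
      coeFn_combBar l (constBar P q) (1 - l) (constBar P r),
    ae_all_iff.2 fun q : ℚ => ae_all_iff.2 fun r : ℚ =>
      (localMono_levelSup α Z.1).rightVersion_le (combBar l s (1 - l) t)
        (combBar l (constBar P q) (1 - l) (constBar P r)),
    ae_all_iff.2 fun q : ℚ => ae_all_iff.2 fun r : ℚ =>
      (AEEqFun.coeFn_le.2 (levelSup_comb_le (α := α) hl0 hl1 Z₁.1 Z₂.1 (constBar P q)
        (constBar P r))).trans (AEEqFun.coeFn_sup _ _).le]
    with ω hs ht hsup hcomb hsub h1 hl0 hl1 hconst hcomb' hright hle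
  rw [Pi.sub_apply, h1, Pi.one_apply] at hsub
  rw [hsup]
  refine le_of_forall_gt fun c hc => ?_
  obtain ⟨hc₁, hc₂⟩ := max_lt_iff.1 hc
  obtain ⟨q, hsq, hqc⟩ := (hs c).1 hc₁
  obtain ⟨r, htr, hrc⟩ := (ht c).1 hc₂
  refine (hright q r ?_).trans_lt ?_
  · rw [hcomb, hcomb', hconst, hconst, hsub, ← EReal.coe_mul, ← EReal.coe_mul, ← EReal.coe_add]
    exact coe_mul_add_coe_mul_lt hl0 (sub_nonneg.2 hl1) (add_sub_cancel _ _) hsq htr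
  · rw [hZ]
    exact (hle q r).trans_lt (max_lt hqc hrc)

theorem minRisk_divBar_le {l : L0 P} (hl : IsPos l) {Z Z' : polarCone (P := P) K}
    (hZ : Z'.1 = l • Z.1) (s : Lbar P) : minRisk α Z (divBar s l) ≤ minRisk α Z' s := by
  rw [← AEEqFun.coeFn_le]
  filter_upwards [(localMono_levelSup α Z'.1).rightVersion_lt_iff s, coeFn_divBar s l, hl,
    ae_all_iff.2 fun q : ℚ => coeFn_divBar (constBar P q) l,
    ae_all_iff.2 fun q : ℚ => coeFn_constBar (P := P) q,
    ae_all_iff.2 fun q : ℚ => (localMono_levelSup α Z.1).rightVersion_le (divBar s l)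
      (divBar (constBar P q) l)] with ω hs hdiv hl hdiv' hconst hright
  refine le_of_forall_gt fun c hc => ?_
  obtain ⟨q, hsq, hqc⟩ := (hs c).1 hc
  rw [hZ, levelSup_smul α ‹IsPos l›] at hqc
  refine (hright q ?_).trans_lt hqc
  rw [hdiv, hdiv', hconst]
  exact mul_coe_inv_lt_mul_coe_inv hl hsq

theorem minRisk_smul {l : L0 P} (hl : IsPos l) {Z Z' : polarCone (P := P) K}
    (hZ : Z'.1 = l • Z.1) (s : Lbar P) : minRisk α Z' s = minRisk α Z (divBar s l) := by
  obtain ⟨k, hk, hlk, hkl⟩ := hl.exists_inv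
  have hZ' : Z.1 = k • Z'.1 := by rw [hZ, smul_smul, mul_comm, hlk, one_smul]
  refine le_antisymm ?_ (minRisk_divBar_le hl hZ s)
  simpa only [divBar_divBar hl hkl] using minRisk_divBar_le (α := α) hk hZ' (divBar s l)

variable (α)

theorem essSupSet_range_minRisk (Z : polarCone (P := P) K) :
    essSupSet (Set.range fun s : L0 P => minRisk α Z (toBar s)) = essSupSet (Set.range α) := by
  refine le_antisymm ((isLUB_essSupSet _).2 ?_) ((isLUB_essSupSet _).2 ?_)
  · rintro _ ⟨s, rfl⟩
    have hle (q : ℚ) : levelSup α Z.1 (constBar P q) ≤ essSupSet (Set.range α) :=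
      levelSup_le fun x => (AEEqFun.coeFn_le.2
        ((isLUB_essSupSet (Set.range α)).1 ⟨x, rfl⟩)).mono fun ω h _ => h
    rw [← AEEqFun.coeFn_le]
    filter_upwards [ae_all_iff.2 fun q : ℚ => AEEqFun.coeFn_le.2 (hle q),
      ae_all_iff.2 fun q : ℚ => coeFn_constBar (P := P) q, coeFn_toBar s,
      ae_all_iff.2 fun q : ℚ =>
        (localMono_levelSup α Z.1).rightVersion_le (toBar s) (constBar P q)]
      with ω hle hconst hs hright
    obtain ⟨q, hq⟩ := exists_rat_gt (s ω)
    exact (hright q (by rw [hconst, hs]; exact EReal.coe_lt_coe_iff.2 hq)).trans (hle q)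
  · rintro _ ⟨x, rfl⟩
    refine le_trans ?_ ((isLUB_essSupSet _).1 ⟨Z.1 x, rfl⟩)
    rw [← AEEqFun.coeFn_le]
    filter_upwards [le_minRisk α Z (toBar (Z.1 x)) x, coeFn_toBar (Z.1 x)] with ω hle hx
    exact hle hx.ge

theorem isClosed_levelSup_le (m : Lbar P) :
    IsClosed {p : polarCone (P := P) K × L0 P | levelSup α p.1.1 (toBar p.2) ≤ m} := by
  refine isOpen_compl_iff.1 (isOpen_iff_eventually.2 ?_)
  rintro ⟨Z, s⟩ hp
  obtain ⟨x, hx⟩ : ∃ x, ∃ᵐ ω ∂P, Z.1 x ω < s ω ∧ m ω < α x ω := by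
    by_contra hc
    simp only [not_exists, not_frequently] at hc
    refine hp (levelSup_le fun x => ?_)
    filter_upwards [hc x, coeFn_toBar s] with ω hc hs hω
    rw [hs, EReal.coe_lt_coe_iff] at hω
    exact not_lt.1 fun h => hc ⟨hω, h⟩
  have hcont : Continuous fun p : polarCone (P := P) K × L0 P => p.2 - p.1.1 x :=
    continuous_snd.sub
      ((WeakDual.eval_continuous x).comp (continuous_subtype_val.comp continuous_fst))
  filter_upwards [hcont.continuousAt.eventually (eventually_nhds_ae_pos _)]
  rintro ⟨Z', s'⟩ hpos hle
  refine hx ?_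
  filter_upwards [hpos, le_levelSup α Z'.1 (toBar s') x, coeFn_toBar s', AEEqFun.coeFn_le.2 hle,
    AEEqFun.coeFn_sub s (Z.1 x), AEEqFun.coeFn_sub s' (Z'.1 x)]
    with ω hpos hlevel hs hle hsub hsub' hω
  rw [hsub, hsub', Pi.sub_apply, Pi.sub_apply, sub_pos, sub_pos] at hpos
  rw [hs, EReal.coe_lt_coe_iff] at hlevel
  exact ((hlevel (hpos hω.1)).trans hle).not_gt hω.2

theorem minRisk_isMinimal : IsMinimalRiskFunction (minRisk (K := K) α) where
  toIsRiskFunction := minRisk_isRiskFunction α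
  quasiconvex _ hl0 hl1 _ _ _ hZ s t := minRisk_comb_le hl0 hl1 hZ s t
  scaling _ hl _ _ hZ s := minRisk_smul hl hZ s
  asymptoticMax Z Z' := by rw [essSupSet_range_minRisk, essSupSet_range_minRisk]
  lsc m := by
    simp only [leftVersion_minRisk]
    exact isClosed_levelSup_le α m

theorem minRisk_isNormalizedAtZero : IsNormalizedAtZero (minRisk (K := K) α) := by
  intro Z hZ s
  have hbot : levelSup α Z.1 (toBar 0) ≤ AEEqFun.const Ω ⊥ := levelSup_le fun x => by
    have hZx : Z.1 x = 0 := by rw [hZ]; rfl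
    filter_upwards [coeFn_toBar (0 : L0 P)] with ω h0 hω
    rw [hZx, h0] at hω
    exact absurd hω (lt_irrefl _)
  filter_upwards [(localMono_levelSup α Z.1).rightVersion_le s (toBar 0), AEEqFun.coeFn_le.2 hbot,
    AEEqFun.coeFn_const (μ := P) Ω (⊥ : EReal), coeFn_toBar (0 : L0 P),
    AEEqFun.coeFn_zero (μ := P) (β := ℝ)] with ω hright hle hbot hbar h0 hω
  rw [hbar, h0, Pi.zero_apply, EReal.coe_zero] at hright
  exact le_bot_iff.1 ((hright hω).trans (hle.trans_eq hbot))

end MinRisk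

/-! ### Gauges of neighbourhoods of zero -/

section Gauge

variable {X : Type*} [AddCommGroup X] [Module (L0 P) X] {U : Set X} {p : X → L0 P}

variable (P) in
/-- The scalars `l ∈ L⁰₊₊` with `x ∈ l U`, whose essential infimum is the gauge of `U` at `x`. -/
def gaugeSet (U : Set X) (x : X) : Set (L0 P) := {l | IsPos l ∧ ∃ u ∈ U, x = l • u}

/-- `p` is the Minkowski gauge of `U`. The infima need not exist for sets that are not
absorbent, hence a predicate rather than a function of `U`. -/
def IsGauge (U : Set X) (p : X → L0 P) : Prop := ∀ x, IsGLB (gaugeSet P U x) (p x)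

theorem zero_mem_lowerBounds_gaugeSet (U : Set X) (x : X) :
    0 ∈ lowerBounds (gaugeSet P U x) := fun _ hl => hl.1.le

theorem exists_isGauge [IsFiniteMeasure P] (habs : L0Absorbent P U) :
    ∃ p : X → L0 P, IsGauge U p := by
  choose p hp using fun x =>
    exists_isGLB_L0 (S := gaugeSet P U x) (habs x) ⟨0, zero_mem_lowerBounds_gaugeSet U x⟩
  exact ⟨p, hp⟩

theorem glueStable_gaugeSet (hσ : SigmaStable P U) (x : X) : GlueStable (gaugeSet P U x) := by
  intro A hA y hy
  obtain ⟨z, hz⟩ := hA.exists_forall_ae_eq y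
  have hzpos : IsPos z := hA.ae_of_forall fun n => by
    filter_upwards [hz n, (hy n).1] with ω hz hpos hω
    rwa [hz hω]
  obtain ⟨k, -, hzk, -⟩ := hzpos.exists_inv
  choose u hu hxu using fun n => (hy n).2
  have hku : IsConcat P hA u (k • x) := fun n => by
    have hkz : ind P (hA.measurable n) * z = ind P (hA.measurable n) * y n :=
      (ind_mul_eq_ind_mul_iff _).2 (hz n)
    rw [hxu n, smul_smul, smul_smul, mul_right_comm, ← hkz, mul_assoc, hzk, mul_one]
  exact ⟨z, ⟨hzpos, k • x, hσ A hA u hu _ hku, by rw [smul_smul, hzk, one_smul]⟩,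
    fun n => (hz n).mono fun ω h hω => (h hω).le⟩

namespace IsGauge

theorem nonneg (hp : IsGauge U p) (x : X) : 0 ≤ p x :=
  (hp x).2 (zero_mem_lowerBounds_gaugeSet U x)

theorem smul_le (hp : IsGauge U p) {l : L0 P} (hl : IsPos l) {u : X} (hu : u ∈ U) :
    p (l • u) ≤ l :=
  (hp _).1 ⟨hl, u, hu, rfl⟩

theorem isSublinear (hp : IsGauge U p) (hconv : L0Convex P U) (habs : L0Absorbent P U)
    (hbal : L0Balanced P U) : IsSublinear p where
  add_le x y := by
    refine le_add_of_isGLB (hp x) (hp y) ?_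
    rintro a ⟨ha, u, hu, rfl⟩ b ⟨hb, v, hv, rfl⟩
    obtain ⟨t, ht0, ht1, hta, htb⟩ := exists_convex_weight ha.le hb.le
    have hsum : a • u + b • v = (a + b) • (t • u + (1 - t) • v) := by
      rw [smul_add, smul_smul, smul_smul, hta, htb]
    exact hsum ▸ hp.smul_le (hb.add_of_nonneg ha.le) (hconv t ht0 ht1 u hu v hv)
  smul_le l hl x := by
    refine le_mul_of_isGLB (habs x) (hp x) hl ?_
    rintro a ⟨ha, u, hu, rfl⟩
    refine le_of_forall_isPos_le_add fun e he => ?_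
    have hla : 0 ≤ l * a := mul_nonneg hl ha.le
    obtain ⟨t, ht0, ht1, hta, -⟩ := exists_convex_weight hla he.le
    have htU : t • u ∈ U := hbal t (by
      filter_upwards [nonneg_iff_ae.1 ht0, le_one_iff_ae.1 ht1] with ω h0 h1
      exact abs_le.2 ⟨by linarith, h1⟩) u hu
    simpa only [smul_smul, hta] using hp.smul_le (he.add_of_nonneg hla) htU

theorem mem_of_ae_lt_one [IsFiniteMeasure P] (hp : IsGauge U p) (hσ : SigmaStable P U)
    (habs : L0Absorbent P U) (hbal : L0Balanced P U) {x : X} (h : ∀ᵐ ω ∂P, p x ω < 1) :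
    x ∈ U := by
  obtain ⟨l, ⟨hl, u, hu, rfl⟩, hlt⟩ :=
    (glueStable_gaugeSet hσ x).exists_ae_lt_of_isGLB (habs x) (hp x) 1
  refine hbal l ?_ u hu
  filter_upwards [hl, hlt, h, AEEqFun.coeFn_one (μ := P) (β := ℝ)] with ω hl hlt h h1
  rw [h1, Pi.one_apply] at hlt
  exact abs_le.2 ⟨by linarith, (hlt h).le⟩

theorem continuous_of_le [TopologicalSpace X] [IsTopologicalAddGroup X]
    [ContinuousSMul (L0 P) X] (hp : IsGauge U p) (hU : U ∈ 𝓝 (0 : X)) (hbal : L0Balanced P U)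
    {f : X →ₗ[L0 P] L0 P} (hf : ∀ x, f x ≤ p x) : Continuous f := by
  refine continuous_of_continuousAt_zero f ?_
  rw [ContinuousAt, map_zero]
  intro V hV
  obtain ⟨e, he, heV⟩ := (mem_nhds_iff_ball _ _).1 hV
  obtain ⟨k, -, hek, -⟩ := he.exists_inv
  have hkU : {x : X | k • x ∈ U} ∈ 𝓝 (0 : X) :=
    (continuous_const_smul k).continuousAt.preimage_mem_nhds (by rwa [smul_zero])
  have hle : ∀ u ∈ U, f (e • u) ≤ e := fun u hu => (hf _).trans (hp.smul_le he hu)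
  rw [mem_map]
  filter_upwards [hkU] with x hx
  have hneg : -(k • x) ∈ U := by
    rw [← neg_one_smul (L0 P) (k • x)]
    refine hbal (-1) ?_ _ hx
    filter_upwards [AEEqFun.coeFn_neg (1 : L0 P), AEEqFun.coeFn_one (μ := P) (β := ℝ)]
      with ω hneg h1
    simp [hneg, h1]
  have hxe : f x ≤ e := by simpa [smul_smul, hek] using hle _ hx
  have hxe' : -f x ≤ e := by
    simpa only [smul_neg, smul_smul, hek, one_smul, map_neg] using hle _ hneg
  refine heV (mem_ball_zero.2 ?_)
  filter_upwards [AEEqFun.coeFn_le.2 hxe, AEEqFun.coeFn_le.2 hxe', AEEqFun.coeFn_neg (f x)]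
    with ω hxe hxe' hneg
  rw [hneg, Pi.neg_apply] at hxe'
  exact abs_le.2 ⟨neg_le.1 hxe', hxe⟩

end IsGauge

end Gauge

/-! ### Separation of closed convex sets from points -/

section Separation

variable {X : Type*} [AddCommGroup X] [Module (L0 P) X]

theorem glueStable_image_sub {C : Set X} (hC : SigmaStable P C)
    (hconcat : ∀ (A : ℕ → Set Ω) (hA : IsPartition A) (x : ℕ → X), ∃ y, IsConcat P hA x y)
    {p : X → L0 P} (hp : IsSublinear p) (x : X) : GlueStable ((fun c => p (c - x)) '' C) := by
  intro A hA y hy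
  choose c hc hcy using hy
  obtain ⟨z, hz⟩ := hconcat A hA c
  refine ⟨_, ⟨z, hC A hA c hc z hz, rfl⟩, fun n => ?_⟩
  filter_upwards [hp.eq_on (hA.measurable n) (x := z - x) (y := c n - x) (by
    rw [smul_sub, smul_sub, hz n])] with ω heq hω
  exact (heq hω).trans_le (congrArg (fun a : L0 P => a ω) (hcy n)).le

theorem L0Convex.image_sub_right {C : Set X} (hC : L0Convex P C) (x : X) :
    L0Convex P ((fun c => c - x) '' C) := by
  rintro l hl0 hl1 _ ⟨y, hy, rfl⟩ _ ⟨z, hz, rfl⟩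
  refine ⟨_, hC l hl0 hl1 y hy z hz, ?_⟩
  simp only [smul_sub, sub_smul, one_smul]
  abel

variable [IsFiniteMeasure P]

theorem IsSublinear.exists_linearMap_separating {p : X → L0 P} (hp : IsSublinear p) {C : Set X}
    (hC : L0Convex P C) (hne : C.Nonempty) {x : X} {d : L0 P} (hd : ∀ c ∈ C, d ≤ p (c - x)) :
    ∃ f : X →ₗ[L0 P] L0 P, (∀ y, f y ≤ p y) ∧ ∀ c ∈ C, f x + d ≤ f c := by
  obtain ⟨f, hfp, hf⟩ := hp.exists_linearMap_le_forall_le (hC.image_sub_right x) (hne.image _)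
    (Set.forall_mem_image.2 hd)
  refine ⟨f, hfp, fun c hc => ?_⟩
  rw [← le_sub_iff_add_le', ← map_sub]
  exact hf _ ⟨c, hc, rfl⟩

variable [TopologicalSpace X]

theorem exists_isGauge_nhds (hX : IsConditionallyLocallyConvex P X) {V : Set X}
    (hV : V ∈ 𝓝 (0 : X)) :
    ∃ U ∈ 𝓝 (0 : X), L0Balanced P U ∧ ∃ p : X → L0 P, IsGauge U p ∧ IsSublinear p ∧
      ∀ x, (∀ᵐ ω ∂P, p x ω < 1) → x ∈ V := by
  obtain ⟨U, hU, hUV, hσ, hconv, habs, hbal⟩ := hX.nhds_base V hV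
  obtain ⟨p, hp⟩ := exists_isGauge habs
  exact ⟨U, hU, hbal, p, hp, hp.isSublinear hconv habs hbal,
    fun x hx => hUV (hp.mem_of_ae_lt_one hσ habs hbal hx)⟩

/-- If the distance from `x` to `C` vanished on `A`, then `1_A x + 1_{Aᶜ} x'`, with `x' ∈ C`,
would lie in the closure of `C`. -/
theorem exists_isSublinear_forall_le [ContinuousAdd X]
    (hconcat : ∀ (A : ℕ → Set Ω) (hA : IsPartition A) (x : ℕ → X), ∃ y, IsConcat P hA x y)
    {Q : Set (X → L0 P)} (hQ : ∀ p ∈ Q, IsSublinear p ∧ ∀ x, 0 ≤ p x)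
    (hbase : ∀ V ∈ 𝓝 (0 : X), ∃ p ∈ Q, ∃ e : L0 P, IsPos e ∧
      ∀ x, (∀ᵐ ω ∂P, p x ω < e ω) → x ∈ V)
    {C : Set X} (hC : IsClosed C) (hconv : L0Convex P C) (hσ : SigmaStable P C)
    (hne : C.Nonempty) {A : Set Ω} (hA : MeasurableSet A) {x : X}
    (hx : ∀ c ∈ C, ind P hA • c ≠ ind P hA • x) :
    ∃ p ∈ Q, ∃ d : L0 P, (∀ c ∈ C, d ≤ p (c - x)) ∧ ∃ᵐ ω ∂P, ω ∈ A ∧ 0 < d ω := by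
  obtain ⟨x', hx'⟩ := hne
  set y := ind P hA • x + ind P hA.compl • x' with hy
  have hyC : y ∉ C := fun h => hx y h (ind_smul_glue hA x x')
  obtain ⟨p, hp, e, he, hpe⟩ := hbase {v | y + v ∈ Cᶜ}
    ((continuous_const_add y).continuousAt.preimage_mem_nhds
      (hC.isOpen_compl.mem_nhds (by rwa [add_zero])))
  obtain ⟨hsub, hnonneg⟩ := hQ p hp
  have hSne : ((fun c => p (c - x)) '' C).Nonempty := ⟨_, x', hx', rfl⟩
  obtain ⟨d, hd⟩ := exists_isGLB_L0 hSne ⟨0, Set.forall_mem_image.2 fun c _ => hnonneg _⟩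
  refine ⟨p, hp, d, fun c hc => hd.1 ⟨c, hc, rfl⟩, fun hd0 => ?_⟩
  obtain ⟨_, ⟨c, hc, rfl⟩, hlt⟩ :=
    (glueStable_image_sub hσ hconcat hsub x).exists_ae_lt_of_isGLB hSne hd e
  refine hpe (ind P hA • (c - x)) ?_ ?_
  · rw [hsub.map_smul_of_nonneg (ind_nonneg hA)]
    filter_upwards [AEEqFun.coeFn_mul (ind P hA) (p (c - x)), coeFn_ind (P := P) hA, he, hlt,
      hd0] with ω hmul hind he hlt hd0
    rw [hmul, Pi.mul_apply, hind]
    split_ifs with hω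
    · rw [one_mul]
      exact hlt ((not_lt.1 fun h => hd0 ⟨hω, h⟩).trans_lt he)
    · rwa [zero_mul]
  · have hsum : y + ind P hA • (c - x) = ind P hA • c + ind P hA.compl • x' := by
      rw [hy, smul_sub]
      abel
    rw [hsum]
    exact hconv.glue_mem hA hc hx'

variable [IsTopologicalAddGroup X] [ContinuousSMul (L0 P) X]

theorem exists_continuousLinearMap_separating (hX : IsConditionallyLocallyConvex P X) {C : Set X}
    (hC : IsClosed C) (hconv : L0Convex P C) (hσ : SigmaStable P C) (hne : C.Nonempty)
    {A : Set Ω} (hA : MeasurableSet A) {x : X} (hx : ∀ c ∈ C, ind P hA • c ≠ ind P hA • x) :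
    ∃ (f : X →L[L0 P] L0 P) (d : L0 P), (∀ c ∈ C, f x + d ≤ f c) ∧
      ∃ᵐ ω ∂P, ω ∈ A ∧ 0 < d ω := by
  obtain ⟨p, ⟨U, hU, hbal, hp, hsub⟩, d, hd, hpos⟩ :=
    exists_isSublinear_forall_le hX.exists_concat
      (Q := {p | ∃ U ∈ 𝓝 (0 : X), L0Balanced P U ∧ IsGauge U p ∧ IsSublinear p})
      (fun p ⟨U, _, _, hp, hsub⟩ => ⟨hsub, hp.nonneg⟩)
      (fun V hV => by
        obtain ⟨U, hU, hbal, p, hp, hsub, hpV⟩ := exists_isGauge_nhds hX hV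
        refine ⟨p, ⟨U, hU, hbal, hp, hsub⟩, 1, isPos_one, fun x hx => hpV x ?_⟩
        filter_upwards [hx, AEEqFun.coeFn_one (μ := P) (β := ℝ)] with ω hx h1
        rwa [h1] at hx)
      hC hconv hσ hne hA hx
  obtain ⟨f, hfp, hf⟩ := hsub.exists_linearMap_separating hconv hne hd
  exact ⟨⟨f, hp.continuous_of_le hU hbal hfp⟩, d, hf, hpos⟩

end Separation

/-! ### The robust representation -/

section Representation

variable {X : Type*} [AddCommGroup X] [Module (L0 P) X] {K : Set X} {α : X → Lbar P}

namespace IsAssessmentIndex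

theorem eq_on (hα : IsAssessmentIndex K α) {A : Set Ω} (hA : MeasurableSet A) {x y : X}
    (h : ind P hA • x = ind P hA • y) : ∀ᵐ ω ∂P, ω ∈ A → α x ω = α y ω := by
  have hlocal := hα.isLocal A hA y x
  rw [← h, ← add_smul, ind_add_ind_compl, one_smul] at hlocal
  filter_upwards [coeFn_glue hA (α y) (α x)] with ω hglue hω
  rw [hlocal]
  exact hglue.trans (if_pos hω)

theorem le_glue (hα : IsAssessmentIndex K α) {A : Set Ω} (hA : MeasurableSet A) {m : Lbar P}
    {x y : X} (hx : ∀ᵐ ω ∂P, ω ∈ A → m ω ≤ α x ω) (hy : m ≤ α y) :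
    m ≤ α (ind P hA • x + ind P hA.compl • y) := by
  rw [hα.isLocal A hA x y, ← AEEqFun.coeFn_le]
  filter_upwards [coeFn_glue hA (α x) (α y), hx, AEEqFun.coeFn_le.2 hy] with ω hglue hx hy
  rw [hglue]
  split_ifs with hω
  exacts [hx hω, hy]

theorem l0Convex_superlevel (hα : IsAssessmentIndex K α) (m : Lbar P) :
    L0Convex P {x | m ≤ α x} := fun l hl0 hl1 x hx y hy =>
  (le_inf hx hy).trans (hα.quasiconcave l hl0 hl1 x y)

theorem sigmaStable_superlevel (hα : IsAssessmentIndex K α) (m : Lbar P) :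
    SigmaStable P {x | m ≤ α x} := fun A hA x hx y hy =>
  AEEqFun.coeFn_le.1 <| hA.ae_of_forall fun n => by
    filter_upwards [hα.eq_on (hA.measurable n) (hy n), AEEqFun.coeFn_le.2 (hx n)] with ω heq hle hω
    rwa [heq hω]

end IsAssessmentIndex

variable [IsFiniteMeasure P] [TopologicalSpace X]

theorem exists_frequently_lt_of_lt_minRisk {Z : polarCone (P := P) K} {s : L0 P} {A : Set Ω}
    (hA : MeasurableSet A) {q : Lbar P}
    (h : ∃ᵐ ω ∂P, ω ∈ A ∧ q ω < minRisk α Z (toBar s) ω) :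
    ∃ x, ∃ᵐ ω ∂P, ω ∈ A ∧ q ω < α x ω := by
  have hle : minRisk α Z (toBar s) ≤ essSupSet (Set.range α) :=
    essSupSet_range_minRisk α Z ▸ (isLUB_essSupSet _).1 ⟨s, rfl⟩
  obtain ⟨_, ⟨x, rfl⟩, hx⟩ := exists_frequently_lt_of_isLUB (isLUB_essSupSet (Set.range α)) hA
    (h.mp ((AEEqFun.coeFn_le.2 hle).mono fun ω hle h => ⟨h.1, h.2.trans_le hle⟩))
  exact ⟨x, hx⟩

variable [IsTopologicalAddGroup X] [ContinuousSMul (L0 P) X]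

theorem exists_polarCone_separating (hX : IsConditionallyLocallyConvex P X)
    (hK : IsConvexCone P K) (hα : IsAssessmentIndex K α) (husc : IsUSC α)
    {A : Set Ω} (hA : MeasurableSet A) (hA0 : ∃ᵐ ω ∂P, ω ∈ A) {m : Lbar P} {x x' : X}
    (hx : ∀ᵐ ω ∂P, ω ∈ A → α x ω < m ω) (hx' : m ≤ α x') :
    ∃ (Z : polarCone (P := P) K) (d : L0 P), (∀ c, m ≤ α c → Z.1 x + d ≤ Z.1 c) ∧
      ∃ᵐ ω ∂P, ω ∈ A ∧ 0 < d ω := by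
  obtain ⟨f, d, hf, hd⟩ := exists_continuousLinearMap_separating hX (husc m)
    (hα.l0Convex_superlevel m) (hα.sigmaStable_superlevel m) ⟨x', hx'⟩ hA (x := x) <| by
      intro c hc heq
      obtain ⟨ω, hω, hlt, heq, hle⟩ := (hA0.and_eventually (hx.and
        ((hα.eq_on hA heq).and (AEEqFun.coeFn_le.2 (hc : m ≤ α c))))).exists
      exact (hle.trans_eq (heq hω)).not_gt (hlt hω)
  refine ⟨⟨f, fun k hk => ?_⟩, d, hf, hd⟩
  refine nonneg_of_forall_isPos_le_mul (a := f x + d - f x') fun l hl => ?_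
  have hmem : m ≤ α (x' + l • k) := hx'.trans (hα.monotone _ _ (by
    rw [add_sub_cancel_left]
    exact hK.smul_mem l hl k hk))
  have hle := hf _ hmem
  rw [map_add, map_smul, smul_eq_mul] at hle
  exact sub_le_iff_le_add'.2 hle

theorem exists_minRisk_le (hX : IsConditionallyLocallyConvex P X) (hK : IsConvexCone P K)
    (hα : IsAssessmentIndex K α) (husc : IsUSC α) {A : Set Ω} (hA : MeasurableSet A)
    (hA0 : ∃ᵐ ω ∂P, ω ∈ A) {m : Lbar P} {x x' : X} (hx : ∀ᵐ ω ∂P, ω ∈ A → α x ω < m ω)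
    (hx' : m ≤ α x') :
    ∃ Z : polarCone (P := P) K, ∃ᵐ ω ∂P, ω ∈ A ∧ minRisk α Z (toBar (Z.1 x)) ω ≤ m ω := by
  obtain ⟨Z, d, hZ, hd⟩ := exists_polarCone_separating hX hK hα husc hA hA0 hx hx'
  have hle : levelSup α Z.1 (toBar (Z.1 x + d)) ≤ m := levelSup_le fun y => by
    have hB : MeasurableSet {ω | m ω ≤ α y ω} := measurableSet_le m.measurable (α y).measurable
    filter_upwards [AEEqFun.coeFn_le.2 (hZ _ (hα.le_glue hB (Eventually.of_forall fun ω hω => hω)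
      hx')), coeFn_map_glue ((Z.1 : X →L[L0 P] L0 P) : X →ₗ[L0 P] L0 P) hB y x',
      coeFn_toBar (Z.1 x + d)] with ω hle hglue htoBar hlt
    rw [htoBar, EReal.coe_lt_coe_iff] at hlt
    by_contra hnot
    exact (hle.trans_eq (hglue.trans (if_pos (not_le.1 hnot).le))).not_gt hlt
  refine ⟨Z, hd.mp ?_⟩
  filter_upwards [AEEqFun.coeFn_le.2 hle,
    (localMono_levelSup α Z.1).rightVersion_le (toBar (Z.1 x)) (toBar (Z.1 x + d)),
    coeFn_toBar (Z.1 x), coeFn_toBar (Z.1 x + d), AEEqFun.coeFn_add (Z.1 x) d]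
    with ω hle hright hx hxd hadd hω
  rw [hx, hxd, hadd, Pi.add_apply, EReal.coe_lt_coe_iff] at hright
  exact ⟨hω.1, (hright (lt_add_of_pos_right _ hω.2)).trans hle⟩

theorem exists_frequently_minRisk_le (hX : IsConditionallyLocallyConvex P X)
    (hK : IsConvexCone P K) (hα : IsAssessmentIndex K α) (husc : IsUSC α) {A : Set Ω}
    (hA : MeasurableSet A) {x x' : X} {q : Lbar P} (hx : ∀ᵐ ω ∂P, ω ∈ A → α x ω < q ω)
    (hx' : ∃ᵐ ω ∂P, ω ∈ A ∧ q ω < α x' ω) :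
    ∃ Z : polarCone (P := P) K,
      ∃ᵐ ω ∂P, ω ∈ A ∧ minRisk α Z (toBar (Z.1 x)) ω ≤ q ω := by
  have hB : MeasurableSet (A ∩ {ω | q ω < α x' ω}) :=
    hA.inter (measurableSet_lt q.measurable (α x').measurable)
  obtain ⟨m, hm⟩ := exists_coeFn_eq_ite hB q (AEEqFun.const Ω ⊥)
  have hmx' : m ≤ α x' := AEEqFun.coeFn_le.1 <| by
    filter_upwards [hm, AEEqFun.coeFn_const (μ := P) Ω (⊥ : EReal)] with ω hm hbot
    rw [hm]
    split_ifs with hω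
    exacts [hω.2.le, hbot ▸ bot_le]
  obtain ⟨Z, hZ⟩ := exists_minRisk_le hX hK hα husc hB hx' (m := m) (x := x) (by
    filter_upwards [hm, hx] with ω hm hx hω
    rw [hm, if_pos hω]
    exact hx hω.1) hmx'
  refine ⟨Z, hZ.mp (hm.mono fun ω hm h => ⟨h.1.1, h.2.trans_eq ?_⟩)⟩
  rw [hm, if_pos h.1]

theorem robust_minRisk_le (hX : IsConditionallyLocallyConvex P X) (hK : IsConvexCone P K)
    (hα : IsAssessmentIndex K α) (husc : IsUSC α) (x : X) :
    robust (minRisk (K := K) α) x ≤ α x := by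
  set b := robust (minRisk (K := K) α) x
  have hb (Z : polarCone (P := P) K) : ∀ᵐ ω ∂P, b ω ≤ minRisk α Z (toBar (Z.1 x)) ω :=
    AEEqFun.coeFn_le.2 ((isGLB_essInfSet _).1 ⟨Z, rfl⟩)
  by_contra hnot
  obtain ⟨q, hq⟩ : ∃ q : ℚ, ∃ᵐ ω ∂P, α x ω < (q : ℝ) ∧ ((q : ℝ) : EReal) < b ω := by
    by_contra hc
    simp only [not_exists, not_frequently, ← ae_all_iff] at hc
    refine hnot (AEEqFun.coeFn_le.1 (hc.mono fun ω hc => not_lt.1 fun hlt => ?_))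
    obtain ⟨q, hq⟩ := EReal.lt_iff_exists_rat_btwn.1 hlt
    exact hc q hq
  have hA : MeasurableSet {ω | α x ω < (q : ℝ) ∧ ((q : ℝ) : EReal) < b ω} :=
    (measurableSet_lt (α x).measurable measurable_const).inter
      (measurableSet_lt measurable_const b.measurable)
  obtain ⟨x', hx'⟩ := exists_frequently_lt_of_lt_minRisk (α := α)
    (Z := (⟨0, fun _ _ => le_rfl⟩ : polarCone (P := P) K)) hA (q := constBar P q) <| hq.mp (by
      filter_upwards [hb ⟨0, fun _ _ => le_rfl⟩, coeFn_constBar (P := P) q] with ω hb hq h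
      exact ⟨h, hq.trans_lt (h.2.trans_le hb)⟩)
  obtain ⟨Z, hZ⟩ := exists_frequently_minRisk_le hX hK hα husc hA (x := x)
    ((coeFn_constBar (P := P) q).mono fun ω hq h => h.1.trans_eq hq.symm) hx'
  obtain ⟨ω, ⟨hω, hle⟩, hb, hq⟩ := (hZ.and_eventually ((hb Z).and (coeFn_constBar q))).exists
  exact (hb.trans hle).not_gt (hq.trans_lt hω.2)

theorem robust_minRisk (hX : IsConditionallyLocallyConvex P X) (hK : IsConvexCone P K)
    (hα : IsAssessmentIndex K α) (husc : IsUSC α) (x : X) :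
    α x = robust (minRisk (K := K) α) x := by
  refine le_antisymm ((isGLB_essInfSet _).2 ?_) (robust_minRisk_le hX hK hα husc x)
  rintro _ ⟨Z, rfl⟩
  rw [← AEEqFun.coeFn_le]
  filter_upwards [le_minRisk α Z (toBar (Z.1 x)) x, coeFn_toBar (Z.1 x)] with ω hle htoBar
  exact hle htoBar.ge

end Representation

/-! ### Separation in the dual pair of `X* × L⁰` and `X × L⁰` -/

section DualPair

section SumNorm

variable {ι : Type*} [Fintype ι]

/-- The `ℓ¹` norm on `(L⁰)^ι × L⁰`, with values in `L⁰`. -/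
def sumNorm (v : (ι → L0 P) × L0 P) : L0 P := ∑ i, |v.1 i| + |v.2|

theorem abs_mul_le_mul_abs {l : L0 P} (hl : 0 ≤ l) (a : L0 P) : |l * a| ≤ l * |a| := by
  rw [← AEEqFun.coeFn_le]
  filter_upwards [AEEqFun.coeFn_abs a, AEEqFun.coeFn_abs (l * a), AEEqFun.coeFn_mul l a,
    AEEqFun.coeFn_mul l |a|, nonneg_iff_ae.1 hl] with ω habs habsmul hmul hmulabs hl
  rw [habsmul, hmulabs, hmul, Pi.mul_apply, Pi.mul_apply, habs, abs_mul, abs_of_nonneg hl]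

theorem sumNorm_isSublinear : IsSublinear (sumNorm (P := P) (ι := ι)) where
  add_le v w :=
    calc ∑ i, |v.1 i + w.1 i| + |v.2 + w.2|
        ≤ ∑ i, (|v.1 i| + |w.1 i|) + (|v.2| + |w.2|) :=
          add_le_add (Finset.sum_le_sum fun i _ => abs_add_le _ _) (abs_add_le _ _)
      _ = ∑ i, |v.1 i| + |v.2| + (∑ i, |w.1 i| + |w.2|) := by
          rw [Finset.sum_add_distrib, add_add_add_comm]
  smul_le l hl v :=
    calc ∑ i, |l * v.1 i| + |l * v.2|
        ≤ ∑ i, l * |v.1 i| + l * |v.2| :=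
          add_le_add (Finset.sum_le_sum fun i _ => abs_mul_le_mul_abs hl _)
            (abs_mul_le_mul_abs hl _)
      _ = l * (∑ i, |v.1 i| + |v.2|) := by rw [mul_add, Finset.mul_sum]

theorem sumNorm_nonneg (v : (ι → L0 P) × L0 P) : 0 ≤ sumNorm v :=
  add_nonneg (Finset.sum_nonneg fun _ _ => abs_nonneg _) (abs_nonneg _)

theorem abs_fst_le_sumNorm (v : (ι → L0 P) × L0 P) (i : ι) : |v.1 i| ≤ sumNorm v :=
  (Finset.single_le_sum (f := fun i => |v.1 i|) (fun _ _ => abs_nonneg _)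
    (Finset.mem_univ i)).trans (le_add_of_nonneg_right (abs_nonneg _))

theorem abs_snd_le_sumNorm (v : (ι → L0 P) × L0 P) : |v.2| ≤ sumNorm v :=
  le_add_of_nonneg_left (Finset.sum_nonneg fun _ _ => abs_nonneg _)

end SumNorm

theorem IsSublinear.comp_linearMap {E F : Type*} [AddCommGroup E] [Module (L0 P) E]
    [AddCommGroup F] [Module (L0 P) F] {q : F → L0 P} (hq : IsSublinear q) (f : E →ₗ[L0 P] F) :
    IsSublinear fun x => q (f x) where
  add_le x y := map_add f x y ▸ hq.add_le _ _
  smul_le l hl x := map_smul f l x ▸ hq.smul_le l hl _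

theorem L0Convex.image {E F : Type*} [AddCommGroup E] [Module (L0 P) E] [AddCommGroup F]
    [Module (L0 P) F] {C : Set E} (hC : L0Convex P C) (f : E →ₗ[L0 P] F) :
    L0Convex P (f '' C) := by
  rintro l hl0 hl1 _ ⟨x, hx, rfl⟩ _ ⟨y, hy, rfl⟩
  exact ⟨_, hC l hl0 hl1 x hx y hy, by rw [map_add, map_smul, map_smul]⟩

theorem exists_isPos_forall_le {ι : Type*} (F : Finset ι) {e : ι → L0 P}
    (he : ∀ i, IsPos (e i)) : ∃ d, IsPos d ∧ ∀ i ∈ F, d ≤ e i := by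
  induction F using Finset.cons_induction with
  | empty => exact ⟨1, isPos_one, by simp⟩
  | cons a F ha ih =>
    obtain ⟨d, hd, hde⟩ := ih
    refine ⟨e a ⊓ d, ?_, (Finset.forall_mem_cons ha _).2
      ⟨inf_le_left, fun i hi => inf_le_right.trans (hde i hi)⟩⟩
    filter_upwards [he a, hd, AEEqFun.coeFn_inf (e a) d] with ω ha hd hinf
    rw [hinf]
    exact lt_min ha hd

theorem IsPartition.exists_linearMap_ae_eq {E : Type*} [AddCommGroup E] [Module (L0 P) E]
    {A : ℕ → Set Ω} (hA : IsPartition A) (f : ℕ → E →ₗ[L0 P] L0 P) :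
    ∃ g : E →ₗ[L0 P] L0 P, ∀ n x, ∀ᵐ ω ∂P, ω ∈ A n → g x ω = f n x ω := by
  choose g hg using fun x => hA.exists_forall_ae_eq fun n => f n x
  refine ⟨{ toFun := g, map_add' := fun x y => ?_, map_smul' := fun l x => ?_ }, fun n x => hg x n⟩
  · refine AEEqFun.ext (hA.ae_of_forall fun n => ?_)
    have hadd := AEEqFun.coeFn_add (f n x) (f n y)
    rw [← map_add] at hadd
    filter_upwards [hg x n, hg y n, hg (x + y) n, AEEqFun.coeFn_add (g x) (g y), hadd]
      with ω hx hy hxy hg hf hω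
    rw [hxy hω, hg, hf, Pi.add_apply, Pi.add_apply, hx hω, hy hω]
  · refine AEEqFun.ext (hA.ae_of_forall fun n => ?_)
    have hmul := AEEqFun.coeFn_mul l (f n x)
    rw [← smul_eq_mul, ← map_smul] at hmul
    filter_upwards [hg x n, hg (l • x) n, AEEqFun.coeFn_mul l (g x), hmul] with ω hx hlx hg hf hω
    rw [hlx hω, RingHom.id_apply, smul_eq_mul, hg, hf, Pi.mul_apply, Pi.mul_apply, hx hω]

variable {X : Type*} [AddCommGroup X] [Module (L0 P) X] [TopologicalSpace X]

theorem IsConditionallyLocallyConvex.continuous_of_ae_eq [IsTopologicalAddGroup X]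
    (hX : IsConditionallyLocallyConvex P X) {A : ℕ → Set Ω} (hA : IsPartition A)
    (f : ℕ → X →L[L0 P] L0 P) {g : X →ₗ[L0 P] L0 P}
    (hg : ∀ n x, ∀ᵐ ω ∂P, ω ∈ A n → g x ω = f n x ω) : Continuous g := by
  refine continuous_of_continuousAt_zero g ?_
  rw [ContinuousAt, map_zero]
  intro V hV
  obtain ⟨e, he, heV⟩ := (mem_nhds_iff_ball _ _).1 hV
  have hU (n) : {x : X | f n x ∈ ball 0 e} ∈ 𝓝 (0 : X) :=
    (f n).continuous.continuousAt.preimage_mem_nhds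
      ((mem_nhds_iff_ball _ _).2 ⟨e, he, by rw [map_zero]⟩)
  rw [mem_map]
  filter_upwards [hX.nhds_concat A hA _ hU]
  rintro y ⟨x, hx, hy⟩
  refine heV (mem_ball_zero.2 (hA.ae_of_forall fun n => ?_))
  have hyx : ∀ᵐ ω ∂P, ω ∈ A n → f n y ω = f n (x n) ω := by
    refine (ind_mul_eq_ind_mul_iff (hA.measurable n)).1 ?_
    rw [← smul_eq_mul, ← smul_eq_mul, ← map_smul, ← map_smul, hy n]
  filter_upwards [hg n y, hyx, mem_ball_zero.1 (hx n)] with ω hg hyx hball hω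
  rwa [hg hω, hyx hω]

theorem IsConditionallyLocallyConvex.exists_concat_weakDual_prod [IsTopologicalAddGroup X]
    (hX : IsConditionallyLocallyConvex P X) (A : ℕ → Set Ω) (hA : IsPartition A)
    (q : ℕ → WeakDual (L0 P) X × L0 P) : ∃ r, IsConcat P hA q r := by
  obtain ⟨g, hg⟩ := hA.exists_linearMap_ae_eq fun n =>
    (((q n).1 : X →L[L0 P] L0 P) : X →ₗ[L0 P] L0 P)
  obtain ⟨t, ht⟩ := hA.exists_forall_ae_eq fun n => (q n).2
  exact ⟨((⟨g, hX.continuous_of_ae_eq hA (fun n => (q n).1) hg⟩ : X →L[L0 P] L0 P), t),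
    fun n => Prod.ext (ContinuousLinearMap.ext fun x =>
      (ind_mul_eq_ind_mul_iff (hA.measurable n)).2 (hg n x))
      ((ind_mul_eq_ind_mul_iff (hA.measurable n)).2 (ht n))⟩

/-- The functional on `X* × L⁰` given by the pairing with `(y, b) ∈ X × L⁰`. -/
def dualPairing (y : X) (b : L0 P) : (WeakDual (L0 P) X × L0 P) →ₗ[L0 P] L0 P where
  toFun q := q.1 y + b * q.2
  map_add' q r := by
    rw [Prod.fst_add, Prod.snd_add, mul_add, add_add_add_comm]
    rfl
  map_smul' l q := by
    rw [Prod.smul_fst, Prod.smul_snd, RingHom.id_apply, smul_add, smul_eq_mul, smul_eq_mul,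
      smul_eq_mul, mul_left_comm]
    rfl

theorem coeFn_dualPairing (y : X) (b : L0 P) (q : WeakDual (L0 P) X × L0 P) :
    ∀ᵐ ω ∂P, dualPairing y b q ω = q.1 y ω + b ω * q.2 ω := by
  filter_upwards [AEEqFun.coeFn_add (q.1 y) (b * q.2), AEEqFun.coeFn_mul b q.2] with ω hadd hmul
  exact hadd.trans (congrArg (_ + ·) hmul)

/-- The pairing of `(Z, s)` with the points of a finite set. -/
def evalPair (F : Finset X) : (WeakDual (L0 P) X × L0 P) →ₗ[L0 P] (F → L0 P) × L0 P where
  toFun q := (fun x => q.1 x.1, q.2)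
  map_add' _ _ := rfl
  map_smul' _ _ := rfl

theorem exists_linearMap_evalPair_eq (F : Finset X) (f : ((F → L0 P) × L0 P) →ₗ[L0 P] L0 P) :
    ∃ y b, ∀ q, f (evalPair F q) = dualPairing y b q := by
  classical
  refine ⟨∑ i : F, f (fun j => if i = j then 1 else 0, 0) • i.1, f (0, 1), fun q => ?_⟩
  have hsplit : evalPair F q = LinearMap.inl (L0 P) (F → L0 P) (L0 P) (fun x => q.1 x.1) +
      q.2 • ((0, 1) : (F → L0 P) × L0 P) := by
    refine Prod.ext (funext fun x => ?_) ?_ <;> simp <;> rfl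
  have hsum := LinearMap.pi_apply_eq_sum_univ (f ∘ₗ LinearMap.inl (L0 P) (F → L0 P) (L0 P))
    (fun x : F => q.1 x.1)
  rw [hsplit, map_add, map_smul, smul_eq_mul, mul_comm q.2, ← LinearMap.comp_apply, hsum]
  change _ = q.1 (∑ i : F, _) + _
  rw [map_sum]
  refine congrArg (· + _) (Finset.sum_congr rfl fun i _ => ?_)
  rw [map_smul, smul_eq_mul, smul_eq_mul, mul_comm, LinearMap.comp_apply, LinearMap.inl_apply]

theorem exists_sumNorm_evalPair_lt_subset {V : Set (WeakDual (L0 P) X × L0 P)}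
    (hV : V ∈ 𝓝 0) :
    ∃ (F : Finset X) (e : L0 P), IsPos e ∧
      ∀ q, (∀ᵐ ω ∂P, sumNorm (evalPair F q) ω < e ω) → q ∈ V := by
  obtain ⟨V₁, hV₁, V₂, hV₂, hsub⟩ := mem_nhds_prod_iff.1 hV
  obtain ⟨T, hT, hTV⟩ := mem_nhds_induced (fun (Z : WeakDual (L0 P) X) x => Z x) 0 V₁ |>.1 hV₁
  rw [nhds_pi, Filter.mem_pi] at hT
  obtain ⟨I, hI, W, hW, hIW⟩ := hT
  choose r hr hrW using fun x => (mem_nhds_iff_ball (0 : L0 P) _).1 (hW x)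
  obtain ⟨d, hd, hdr⟩ := exists_isPos_forall_le hI.toFinset hr
  obtain ⟨t, ht, htV⟩ := (mem_nhds_iff_ball (0 : L0 P) _).1 hV₂
  have hball {v : (hI.toFinset → L0 P) × L0 P} (hv : ∀ᵐ ω ∂P, sumNorm v ω < (d ⊓ t) ω)
      {a e : L0 P} (ha : |a| ≤ sumNorm v) (he : d ⊓ t ≤ e) : a ∈ ball 0 e := by
    refine mem_ball_zero.2 ?_
    filter_upwards [hv, AEEqFun.coeFn_le.2 ha, AEEqFun.coeFn_le.2 he, AEEqFun.coeFn_abs a]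
      with ω hv ha he habs
    exact habs ▸ ha.trans (hv.le.trans he)
  refine ⟨hI.toFinset, d ⊓ t, ?_, fun q hq => hsub ⟨hTV (hIW fun x hx => hrW x ?_), htV ?_⟩⟩
  · filter_upwards [hd, ht, AEEqFun.coeFn_inf d t] with ω hd ht hinf
    rw [hinf]
    exact lt_min hd ht
  · have hxF : x ∈ hI.toFinset := hI.mem_toFinset.2 hx
    exact hball hq (abs_fst_le_sumNorm (evalPair _ q) ⟨x, hxF⟩)
      (inf_le_left.trans (hdr x hxF))
  · exact hball hq (abs_snd_le_sumNorm (evalPair _ q)) inf_le_right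

theorem exists_dualPair_separating [IsFiniteMeasure P] [IsTopologicalAddGroup X]
    (hX : IsConditionallyLocallyConvex P X) {C : Set (WeakDual (L0 P) X × L0 P)}
    (hC : IsClosed C) (hconv : L0Convex P C) (hσ : SigmaStable P C) (hne : C.Nonempty)
    {A : Set Ω} (hA : MeasurableSet A) {q₀ : WeakDual (L0 P) X × L0 P}
    (hq₀ : ∀ q ∈ C, ind P hA • q ≠ ind P hA • q₀) :
    ∃ y b d, (∀ q ∈ C, dualPairing y b q₀ + d ≤ dualPairing y b q) ∧
      ∃ᵐ ω ∂P, ω ∈ A ∧ 0 < d ω := by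
  obtain ⟨_, ⟨F, rfl⟩, d, hd, hpos⟩ := exists_isSublinear_forall_le hX.exists_concat_weakDual_prod
    (Q := Set.range fun (F : Finset X) q => sumNorm (evalPair F q))
    (Set.forall_mem_range.2 fun F =>
      ⟨sumNorm_isSublinear.comp_linearMap (evalPair F), fun q => sumNorm_nonneg _⟩)
    (fun V hV => by
      obtain ⟨F, e, he, hFV⟩ := exists_sumNorm_evalPair_lt_subset hV
      exact ⟨_, ⟨F, rfl⟩, e, he, hFV⟩)
    hC hconv hσ hne hA hq₀
  obtain ⟨f, -, hf⟩ := sumNorm_isSublinear.exists_linearMap_separating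
    (hconv.image (evalPair F)) (hne.image _) (x := evalPair F q₀) (d := d)
    (Set.forall_mem_image.2 fun q hq => map_sub (evalPair F) q q₀ ▸ hd q hq)
  obtain ⟨y, b, hyb⟩ := exists_linearMap_evalPair_eq F f
  exact ⟨y, b, d, fun q hq => by simpa only [hyb] using hf _ ⟨q, hq, rfl⟩, hpos⟩

end DualPair

/-! ### Separation from the sublevel sets of a risk function -/

section Sublevel

theorem isClosed_nonneg : IsClosed {a : L0 P | 0 ≤ a} :=
  isClosed_of_closure_subset fun a ha => le_of_forall_isPos_le_add fun e he => by
    obtain ⟨b, hab, hb⟩ := mem_closure_iff_nhds.1 ha _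
      ((mem_nhds_iff_ball a _).2 ⟨e, he, subset_rfl⟩)
    rw [nonneg_iff_ae]
    filter_upwards [hab, nonneg_iff_ae.1 hb, AEEqFun.coeFn_add a e] with ω hab hb hadd
    rw [hadd, Pi.add_apply]
    linarith [neg_abs_le (a ω - b ω)]

section Cone

variable {E : Type*} [AddCommGroup E] [Module (L0 P) E] {C : Set E} {f : E →ₗ[L0 P] L0 P}
  {a : L0 P} {x : E}

theorem nonneg_of_forall_le_of_smul_mem (hC : ∀ l : L0 P, IsPos l → ∀ x ∈ C, l • x ∈ C)
    (ha : ∀ x ∈ C, a ≤ f x) (hx : x ∈ C) : 0 ≤ f x :=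
  nonneg_of_forall_isPos_le_mul fun l hl => (ha _ (hC l hl x hx)).trans_eq (map_smul f l x)

theorem nonpos_of_forall_le_of_smul_mem (hC : ∀ l : L0 P, IsPos l → ∀ x ∈ C, l • x ∈ C)
    (ha : ∀ x ∈ C, a ≤ f x) (hx : x ∈ C) : a ≤ 0 := by
  refine le_of_forall_isPos_le_add fun e he => ?_
  have hfx := nonneg_of_forall_le_of_smul_mem hC ha hx
  obtain ⟨k, hk, hinv, -⟩ := (isPos_one.add_of_nonneg hfx).exists_inv
  have hek : IsPos (e * k) := by
    filter_upwards [he, hk, AEEqFun.coeFn_mul e k] with ω he hk hmul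
    exact hmul ▸ mul_pos he hk
  calc a ≤ f ((e * k) • x) := ha _ (hC _ hek x hx)
    _ = e * k * f x := map_smul f _ x
    _ ≤ e * k * (f x + 1) := mul_le_mul_of_nonneg_left (le_add_of_nonneg_right zero_le_one) hek.le
    _ = 0 + e := by rw [mul_assoc, mul_comm k, hinv, mul_one, zero_add]

end Cone

variable {X : Type*} [AddCommGroup X] [Module (L0 P) X] [TopologicalSpace X] {K : Set X}

theorem zero_mem_polarCone : (0 : WeakDual (L0 P) X) ∈ polarCone K :=
  fun _ _ => le_refl (0 : L0 P)

theorem smul_mem_polarCone {l : L0 P} (hl : 0 ≤ l) {Z : WeakDual (L0 P) X}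
    (hZ : Z ∈ polarCone K) : l • Z ∈ polarCone K :=
  fun x hx => mul_nonneg hl (hZ x hx)

theorem polarCone_l0Convex : L0Convex P (polarCone (P := P) K) :=
  fun _ hl0 hl1 _ hZ _ hZ' x hx =>
    add_nonneg (mul_nonneg hl0 (hZ x hx)) (mul_nonneg (sub_nonneg.2 hl1) (hZ' x hx))

theorem polarCone_sigmaStable : SigmaStable P (polarCone (P := P) K) := by
  refine fun A hA Z hZ Z' hZ' x hx => nonneg_iff_ae.2 (hA.ae_of_forall fun n => ?_)
  filter_upwards [nonneg_iff_ae.1 (hZ n x hx), (ind_mul_eq_ind_mul_iff (hA.measurable n)).1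
    (congrArg (fun Z : WeakDual (L0 P) X => Z x) (hZ' n))] with ω hZ hZ' hω
  exact hZ.trans_eq (hZ' hω).symm

theorem isClosed_polarCone : IsClosed (polarCone (P := P) K) := by
  have hinter : polarCone (P := P) K = ⋂ x ∈ K, {Z | 0 ≤ Z x} := by
    ext Z
    simp [polarCone]
  rw [hinter]
  exact isClosed_biInter fun x _ => isClosed_nonneg.preimage (WeakDual.eval_continuous x)

variable {R : polarCone (P := P) K → Lbar P → Lbar P}

/-- The set of all `(Z, s)` with `R⁻(Z, s) ≤ m`, as a subset of `X* × L⁰`. -/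
def sublevelPairs (R : polarCone (P := P) K → Lbar P → Lbar P) (m : Lbar P) :
    Set (WeakDual (L0 P) X × L0 P) :=
  Prod.map Subtype.val id '' {p : polarCone (P := P) K × L0 P |
    leftVersion (R p.1) (toBar p.2) ≤ m}

theorem mem_sublevelPairs {m : Lbar P} (Z : polarCone (P := P) K) {s : L0 P}
    (h : ∀ᵐ ω ∂P, leftVersion (R Z) (toBar s) ω ≤ m ω) : (Z.1, s) ∈ sublevelPairs R m :=
  ⟨(Z, s), AEEqFun.coeFn_le.1 h, rfl⟩

theorem forall_mem_sublevelPairs {m : Lbar P} {p : WeakDual (L0 P) X × L0 P → Prop} :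
    (∀ q ∈ sublevelPairs R m, p q) ↔ ∀ (Z : polarCone (P := P) K) (s : L0 P),
      (∀ᵐ ω ∂P, leftVersion (R Z) (toBar s) ω ≤ m ω) → p (Z.1, s) := by
  rw [sublevelPairs, Set.forall_mem_image, Prod.forall]
  exact forall₂_congr fun Z s => imp_congr_left AEEqFun.coeFn_le.symm

theorem IsMinimalRiskFunction.isClosed_sublevelPairs (hR : IsMinimalRiskFunction R) (m : Lbar P) :
    IsClosed (sublevelPairs R m) :=
  (isClosed_polarCone.isClosedEmbedding_subtypeVal.prodMap .id).isClosedMap _ (hR.lsc m)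

namespace IsRiskFunction

theorem eq_on (hR : IsRiskFunction R) {A : Set Ω} (hA : MeasurableSet A)
    {Z Z' : polarCone (P := P) K} (hZ : ∀ x, ∀ᵐ ω ∂P, ω ∈ A → Z.1 x ω = Z'.1 x ω) (s : Lbar P) :
    ∀ᵐ ω ∂P, ω ∈ A → R Z s ω = R Z' s ω := by
  have hglue : Z.1 = ind P hA • Z'.1 + ind P hA.compl • Z.1 :=
    ContinuousLinearMap.ext fun x => AEEqFun.ext <| by
      filter_upwards [hZ x, coeFn_ind_mul_add hA (Z'.1 x) (Z.1 x)] with ω hZ hite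
      refine Eq.trans ?_ hite.symm
      split_ifs with hω
      exacts [hZ hω, rfl]
  have hs : glue hA s s = s := AEEqFun.ext <| by
    filter_upwards [coeFn_glue hA s s] with ω hite
    rw [hite, ite_self]
  have hlocal := hR.isLocal A hA Z' Z Z hglue s s
  rw [hs] at hlocal
  filter_upwards [coeFn_glue hA (R Z' s) (R Z s)] with ω hite hω
  rw [← hlocal] at hite
  exact hite.trans (if_pos hω)

variable [IsFiniteMeasure P]

theorem leftVersion_le_on (hR : IsRiskFunction R) {A : Set Ω} (hA : MeasurableSet A)
    {Z Z' : polarCone (P := P) K} (hZ : ∀ x, ∀ᵐ ω ∂P, ω ∈ A → Z.1 x ω = Z'.1 x ω)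
    {s t : L0 P} (hst : ∀ᵐ ω ∂P, ω ∈ A → s ω ≤ t ω) :
    ∀ᵐ ω ∂P, ω ∈ A → leftVersion (R Z) (toBar s) ω ≤ leftVersion (R Z') (toBar t) ω := by
  filter_upwards [(hR.localMono Z).lt_leftVersion_iff (toBar s),
    (hR.localMono Z').lt_leftVersion_iff (toBar t), coeFn_toBar s, coeFn_toBar t, hst,
    ae_all_iff.2 fun q : ℚ => hR.eq_on hA hZ (constBar P q)] with ω hs ht hsbar htbar hst heq hω
  refine le_of_forall_lt fun c hc => (ht c).2 ?_
  obtain ⟨q, hqs, hcq⟩ := (hs c).1 hc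
  refine ⟨q, hqs.trans_le ?_, heq q hω ▸ hcq⟩
  rw [hsbar, htbar]
  exact EReal.coe_le_coe_iff.2 (hst hω)

theorem sublevelPairs_sigmaStable (hR : IsRiskFunction R) (m : Lbar P) :
    SigmaStable P (sublevelPairs R m) := by
  intro A hA q hq r hr
  choose p hp hpq using hq
  obtain rfl : (fun n => Prod.map Subtype.val id (p n)) = q := funext hpq
  have hr₁ : r.1 ∈ polarCone K :=
    polarCone_sigmaStable A hA _ (fun n => (p n).1.2) r.1 fun n => congrArg Prod.fst (hr n)
  refine mem_sublevelPairs ⟨r.1, hr₁⟩ (hA.ae_of_forall fun n => ?_)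
  filter_upwards [AEEqFun.coeFn_le.2 (hp n), hR.leftVersion_le_on (hA.measurable n)
    (Z := ⟨r.1, hr₁⟩) (Z' := (p n).1) (s := r.2) (t := (p n).2)
    (fun x => (ind_mul_eq_ind_mul_iff (hA.measurable n)).1
      (congrArg (fun q : WeakDual (L0 P) X × L0 P => q.1 x) (hr n)))
    (((ind_mul_eq_ind_mul_iff (hA.measurable n)).1 (congrArg Prod.snd (hr n))).mono
      fun ω h hω => (h hω).le)] with ω hp hle hω
  exact (hle hω).trans hp

theorem nonneg_of_leftVersion_le (hR : IsRiskFunction R) {m : Lbar P}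
    (hne : (sublevelPairs R m).Nonempty) {f : (WeakDual (L0 P) X × L0 P) →ₗ[L0 P] L0 P}
    (hf : ∀ q ∈ sublevelPairs R m, 0 ≤ f q) (Z : polarCone (P := P) K) (s : L0 P) :
    ∀ᵐ ω ∂P, leftVersion (R Z) (toBar s) ω ≤ m ω → 0 ≤ f (Z.1, s) ω := by
  obtain ⟨_, ⟨Z₁, s₁⟩, h₁, rfl⟩ := hne
  have hB : MeasurableSet {ω | leftVersion (R Z) (toBar s) ω ≤ m ω} :=
    measurableSet_le (AEEqFun.measurable _) (AEEqFun.measurable _)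
  set B := {ω | leftVersion (R Z) (toBar s) ω ≤ m ω}
  let Z₂ : polarCone (P := P) K := ⟨_, polarCone_l0Convex.glue_mem hB Z.2 Z₁.2⟩
  let s₂ := ind P hB * s + ind P hB.compl * s₁
  have hZ₂ (x) : ∀ᵐ ω ∂P, Z₂.1 x ω = _ := coeFn_ind_mul_add hB (Z.1 x) (Z₁.1 x)
  have hs₂ := coeFn_ind_mul_add hB s s₁
  have hmem : (Z₂.1, s₂) ∈ sublevelPairs R m := by
    refine mem_sublevelPairs Z₂ ?_
    filter_upwards [AEEqFun.coeFn_le.2 h₁,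
      hR.leftVersion_le_on hB (Z := Z₂) (s := s₂)
        (fun x => (hZ₂ x).mono fun ω h hω => h.trans (if_pos hω))
        (hs₂.mono fun ω h hω => (h.trans (if_pos hω)).le),
      hR.leftVersion_le_on hB.compl (Z := Z₂) (s := s₂)
        (fun x => (hZ₂ x).mono fun ω h hω => h.trans (if_neg hω))
        (hs₂.mono fun ω h hω => (h.trans (if_neg hω)).le)] with ω h₁ hmem hnotMem
    by_cases hω : ω ∈ B
    exacts [(hmem hω).trans hω, (hnotMem hω).trans h₁]
  filter_upwards [nonneg_iff_ae.1 (hf _ hmem), coeFn_map_glue f hB (Z.1, s) (Z₁.1, s₁)]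
    with ω hnonneg hite hω
  exact hnonneg.trans_eq (hite.trans (if_pos hω))

end IsRiskFunction

theorem combBar_toBar (l s t : L0 P) :
    combBar l (toBar s) (1 - l) (toBar t) = toBar (l * s + (1 - l) * t) := by
  refine AEEqFun.ext ?_
  filter_upwards [coeFn_combBar l (toBar s) (1 - l) (toBar t), coeFn_toBar s, coeFn_toBar t,
    coeFn_toBar (l * s + (1 - l) * t), coeFn_convexComb l s t, AEEqFun.coeFn_sub 1 l,
    AEEqFun.coeFn_one (μ := P) (β := ℝ)] with ω hcomb hs ht hbar hconvex hsub h1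
  rw [hcomb, hs, ht, hbar, hconvex, hsub, Pi.sub_apply, h1, Pi.one_apply]
  norm_cast

theorem coeFn_toBar_sub_const (a : L0 P) (c : ℝ) :
    ∀ᵐ ω ∂P, toBar (a - AEEqFun.const Ω c) ω = ((a ω - c : ℝ) : EReal) := by
  filter_upwards [coeFn_toBar (a - AEEqFun.const Ω c), AEEqFun.coeFn_sub a (AEEqFun.const Ω c),
    AEEqFun.coeFn_const (μ := P) Ω c] with ω hbar hsub hconst
  rw [hbar, hsub, Pi.sub_apply, hconst, Function.const_apply]

namespace IsMinimalRiskFunction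

variable [IsFiniteMeasure P]

theorem leftVersion_smul_le (hR : IsMinimalRiskFunction R) {l : L0 P} (hl : IsPos l)
    {Z Z' : polarCone (P := P) K} (hZ : Z'.1 = l • Z.1) (s : L0 P) :
    ∀ᵐ ω ∂P, leftVersion (R Z') (toBar (l * s)) ω ≤ leftVersion (R Z) (toBar s) ω := by
  filter_upwards [(hR.localMono Z').lt_leftVersion_iff (toBar (l * s)), hl,
    coeFn_toBar (l * s), coeFn_toBar s, AEEqFun.coeFn_mul l s,
    ae_all_iff.2 fun q : ℚ => coeFn_divBar (constBar P q) l,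
    ae_all_iff.2 fun q : ℚ => coeFn_constBar (P := P) q,
    ae_all_iff.2 fun q : ℚ => (hR.localMono Z).le_leftVersion (toBar s) (divBar (constBar P q) l)]
    with ω hlt hl hlsbar hsbar hmul hdiv hconst hleft
  refine le_of_forall_lt fun c hc => ?_
  obtain ⟨q, hqs, hcq⟩ := (hlt c).1 hc
  rw [hR.scaling l ‹IsPos l› Z Z' hZ] at hcq
  refine hcq.trans_le (hleft q ?_)
  rw [hlsbar, hmul, Pi.mul_apply, EReal.coe_lt_coe_iff] at hqs
  rw [hdiv, hconst, hsbar, ← EReal.coe_mul, EReal.coe_lt_coe_iff, ← div_eq_mul_inv,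
    div_lt_iff₀' hl]
  exact hqs

theorem leftVersion_comb_le (hR : IsMinimalRiskFunction R) {l : L0 P} (hl0 : 0 ≤ l) (hl1 : l ≤ 1)
    {Z₁ Z₂ Z : polarCone (P := P) K} (hZ : Z.1 = l • Z₁.1 + (1 - l) • Z₂.1) (s t : L0 P) :
    ∀ᵐ ω ∂P, leftVersion (R Z) (toBar (l * s + (1 - l) * t)) ω ≤
      leftVersion (R Z₁) (toBar s) ω ⊔ leftVersion (R Z₂) (toBar t) ω := by
  have hshift (c : L0 P) : R Z (toBar (l * s + (1 - l) * t - c)) ≤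
      R Z₁ (toBar (s - c)) ⊔ R Z₂ (toBar (t - c)) := by
    have hc : l * (s - c) + (1 - l) * (t - c) = l * s + (1 - l) * t - c := by ring
    rw [← hc, ← combBar_toBar]
    exact hR.quasiconvex l hl0 hl1 Z₁ Z₂ Z hZ _ _
  set u := l * s + (1 - l) * t
  let shift (a : L0 P) (c : ℚ) : Lbar P := toBar (a - AEEqFun.const Ω (c : ℝ))
  filter_upwards [(hR.localMono Z).lt_leftVersion_iff (toBar u), coeFn_toBar u, coeFn_toBar s,
    coeFn_toBar t, ae_all_iff.2 fun c : ℚ => coeFn_toBar_sub_const u c,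
    ae_all_iff.2 fun c : ℚ => coeFn_toBar_sub_const s c,
    ae_all_iff.2 fun c : ℚ => coeFn_toBar_sub_const t c,
    ae_all_iff.2 fun q : ℚ => coeFn_constBar (P := P) q,
    ae_all_iff.2 fun c : ℚ => ae_all_iff.2 fun q : ℚ => hR.localMono Z (constBar P q) (shift u c),
    ae_all_iff.2 fun c : ℚ => AEEqFun.coeFn_le.2 (hshift (AEEqFun.const Ω (c : ℝ))),
    ae_all_iff.2 fun c : ℚ => AEEqFun.coeFn_sup (R Z₁ (shift s c)) (R Z₂ (shift t c)),
    ae_all_iff.2 fun c : ℚ => (hR.localMono Z₁).le_leftVersion (toBar s) (shift s c),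
    ae_all_iff.2 fun c : ℚ => (hR.localMono Z₂).le_leftVersion (toBar t) (shift t c)]
    with ω hlt hu hs ht huc hsc htc hconst hmono hshift hsup hleft₁ hleft₂
  refine le_of_forall_lt fun b hb => ?_
  obtain ⟨q, hqu, hbq⟩ := (hlt b).1 hb
  rw [hu, EReal.coe_lt_coe_iff] at hqu
  obtain ⟨c, hc0, hcq⟩ := exists_rat_btwn (sub_pos.2 hqu)
  have hqc : R Z (constBar P q) ω ≤ R Z (shift u c) ω := hmono c q <| by
    rw [hconst, huc, EReal.coe_le_coe_iff]
    linarith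
  refine (hbq.trans_le (hqc.trans ((hshift c).trans_eq (hsup c)))).trans_le
    (sup_le_sup (hleft₁ c ?_) (hleft₂ c ?_))
  · rw [hsc, hs, EReal.coe_lt_coe_iff]
    linarith
  · rw [htc, ht, EReal.coe_lt_coe_iff]
    linarith

theorem leftVersion_le_zero_one (hR : IsMinimalRiskFunction R) {Z₀ : polarCone (P := P) K}
    (hZ₀ : Z₀.1 = 0) (Z : polarCone (P := P) K) (s : L0 P) :
    leftVersion (R Z) (toBar s) ≤ leftVersion (R Z₀) (toBar 1) := by
  have hsup : R Z (toBar s) ≤ essSupSet (Set.range fun s : L0 P => R Z (toBar s)) :=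
    (isLUB_essSupSet _).1 ⟨s, rfl⟩
  refine (((hR.localMono Z).leftVersion_le_self _).trans hsup).trans ?_
  rw [hR.asymptoticMax Z Z₀]
  refine (isLUB_essSupSet _).2 (Set.forall_mem_range.2 fun t => ?_)
  have hpos : IsPos (|t| + 1) := isPos_one.add_of_nonneg (abs_nonneg t)
  rw [← AEEqFun.coeFn_le]
  filter_upwards [hR.leftVersion_smul_le hpos (Z := Z₀) (Z' := Z₀) (by rw [hZ₀, smul_zero]) 1,
    (hR.localMono Z₀).le_leftVersion (toBar ((|t| + 1) * 1)) (toBar t),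
    coeFn_toBar ((|t| + 1) * 1), coeFn_toBar t, AEEqFun.coeFn_mul (|t| + 1) 1,
    AEEqFun.coeFn_add |t| 1, AEEqFun.coeFn_abs t, AEEqFun.coeFn_one (μ := P) (β := ℝ)]
    with ω hsmul hleft hbar htbar hmul hadd habs h1
  refine (hleft ?_).trans hsmul
  rw [hbar, htbar, hmul, Pi.mul_apply, hadd, Pi.add_apply, habs, h1, Pi.one_apply, mul_one,
    EReal.coe_lt_coe_iff]
  linarith [le_abs_self (t ω)]

theorem sublevelPairs_l0Convex (hR : IsMinimalRiskFunction R) (m : Lbar P) :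
    L0Convex P (sublevelPairs R m) := by
  refine fun l hl0 hl1 => forall_mem_sublevelPairs.2 fun Z s hZ =>
    forall_mem_sublevelPairs.2 fun Z' s' hZ' =>
      mem_sublevelPairs ⟨_, polarCone_l0Convex l hl0 hl1 _ Z.2 _ Z'.2⟩ ?_
  filter_upwards [hZ, hZ', hR.leftVersion_comb_le hl0 hl1
    (Z := ⟨_, polarCone_l0Convex l hl0 hl1 _ Z.2 _ Z'.2⟩) rfl s s'] with ω hZ hZ' hle
  exact hle.trans (sup_le hZ hZ')

theorem smul_mem_sublevelPairs (hR : IsMinimalRiskFunction R) {m : Lbar P} (l : L0 P)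
    (hl : IsPos l) : ∀ q ∈ sublevelPairs R m, l • q ∈ sublevelPairs R m :=
  forall_mem_sublevelPairs.2 fun Z s hZ =>
    mem_sublevelPairs ⟨_, smul_mem_polarCone hl.le Z.2⟩ <| by
      filter_upwards [hZ, hR.leftVersion_smul_le hl (Z' := ⟨_, smul_mem_polarCone hl.le Z.2⟩) rfl s]
        with ω hZ hle
      exact hle.trans hZ

end IsMinimalRiskFunction

theorem snd_nonpos_of_forall_nonneg [IsFiniteMeasure P] (hR : IsRiskFunction R) {m : Lbar P}
    (hne : (sublevelPairs R m).Nonempty) {y : X} {b : L0 P}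
    (h : ∀ q ∈ sublevelPairs R m, 0 ≤ dualPairing y b q) : b ≤ 0 := by
  obtain ⟨_, ⟨Z, s⟩, hZ, rfl⟩ := hne
  refine neg_nonneg.1 (nonneg_of_forall_isPos_le_mul (a := -(Z.1 y + b * s)) fun t ht => ?_)
  have hle : s - t ≤ s := sub_le_self s ht.le
  have hmem : (Z.1, s - t) ∈ sublevelPairs R m := mem_sublevelPairs Z <| by
    filter_upwards [AEEqFun.coeFn_le.2 hZ, hR.leftVersion_le_on .univ (Z := Z) (Z' := Z)
      (s := s - t) (t := s) (fun _ => .of_forall fun _ _ => rfl)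
      ((AEEqFun.coeFn_le.2 hle).mono fun ω h _ => h)] with ω hZ hle
    exact (hle (Set.mem_univ ω)).trans hZ
  have hnonneg : 0 ≤ Z.1 y + b * (s - t) := h _ hmem
  have hsplit : t * -b + (Z.1 y + b * s) = Z.1 y + b * (s - t) := by ring
  rwa [neg_le_iff_add_nonneg, hsplit]

theorem IsMinimalRiskFunction.exists_dualPairing_separating [IsFiniteMeasure P]
    [IsTopologicalAddGroup X] (hX : IsConditionallyLocallyConvex P X)
    (hR : IsMinimalRiskFunction R) {A : Set Ω} (hA : MeasurableSet A) (hpos : ∃ᵐ ω ∂P, ω ∈ A)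
    {m : Lbar P} {Z₀ Z₁ : polarCone (P := P) K} {s₀ s₁ : L0 P}
    (h₀ : ∀ᵐ ω ∂P, ω ∈ A → m ω < leftVersion (R Z₀) (toBar s₀) ω)
    (h₁ : ∀ᵐ ω ∂P, ω ∈ A → leftVersion (R Z₁) (toBar s₁) ω ≤ m ω) :
    ∃ y b, b ≤ 0 ∧ (∃ᵐ ω ∂P, ω ∈ A ∧ dualPairing y b (Z₀.1, s₀) ω < 0) ∧
      ∀ (Z : polarCone (P := P) K) s, ∀ᵐ ω ∂P, ω ∈ A →
        leftVersion (R Z) (toBar s) ω ≤ m ω → 0 ≤ dualPairing y b (Z.1, s) ω := by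
  obtain ⟨m', hm'⟩ := exists_coeFn_eq_ite hA m (AEEqFun.const Ω ⊤)
  have hmem₁ : (Z₁.1, s₁) ∈ sublevelPairs R m' := mem_sublevelPairs Z₁ <| by
    filter_upwards [hm', h₁, AEEqFun.coeFn_const (μ := P) Ω (⊤ : EReal)] with ω hm' h₁ htop
    rw [hm', htop]
    split_ifs with hω
    exacts [h₁ hω, le_top]
  have hq₀ : ∀ q ∈ sublevelPairs R m', ind P hA • q ≠ ind P hA • (Z₀.1, s₀) := by
    refine forall_mem_sublevelPairs.2 fun Z s hZ heq => hpos ?_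
    filter_upwards [hZ, hm', h₀, hR.leftVersion_le_on hA (Z := Z₀) (Z' := Z) (s := s₀) (t := s)
      (fun x => (ind_mul_eq_ind_mul_iff hA).1
        (congrArg (fun q : WeakDual (L0 P) X × L0 P => q.1 x) heq.symm))
      (((ind_mul_eq_ind_mul_iff hA).1 (congrArg Prod.snd heq.symm)).mono fun ω h hω => (h hω).le)]
      with ω hZ hm' h₀ hle hω
    rw [hm', if_pos hω] at hZ
    exact (h₀ hω).not_ge ((hle hω).trans hZ)
  obtain ⟨y, b, d, hsep, hd⟩ := exists_dualPair_separating hX (hR.isClosed_sublevelPairs m')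
    (hR.sublevelPairs_l0Convex m') (hR.sublevelPairs_sigmaStable m') ⟨_, hmem₁⟩ hA hq₀
  have hnonneg (q) (hq : q ∈ sublevelPairs R m') : 0 ≤ dualPairing y b q :=
    nonneg_of_forall_le_of_smul_mem hR.smul_mem_sublevelPairs hsep hq
  have hnonpos := nonpos_of_forall_le_of_smul_mem hR.smul_mem_sublevelPairs hsep hmem₁
  refine ⟨y, b, snd_nonpos_of_forall_nonneg hR.toIsRiskFunction ⟨_, hmem₁⟩ hnonneg,
    hd.mp ?_, fun Z s => ?_⟩
  · filter_upwards [AEEqFun.coeFn_le.2 hnonpos, AEEqFun.coeFn_add (dualPairing y b (Z₀.1, s₀)) d,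
      AEEqFun.coeFn_zero (μ := P) (β := ℝ)] with ω hle hadd h0 ⟨hω, hd⟩
    rw [hadd, h0, Pi.add_apply, Pi.zero_apply] at hle
    exact ⟨hω, by linarith⟩
  · filter_upwards [hR.nonneg_of_leftVersion_le ⟨_, hmem₁⟩ hnonneg Z s, hm'] with ω hZ hm' hω
    rwa [hm', if_pos hω] at hZ

end Sublevel

/-! ### Uniqueness of the minimal risk function -/

section Uniqueness

variable {X : Type*} [AddCommGroup X] [Module (L0 P) X] [TopologicalSpace X] {K : Set X}
  {α : X → Lbar P} {R : polarCone (P := P) K → Lbar P → Lbar P} {m : Lbar P} {A B : Set Ω} {y : X}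
  {b : L0 P}

/-- For every `(Z, s)`, the pairing with `(y, b)` is nonnegative on the part of `B` where
`R⁻(Z, s) ≤ m`. -/
def NonnegOnSublevel (R : polarCone (P := P) K → Lbar P → Lbar P) (m : Lbar P) (B : Set Ω)
    (y : X) (b : L0 P) : Prop :=
  ∀ (Z : polarCone (P := P) K) (s : L0 P), ∀ᵐ ω ∂P, ω ∈ B →
    leftVersion (R Z) (toBar s) ω ≤ m ω → 0 ≤ dualPairing y b (Z.1, s) ω

theorem NonnegOnSublevel.mono (h : NonnegOnSublevel R m A y b) (hBA : B ⊆ A) :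
    NonnegOnSublevel R m B y b :=
  fun Z s => (h Z s).mono fun _ h hω => h (hBA hω)

theorem coeFn_dualPairing_add_smul (y y' : X) (b b' e : L0 P) (q : WeakDual (L0 P) X × L0 P) :
    ∀ᵐ ω ∂P, dualPairing (y + e • y') (b + e * b') q ω =
      dualPairing y b q ω + e ω * dualPairing y' b' q ω := by
  have heq : dualPairing (y + e • y') (b + e * b') q =
      dualPairing y b q + e * dualPairing y' b' q := by
    change q.1 (y + e • y') + _ = (q.1 y + _) + e * (q.1 y' + _)
    rw [map_add, map_smul, smul_eq_mul]
    ring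
  filter_upwards [AEEqFun.coeFn_add (dualPairing y b q) (e * dualPairing y' b' q),
    AEEqFun.coeFn_mul e (dualPairing y' b' q)] with ω hadd hmul
  rw [heq, hadd, Pi.add_apply, hmul, Pi.mul_apply]

theorem NonnegOnSublevel.add_smul {y' : X} {b' e : L0 P} (h : NonnegOnSublevel R m B y b)
    (h' : NonnegOnSublevel R m B y' b') (he : 0 ≤ e) :
    NonnegOnSublevel R m B (y + e • y') (b + e * b') := fun Z s => by
  filter_upwards [h Z s, h' Z s, nonneg_iff_ae.1 he,
    coeFn_dualPairing_add_smul y y' b b' e (Z.1, s)] with ω h h' he hadd hω hle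
  exact hadd ▸ add_nonneg (h hω hle) (mul_nonneg he (h' hω hle))

theorem exists_dualPairing_neg_iff (y : X) (b : L0 P) :
    ∃ x : X, ∀ (Z : WeakDual (L0 P) X) (s : L0 P),
      ∀ᵐ ω ∂P, b ω < 0 → (Z x ω < s ω ↔ dualPairing y b (Z, s) ω < 0) := by
  obtain ⟨k, hk⟩ := exists_coeFn_eq_inv (-b)
  refine ⟨k • y, fun Z s => ?_⟩
  rw [map_smul, smul_eq_mul]
  filter_upwards [hk, AEEqFun.coeFn_neg b, AEEqFun.coeFn_mul k (Z y), coeFn_dualPairing y b (Z, s)]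
    with ω hk hneg hmul hpair hb
  rw [hmul, Pi.mul_apply, hk, hneg, Pi.neg_apply, hpair, inv_mul_lt_iff₀ (neg_pos.2 hb)]
  constructor <;> intro h <;> linarith

theorem exists_nonneg_add_mul_neg (v w : L0 P) :
    ∃ e : L0 P, 0 ≤ e ∧ ∀ᵐ ω ∂P, w ω < 0 → 0 < e ω ∧ w ω + e ω * v ω < 0 := by
  obtain ⟨k, hk0, -, hk⟩ := (isPos_one.add_of_nonneg (abs_nonneg v)).exists_inv
  refine ⟨|w| * k, mul_nonneg (abs_nonneg w) hk0.le, ?_⟩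
  filter_upwards [hk0, hk, AEEqFun.coeFn_mul (|w|) k, AEEqFun.coeFn_abs w, AEEqFun.coeFn_abs v,
    AEEqFun.coeFn_add (|v|) 1, AEEqFun.coeFn_one (μ := P) (β := ℝ)]
    with ω hk0 hk hmul hw hv hadd h1 hneg
  rw [hmul, Pi.mul_apply, hw, abs_of_neg hneg]
  have hkv : k ω * v ω < 1 := by
    rw [hk, hadd, Pi.add_apply, hv, h1, Pi.one_apply, inv_mul_lt_iff₀ (by positivity)]
    linarith [le_abs_self (v ω)]
  exact ⟨mul_pos (neg_pos.2 hneg) hk0, by nlinarith⟩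

theorem exists_map_lt (Z : WeakDual (L0 P) X) (x₀ : X) (s : L0 P) :
    ∃ x, ∀ᵐ ω ∂P, (Z x₀ ω ≠ 0 ∨ 0 < s ω) → Z x ω < s ω := by
  obtain ⟨k, hk⟩ := exists_coeFn_eq_inv (Z x₀)
  refine ⟨(-(|s| + 1) * k) • x₀, ?_⟩
  rw [map_smul, smul_eq_mul]
  filter_upwards [hk, AEEqFun.coeFn_mul (-(|s| + 1) * k) (Z x₀), AEEqFun.coeFn_mul (-(|s| + 1)) k,
    AEEqFun.coeFn_neg (|s| + 1), AEEqFun.coeFn_add (|s|) 1, AEEqFun.coeFn_abs s,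
    AEEqFun.coeFn_one (μ := P) (β := ℝ)] with ω hk hmul hmul' hneg hadd habs h1 hω
  rw [hmul, Pi.mul_apply, hmul', Pi.mul_apply, hneg, Pi.neg_apply, hadd, Pi.add_apply, habs, h1,
    Pi.one_apply, hk, mul_assoc]
  rcases eq_or_ne (Z x₀ ω) 0 with hz | hz
  · rw [hz, mul_zero, mul_zero]
    exact hω.resolve_left (not_not.2 hz)
  · rw [inv_mul_cancel₀ hz]
    linarith [neg_abs_le (s ω)]

variable [IsFiniteMeasure P]

theorem IsRiskFunction.levelSup_le_of_robust (hR : IsRiskFunction R)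
    (hα : ∀ x, α x = robust R x) (Z : polarCone (P := P) K) (s : Lbar P) :
    levelSup α Z.1 s ≤ R Z s := by
  refine levelSup_le fun x => ?_
  have hle : robust R x ≤ R Z (toBar (Z.1 x)) := (isGLB_essInfSet _).1 ⟨Z, rfl⟩
  filter_upwards [AEEqFun.coeFn_le.2 hle, hR.localMono Z (toBar (Z.1 x)) s, coeFn_toBar (Z.1 x)]
    with ω hle hmono hbar hω
  rw [hα]
  exact hle.trans (hmono (hbar.trans_le hω.le))

theorem IsRiskFunction.le_robust_of_forall_le (hR : IsRiskFunction R) (hB : MeasurableSet B) {x : X}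
    (h : ∀ (Z : polarCone (P := P) K) (s : L0 P), ∀ᵐ ω ∂P, ω ∈ B →
      leftVersion (R Z) (toBar s) ω ≤ m ω → s ω ≤ Z.1 x ω) :
    ∀ᵐ ω ∂P, ω ∈ B → m ω ≤ robust R x ω := by
  refine ae_le_on_of_isGLB (isGLB_essInfSet _) hB ?_
  rintro _ ⟨Z, rfl⟩
  have hlt := (hR.localMono Z).rightVersion_lt_iff (toBar (Z.1 x))
  rw [← hR.rightContinuous Z] at hlt
  filter_upwards [hlt, coeFn_toBar (Z.1 x), ae_all_iff.2 fun q : ℚ => h Z (AEEqFun.const Ω q),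
    ae_all_iff.2 fun q : ℚ => AEEqFun.coeFn_const (μ := P) Ω (q : ℝ),
    ae_all_iff.2 fun q : ℚ => AEEqFun.coeFn_le.2
      ((hR.localMono Z).leftVersion_le_self (constBar P q))]
    with ω hlt hbar h hconst hleft hω
  refine le_of_not_gt fun hRm => ?_
  obtain ⟨q, hq, hqm⟩ := (hlt _).1 hRm
  rw [hbar, EReal.coe_lt_coe_iff] at hq
  refine hq.not_ge ((hconst q).symm.trans_le (h q hω ?_))
  exact (hleft q).trans hqm.le

theorem NonnegOnSublevel.exists_le_robust (hR : IsRiskFunction R)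
    (h : NonnegOnSublevel R m B y b) (hB : MeasurableSet B) (hb : ∀ᵐ ω ∂P, ω ∈ B → b ω < 0) :
    ∃ x, (∀ᵐ ω ∂P, ω ∈ B → m ω ≤ robust R x ω) ∧ ∀ (Z : WeakDual (L0 P) X) (s : L0 P),
      ∀ᵐ ω ∂P, ω ∈ B → (Z x ω < s ω ↔ dualPairing y b (Z, s) ω < 0) := by
  obtain ⟨x, hx⟩ := exists_dualPairing_neg_iff y b
  have hiff (Z : WeakDual (L0 P) X) (s : L0 P) :
      ∀ᵐ ω ∂P, ω ∈ B → (Z x ω < s ω ↔ dualPairing y b (Z, s) ω < 0) := by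
    filter_upwards [hx Z s, hb] with ω hx hb hω using hx (hb hω)
  refine ⟨x, hR.le_robust_of_forall_le hB fun Z s => ?_, hiff⟩
  filter_upwards [hiff Z.1 s, h Z s] with ω hiff h hω hle
  exact le_of_not_gt fun hlt => ((hiff hω).1 hlt).not_ge (h hω hle)

namespace IsMinimalRiskFunction

variable [IsTopologicalAddGroup X]

/-- The pairing separating `(Z₀, s₀)` may have `b = 0`; adding a small multiple of the one
separating `(0, 1)`, for which `b < 0`, makes it strictly decreasing in the second variable. -/
theorem exists_nonnegOnSublevel (hX : IsConditionallyLocallyConvex P X)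
    (hR : IsMinimalRiskFunction R) (hA : MeasurableSet A) (hpos : ∃ᵐ ω ∂P, ω ∈ A)
    {Z₀ Z₁ : polarCone (P := P) K} {s₀ s₁ : L0 P}
    (h₀ : ∀ᵐ ω ∂P, ω ∈ A → m ω < leftVersion (R Z₀) (toBar s₀) ω)
    (h₁ : ∀ᵐ ω ∂P, ω ∈ A → leftVersion (R Z₁) (toBar s₁) ω ≤ m ω) :
    ∃ B ⊆ A, MeasurableSet B ∧ (∃ᵐ ω ∂P, ω ∈ B) ∧ ∃ y b, NonnegOnSublevel R m B y b ∧
      ∀ᵐ ω ∂P, ω ∈ B → b ω < 0 ∧ dualPairing y b (Z₀.1, s₀) ω < 0 := by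
  have h01 : ∀ᵐ ω ∂P, ω ∈ A → m ω < leftVersion (R ⟨0, zero_mem_polarCone⟩) (toBar 1) ω := by
    filter_upwards [h₀, AEEqFun.coeFn_le.2 (hR.leftVersion_le_zero_one
      (Z₀ := ⟨0, zero_mem_polarCone⟩) rfl Z₀ s₀)] with ω h₀ hle hω
    exact (h₀ hω).trans_le hle
  obtain ⟨y₁, b₁, -, hneg₁, hsub₁⟩ := hR.exists_dualPairing_separating hX hA hpos h01 h₁
  have hB₁ : MeasurableSet (A ∩ {ω | b₁ ω < 0}) :=
    hA.inter (measurableSet_lt b₁.measurable measurable_const)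
  have hpos₁ : ∃ᵐ ω ∂P, ω ∈ A ∩ {ω | b₁ ω < 0} := by
    have heq : dualPairing y₁ b₁ ((0 : WeakDual (L0 P) X), 1) = b₁ :=
      (zero_add _).trans (mul_one b₁)
    rwa [heq] at hneg₁
  obtain ⟨y₂, b₂, hb₂, hneg₂, hsub₂⟩ := hR.exists_dualPairing_separating hX hB₁ hpos₁
    (h₀.mono fun ω h hω => h hω.1) (h₁.mono fun ω h hω => h hω.1)
  set w := dualPairing y₂ b₂ (Z₀.1, s₀)
  obtain ⟨e, he, hew⟩ := exists_nonneg_add_mul_neg (dualPairing y₁ b₁ (Z₀.1, s₀)) w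
  have hBsub : (A ∩ {ω | b₁ ω < 0}) ∩ {ω | w ω < 0} ⊆ A ∩ {ω | b₁ ω < 0} := Set.inter_subset_left
  refine ⟨_, hBsub.trans Set.inter_subset_left,
    hB₁.inter (measurableSet_lt w.measurable measurable_const), hneg₂, y₂ + e • y₁, b₂ + e * b₁,
    NonnegOnSublevel.add_smul (NonnegOnSublevel.mono hsub₂ hBsub)
      (NonnegOnSublevel.mono hsub₁ (hBsub.trans Set.inter_subset_left)) he, ?_⟩
  filter_upwards [hew, AEEqFun.coeFn_le.2 hb₂, AEEqFun.coeFn_zero (μ := P) (β := ℝ),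
    AEEqFun.coeFn_add b₂ (e * b₁), AEEqFun.coeFn_mul e b₁,
    coeFn_dualPairing_add_smul y₂ y₁ b₂ b₁ e (Z₀.1, s₀)]
    with ω hew hb₂ h0 hadd hmul hpair ⟨⟨_, hb₁⟩, hw⟩
  obtain ⟨hepos, hlt⟩ := hew hw
  refine ⟨?_, hpair.trans_lt hlt⟩
  rw [hadd, Pi.add_apply, hmul, Pi.mul_apply]
  exact add_neg_of_nonpos_of_neg (hb₂.trans_eq h0) (mul_neg_of_pos_of_neg hepos hb₁)

theorem exists_lt_and_le_robust (hX : IsConditionallyLocallyConvex P X)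
    (hR : IsMinimalRiskFunction R) (hA : MeasurableSet A) (hpos : ∃ᵐ ω ∂P, ω ∈ A)
    {Z₀ : polarCone (P := P) K} {s₀ : L0 P} {x₀ : X}
    (h₀ : ∀ᵐ ω ∂P, ω ∈ A → m ω < leftVersion (R Z₀) (toBar s₀) ω)
    (hx₀ : ∀ᵐ ω ∂P, ω ∈ A → Z₀.1 x₀ ω ≠ 0 ∨ 0 < s₀ ω) :
    ∃ x, ∃ᵐ ω ∂P, ω ∈ A ∧ Z₀.1 x ω < s₀ ω ∧ m ω ≤ robust R x ω := by
  by_cases hne : ∃ (Z₁ : polarCone (P := P) K) (s₁ : L0 P), ∃ᵐ ω ∂P,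
      ω ∈ A ∩ {ω | leftVersion (R Z₁) (toBar s₁) ω ≤ m ω}
  · obtain ⟨Z₁, s₁, hpos₁⟩ := hne
    obtain ⟨B, hBA, hB, hBpos, y, b, hsub, hneg⟩ := hR.exists_nonnegOnSublevel hX
      (hA.inter (measurableSet_le (AEEqFun.measurable _) m.measurable)) hpos₁
      (h₀.mono fun ω h hω => h hω.1) (.of_forall fun ω hω => hω.2)
    obtain ⟨x, hx, hlt⟩ := hsub.exists_le_robust hR.toIsRiskFunction hB
      (hneg.mono fun ω h hω => (h hω).1)
    refine ⟨x, hBpos.mp ?_⟩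
    filter_upwards [hx, hlt Z₀.1 s₀, hneg] with ω hx hlt hneg hω
    exact ⟨(hBA hω).1, (hlt hω).2 (hneg hω).2, hx hω⟩
  · simp only [not_exists, not_frequently, Set.mem_inter_iff, Set.mem_ofPred_eq, not_and] at hne
    obtain ⟨x, hx⟩ := exists_map_lt Z₀.1 x₀ s₀
    refine ⟨x, hpos.mp ?_⟩
    filter_upwards [hx, hx₀, hR.le_robust_of_forall_le (x := x) hA fun Z s =>
      (hne Z s).mono fun ω h hω hle => absurd hle (h hω)] with ω hx hx₀ hle hω
    exact ⟨hω, hx (hx₀ hω), hle hω⟩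

theorem leftVersion_le_levelSup (hX : IsConditionallyLocallyConvex P X)
    (hR : IsMinimalRiskFunction R) (hα : ∀ x, α x = robust R x) (Z : polarCone (P := P) K)
    (s : L0 P) (x₀ : X) :
    ∀ᵐ ω ∂P, (Z.1 x₀ ω ≠ 0 ∨ 0 < s ω) →
      leftVersion (R Z) (toBar s) ω ≤ levelSup α Z.1 (toBar s) ω := by
  have hrat (q : ℚ) : ∀ᵐ ω ∂P, (Z.1 x₀ ω ≠ 0 ∨ 0 < s ω) →
      levelSup α Z.1 (toBar s) ω < (q : ℝ) → leftVersion (R Z) (toBar s) ω ≤ (q : ℝ) := by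
    let A := {ω | Z.1 x₀ ω ≠ 0 ∨ 0 < s ω} ∩ ({ω | levelSup α Z.1 (toBar s) ω < (q : ℝ)} ∩
      {ω | (q : ℝ) < leftVersion (R Z) (toBar s) ω})
    have hA : MeasurableSet A :=
      (((measurableSet_eq_fun (AEEqFun.measurable _) measurable_const).compl).union
        (measurableSet_lt measurable_const s.measurable)).inter
        ((measurableSet_lt (AEEqFun.measurable _) measurable_const).inter
          (measurableSet_lt measurable_const (AEEqFun.measurable _)))
    by_contra hfreq
    have hpos : ∃ᵐ ω ∂P, ω ∈ A := (not_eventually.1 hfreq).mono fun ω hω => by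
      simp only [Classical.not_imp, not_le] at hω
      exact hω
    obtain ⟨x, hx⟩ := hR.exists_lt_and_le_robust hX hA hpos (m := constBar P q)
      ((coeFn_constBar (P := P) q).mono fun ω h hω => h.trans_lt hω.2.2)
      (.of_forall fun ω hω => hω.1)
    obtain ⟨ω, ⟨hω, hlt, hle⟩, hsup, hbar, hconst⟩ := (hx.and_eventually
      ((le_levelSup α Z.1 (toBar s) x).and ((coeFn_toBar s).and (coeFn_constBar q)))).exists
    rw [hbar, EReal.coe_lt_coe_iff, hα] at hsup
    exact hω.2.1.not_ge (hconst.symm.trans_le (hle.trans (hsup hlt)))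
  filter_upwards [ae_all_iff.2 hrat] with ω hrat hω
  refine le_of_forall_gt fun c hc => ?_
  obtain ⟨q, hq, hqc⟩ := EReal.lt_iff_exists_rat_btwn.1 hc
  exact (hrat q hω hq).trans_lt hqc

theorem eq_minRisk_on (hX : IsConditionallyLocallyConvex P X) (hR : IsMinimalRiskFunction R)
    (hα : ∀ x, α x = robust R x) (Z : polarCone (P := P) K) (s : Lbar P) (x : X) :
    ∀ᵐ ω ∂P, (Z.1 x ω ≠ 0 ∨ 0 ≤ s ω) → R Z s ω = minRisk α Z s ω := by
  have hRs := (hR.localMono Z).rightVersion_lt_iff s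
  rw [← hR.rightContinuous Z] at hRs
  filter_upwards [hRs, (localMono_levelSup α Z.1).rightVersion_lt_iff s,
    ae_all_iff.2 fun q : ℚ => coeFn_constBar (P := P) q,
    ae_all_iff.2 fun q : ℚ => AEEqFun.coeFn_const (μ := P) Ω (q : ℝ),
    ae_all_iff.2 fun q : ℚ => hR.leftVersion_le_levelSup hX hα Z (AEEqFun.const Ω q) x,
    ae_all_iff.2 fun q : ℚ => (hR.localMono Z).le_leftVersion (constBar P q) s,
    ae_all_iff.2 fun q : ℚ => AEEqFun.coeFn_le.2 (hR.levelSup_le_of_robust hα Z (constBar P q)),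
    ae_all_iff.2 fun q : ℚ => (localMono_levelSup α Z.1).rightVersion_le s (constBar P q)]
    with ω hRs hmin hconst hconst' hlevel hleft hsup hright hω
  refine le_antisymm (le_of_forall_gt fun c hc => ?_) (le_of_forall_gt fun c hc => ?_)
  · obtain ⟨q, hsq, hqc⟩ := (hmin c).1 hc
    have hpos : Z.1 x ω ≠ 0 ∨ 0 < AEEqFun.const Ω (q : ℝ) ω := hω.imp_right fun hs => by
      rw [hconst' q]
      exact EReal.coe_pos.1 (hs.trans_lt hsq)
    exact ((hleft q (hsq.trans_eq (hconst q).symm)).trans (hlevel q hpos)).trans_lt hqc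
  · obtain ⟨q, hsq, hqc⟩ := (hRs c).1 hc
    exact ((hright q (hsq.trans_eq (hconst q).symm)).trans (hsup q)).trans_lt hqc

theorem eq_minRisk (hX : IsConditionallyLocallyConvex P X) (hR : IsMinimalRiskFunction R)
    (hnorm : IsNormalizedAtZero R) (hα : ∀ x, α x = robust R x) : R = minRisk α := by
  funext Z s
  let Z₀ : polarCone (P := P) K := ⟨0, zero_mem_polarCone⟩
  let A := {ω | R Z s ω ≠ minRisk α Z s ω}
  have hA : MeasurableSet A :=
    (measurableSet_eq_fun (AEEqFun.measurable _) (AEEqFun.measurable _)).compl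
  have hZ (x : X) : ∀ᵐ ω ∂P, ω ∈ A → Z.1 x ω = Z₀.1 x ω := by
    filter_upwards [hR.eq_minRisk_on hX hα Z s x, AEEqFun.coeFn_zero (μ := P) (β := ℝ)]
      with ω heq h0 hω
    exact (not_not.1 fun hz => hω (heq (.inl hz))).trans h0.symm
  refine AEEqFun.ext ?_
  filter_upwards [hR.eq_minRisk_on hX hα Z s 0, hR.eq_on hA hZ s,
    (minRisk_isRiskFunction α).eq_on hA hZ s, hnorm Z₀ rfl s,
    minRisk_isNormalizedAtZero α Z₀ rfl s] with ω heq hRZ hminZ hRbot hminbot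
  by_contra hω
  have hs : s ω < 0 := not_le.1 fun hs => hω (heq (.inr hs))
  exact hω ((hRZ hω).trans ((hRbot hs).trans ((hminbot hs).symm.trans (hminZ hω).symm)))

end IsMinimalRiskFunction

end Uniqueness

end CondIndex

end

theorem mainTheorem1_general {Ω : Type*} [MeasurableSpace Ω] (P : Measure Ω) [IsFiniteMeasure P]
    {X : Type*} [AddCommGroup X] [Module (L0 P) X] [TopologicalSpace X]
    [IsTopologicalAddGroup X] [ContinuousSMul (L0 P) X]
    (hX : IsConditionallyLocallyConvex P X)
    (K : Set X) (hK : IsConvexCone P K) :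
    (∀ α : X → Lbar P, IsAssessmentIndex K α → IsUSC α →
      (∃! R : polarCone (P := P) K → Lbar P → Lbar P,
        IsMinimalRiskFunction R ∧ IsNormalizedAtZero R ∧ ∀ x, α x = robust R x) ∧
      (∀ R R' : polarCone (P := P) K → Lbar P → Lbar P,
        IsMinimalRiskFunction R → IsMinimalRiskFunction R' →
        (∀ x, α x = robust R x) → (∀ x, α x = robust R' x) →
        ∀ (Z : polarCone (P := P) K) (s : Lbar P) (x : X),
          ∀ᵐ ω ∂P, (Z.1 x ω ≠ 0 ∨ 0 ≤ s ω) → R Z s ω = R' Z s ω)) ∧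
    (∀ R : polarCone (P := P) K → Lbar P → Lbar P, IsRiskFunction R →
      IsAssessmentIndex K (robust R) ∧ IsUSC (robust R)) := by
  refine ⟨fun α hα husc => ⟨⟨minRisk α, ⟨minRisk_isMinimal α, minRisk_isNormalizedAtZero α,
      robust_minRisk hX hK hα husc⟩, fun R ⟨hR, hnorm, hRα⟩ => hR.eq_minRisk hX hnorm hRα⟩,
    fun R R' hR hR' hRα hRα' Z s x => ?_⟩,
    fun R hR => ⟨hR.robust_isAssessmentIndex, hR.robust_isUSC⟩⟩
  filter_upwards [hR.eq_minRisk_on hX hRα Z s x, hR'.eq_minRisk_on hX hRα' Z s x]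
    with ω hmin hmin' hω
  exact (hmin hω).trans (hmin' hω).symm

theorem mainTheorem1 {Ω : Type*} [MeasurableSpace Ω] (P : Measure Ω) [IsProbabilityMeasure P]
    {X : Type*} [AddCommGroup X] [Module (L0 P) X] [TopologicalSpace X]
    [IsTopologicalAddGroup X] [ContinuousSMul (L0 P) X]
    (hX : IsConditionallyLocallyConvex P X)
    (K : Set X) (hK : IsConvexCone P K) (hKclosed : IsClosed K) :
    (∀ α : X → Lbar P, IsAssessmentIndex K α → IsUSC α →
      (∃! R : polarCone (P := P) K → Lbar P → Lbar P,
        IsMinimalRiskFunction R ∧ IsNormalizedAtZero R ∧ ∀ x, α x = robust R x) ∧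
      (∀ R R' : polarCone (P := P) K → Lbar P → Lbar P,
        IsMinimalRiskFunction R → IsMinimalRiskFunction R' →
        (∀ x, α x = robust R x) → (∀ x, α x = robust R' x) →
        ∀ (Z : polarCone (P := P) K) (s : Lbar P) (x : X),
          ∀ᵐ ω ∂P, (Z.1 x ω ≠ 0 ∨ 0 ≤ s ω) → R Z s ω = R' Z s ω)) ∧
    (∀ R : polarCone (P := P) K → Lbar P → Lbar P, IsRiskFunction R →
      IsAssessmentIndex K (robust R) ∧ IsUSC (robust R)) :=
  mainTheorem1_general P hX K hK
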